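/- **Setting.** A market has $n$ customers $\mathcal C$ and $m$ suppliers $\mathcal S$. Every customer $i$ has a choice model: for each assortment $S\subseteq\mathcal S$, a probability distribution $\phi_i(\cdot,S)$ on $S\cup\{0\}$, where $0$ is the outside option; its demand function is $f_i(S)=\sum_{j\in S}\phi_i(j,S)$. Symmetrically, every supplier $j$ has a choice model $\phi_j(\cdot,C)$, $C\subseteq\mathcal C$, with demand function $f_j$. All demand functions are assumed monotone and submodular, and for every agent $a$ there is an oracle that, given nonnegative weights $\theta$, returns an assortment maximizing $\sum_{b\in A}\theta_b\,\phi_a(b,A)$ over all assortments $A$. Let $\phi_{\min}$ be the smallest positive value of $\max_A\phi_a(b,A)$ over all agents $a$ (of both sides) and all agents $b$ of the side opposite to $a$. A *one-sided adaptive policy* commits to an initiating side, processes the agents of this side one by one (in a possibly random and adaptive order, showing each agent one possibly random assortment, which may depend on all earlier choices, and observing its choice), and then processes all agents of the other side. Choices are independent given the assortments; a match is a pair who chose each other. The *backlog* of a responding agent is the set of initiating agents who chose it; responding agents are shown subsets of their backlogs. $\mathrm{OPT}_{\sf OA}$ is the supremum of the expected number of matches over all one-sided adaptive policies (both initiating sides).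 *Greedy* for initiating side $\mathcal C$ and a given order of $\mathcal C$ processes the customers in this order and, with current backlogs $C_j$, shows customer $i$ the assortment returned by its oracle for the weights $\theta_j=f_j(C_j\cup\{i\})-f_j(C_j)$; then each supplier is shown its backlog. Greedy for $\mathcal S$ is symmetric. The *sampling policy* with $T$ runs and given (arbitrary) orders of $\mathcal C$ and $\mathcal S$ simulates, for each of the two initiating sides, $T$ independent runs of greedy, takes as estimate of that side the average over the runs of the sum of the responding agents' demands at their final backlogs, selects the side with the larger estimate (customers in a tie), and runs greedy with that initiating side on the actual agents. **Statement.** There is a constant $\kappa>0$ such that for every such market, all orders of the two sides, all $\epsilon>0$ and $\delta\in(0,1)$, and every $$T\ \ge\ \kappa\cdot\frac{\log(1/\delta)}{\epsilon^{2}\,\phi_{\min}},$$ with probability at least $1-2\delta$ over the simulated runs both the expected number of matches of the selected greedy policy and the larger of the two estimates are at least $(1/2-\epsilon)\cdot\mathrm{OPT}_{\sf OA}$. In particular $O\!\left(\frac{\log(1/\delta)}{\epsilon^2\phi_{\min}}\right)$ runs per side, rounded up, suffice. Moreover, the sampling policy is carried out by one fixed program whose running time, with unit-cost arithmetic and comparisons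 on real numbers and with unit-cost instructions (up to an additional charge $n+m$) for evaluating a choice probability, calling an oracle, simulating a choice and showing an assortment to an agent, is at most $c\,(n+m+1)^d\,(T+1)$ for absolute constants $c,d$; hence it is pseudo-polynomial. Finally, if all choice models are weakly substitutable ($\phi_a(b,A)\ge\phi_a(b,A')$ for all $A\subseteq A'$ and $b\in A\cup\{0\}$), then $\mathrm{OPT}_{\sf OA}$ is also the supremum over all one-sided adaptive policies in which responding agents may be shown arbitrary assortments. -/

import Mathlib

open scoped ENNReal

noncomputable section

/-! ### Choice models and markets -/

/-- A discrete choice model over the alternatives `Fin k`.  Facing an assortment `A`, the agent picks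
at random an alternative of `A` or the outside option `none`. -/
structure ChoiceModel (k : ℕ) where
  law : Finset (Fin k) → PMF (Option (Fin k))
  law_eq_zero : ∀ (A : Finset (Fin k)) (j : Fin k), j ∉ A → law A (some j) = 0

/-- The choice probability `φ(o, A)`. -/
def ChoiceModel.prob {k : ℕ} (φ : ChoiceModel k) (o : Option (Fin k)) (A : Finset (Fin k)) : ℝ :=
  (φ.law A o).toReal

/-- The demand function `f(A) = ∑_{j ∈ A} φ(j, A)`. -/
def ChoiceModel.demand {k : ℕ} (φ : ChoiceModel k) (A : Finset (Fin k)) : ℝ :=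
  ∑ j ∈ A, φ.prob (some j) A

/-- Objective of the single-agent assortment problem with weights `θ`. -/
def ChoiceModel.revenue {k : ℕ} (φ : ChoiceModel k) (θ : Fin k → ℝ) (A : Finset (Fin k)) : ℝ :=
  ∑ j ∈ A, θ j * φ.prob (some j) A

/-- The largest probability `max_A φ(j, A)` with which `j` can be chosen. -/
def ChoiceModel.maxProb {k : ℕ} (φ : ChoiceModel k) (j : Fin k) : ℝ :=
  ⨆ A : Finset (Fin k), φ.prob (some j) A

/-- Enlarging the assortment never makes an option, inside or outside, more likely. -/
def ChoiceModel.WeaklySubstitutable {k : ℕ} (φ : ChoiceModel k) : Prop :=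
  ∀ A B : Finset (Fin k), A ⊆ B →
    φ.prob none B ≤ φ.prob none A ∧ ∀ j ∈ A, φ.prob (some j) B ≤ φ.prob (some j) A

def IsMonotoneSubmodular {k : ℕ} (f : Finset (Fin k) → ℝ) : Prop :=
  (∀ A B : Finset (Fin k), A ⊆ B → f A ≤ f B) ∧
    ∀ (A B : Finset (Fin k)) (e : Fin k), A ⊆ B → e ∉ B →
      f (insert e B) - f B ≤ f (insert e A) - f A

/-- A two-sided market with `n` customers and `m` suppliers. -/
structure Market (n m : ℕ) where
  customer : Fin n → ChoiceModel m
  supplier : Fin m → ChoiceModel n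

/-- The same market with the roles of the two sides exchanged. -/
def Market.swap {n m : ℕ} (M : Market n m) : Market m n where
  customer := M.supplier
  supplier := M.customer

/-- All demand functions are monotone and submodular. -/
def Market.HasMonotoneSubmodularDemand {n m : ℕ} (M : Market n m) : Prop :=
  (∀ i, IsMonotoneSubmodular (M.customer i).demand) ∧
    ∀ j, IsMonotoneSubmodular (M.supplier j).demand

def Market.WeaklySubstitutable {n m : ℕ} (M : Market n m) : Prop :=
  (∀ i, (M.customer i).WeaklySubstitutable) ∧ ∀ j, (M.supplier j).WeaklySubstitutable

/-- `φ_min`: the smallest positive value of `max_A φ_a(b, A)`, over the agents `a` of both sides and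
the agents `b` of the side opposite to `a`. -/
def Market.phiMin {n m : ℕ} (M : Market n m) : ℝ :=
  sInf ({p | 0 < p ∧ ∃ (i : Fin n) (j : Fin m), p = (M.customer i).maxProb j} ∪
    {p | 0 < p ∧ ∃ (j : Fin m) (i : Fin n), p = (M.supplier j).maxProb i})

/-- Single-agent assortment oracles: for every agent and all nonnegative weights, a maximizer of the
unconstrained assortment problem of that agent. -/
structure Market.Oracle {n m : ℕ} (M : Market n m) where
  customer : Fin n → (Fin m → ℝ) → Finset (Fin m)
  supplier : Fin m → (Fin n → ℝ) → Finset (Fin n)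
  customer_optimal : ∀ (i : Fin n) (θ : Fin m → ℝ), (∀ j, 0 ≤ θ j) → ∀ A : Finset (Fin m),
    (M.customer i).revenue θ A ≤ (M.customer i).revenue θ (customer i θ)
  supplier_optimal : ∀ (j : Fin m) (θ : Fin n → ℝ), (∀ i, 0 ≤ θ i) → ∀ A : Finset (Fin n),
    (M.supplier j).revenue θ A ≤ (M.supplier j).revenue θ (supplier j θ)

def Market.Oracle.swap {n m : ℕ} {M : Market n m} (O : M.Oracle) : M.swap.Oracle where
  customer := O.supplier
  supplier := O.customer
  customer_optimal := O.supplier_optimal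
  supplier_optimal := O.customer_optimal

/-! ### One-sided adaptive policies -/

/-- One interaction: an agent of a side of size `N`, the assortment of agents of the opposite side
(of size `K`) shown to it, and its choice. -/
abbrev Step (N K : ℕ) : Type := Fin N × Finset (Fin K) × Option (Fin K)

/-- The histories (latest interaction first) that a decision rule can generate. -/
def IsHistory {N K : ℕ}
    (next : (h : List (Step N K)) → h.length < N → PMF (Fin N × Finset (Fin K))) :
    List (Step N K) → Prop
  | [] => True
  | s :: h => IsHistory next h ∧ ∃ hl : h.length < N, (s.1, s.2.1) ∈ (next h hl).support

/-- A randomized adaptive strategy that processes the agents of one side one by one, each exactly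
once: after the history `h`, it picks the next agent and the assortment shown to it. -/
structure Strategy (N K : ℕ) where
  next : (h : List (Step N K)) → h.length < N → PMF (Fin N × Finset (Fin K))
  fresh : ∀ (h : List (Step N K)) (hl : h.length < N), IsHistory next h →
    ∀ a ∈ (next h hl).support, a.1 ∉ h.map Prod.fst

/-- Law of the history after `t` rounds, for agents with the choice models `φ`. -/
def Strategy.partialLaw {N K : ℕ} (σ : Strategy N K) (φ : Fin N → ChoiceModel K) :
    ℕ → PMF (List (Step N K))
  | 0 => PMF.pure []
  | t + 1 => (σ.partialLaw φ t).bind fun h =>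
      if hl : h.length < N then
        (σ.next h hl).bind fun a => ((φ a.1).law a.2).map fun o => (a.1, a.2, o) :: h
      else PMF.pure h

/-- Law of the complete history, when all agents have been processed. -/
def Strategy.law {N K : ℕ} (σ : Strategy N K) (φ : Fin N → ChoiceModel K) :
    PMF (List (Step N K)) :=
  σ.partialLaw φ N

/-- The agents that chose `j` in the history `h`. -/
def backlog {N K : ℕ} (h : List (Step N K)) (j : Fin K) : Finset (Fin N) :=
  Finset.univ.filter fun i => ∃ A : Finset (Fin K), (i, A, some j) ∈ h

/-- The number of pairs that selected each other. -/
def matchCount {N K : ℕ} (h : List (Step N K)) (k : List (Step K N)) : ℕ :=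
  (Finset.univ.filter fun p : Fin N × Fin K => p.1 ∈ backlog h p.2 ∧ p.2 ∈ backlog k p.1).card

/-- An adaptive policy for an initiating side of size `N` and a responding side of size `K`: the
initiating side is processed one by one, and then the responding side.  (Processing the responding
side all at once is the case in which `second h` ignores the answers it gets.) -/
structure Policy (N K : ℕ) where
  first : Strategy N K
  second : List (Step N K) → Strategy K N

/-- Law of the pair of histories of the two phases; the first component of `M` initiates. -/
def Policy.law {N K : ℕ} (π : Policy N K) (M : Market N K) :
    PMF (List (Step N K) × List (Step K N)) :=
  (π.first.law M.customer).bind fun h => ((π.second h).law M.supplier).map fun k => (h, k)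

def Policy.expectedMatches {N K : ℕ} (π : Policy N K) (M : Market N K) : ℝ≥0∞ :=
  ∑' r : List (Step N K) × List (Step K N), π.law M r * (matchCount r.1 r.2 : ℝ≥0∞)

/-- Responding agents are shown only agents that have chosen them. -/
def Policy.ServesBacklog {N K : ℕ} (π : Policy N K) : Prop :=
  ∀ (h : List (Step N K)) (k : List (Step K N)) (hl : k.length < K),
    ∀ b ∈ ((π.second h).next k hl).support, b.2 ⊆ backlog h b.1

/-- One-sided adaptive policies: they commit to an initiating side. -/
inductive OneSidedPolicy (n m : ℕ) where
  | customersFirst (π : Policy n m) : OneSidedPolicy n m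
  | suppliersFirst (π : Policy m n) : OneSidedPolicy n m

/-- Expected number of matches. -/
def OneSidedPolicy.value {n m : ℕ} (M : Market n m) : OneSidedPolicy n m → ℝ≥0∞
  | .customersFirst π => π.expectedMatches M
  | .suppliersFirst π => π.expectedMatches M.swap

def OneSidedPolicy.ServesBacklog {n m : ℕ} : OneSidedPolicy n m → Prop
  | .customersFirst π => π.ServesBacklog
  | .suppliersFirst π => π.ServesBacklog

/-- The complete record of interactions, latest first: customers on the left, suppliers on the
right. -/
abbrev Transcript (n m : ℕ) : Type := List (Step n m ⊕ Step m n)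

def OneSidedPolicy.transcriptLaw {n m : ℕ} (M : Market n m) :
    OneSidedPolicy n m → PMF (Transcript n m)
  | .customersFirst π => (π.law M).map fun r => r.2.map Sum.inr ++ r.1.map Sum.inl
  | .suppliersFirst π => (π.law M.swap).map fun r => r.2.map Sum.inl ++ r.1.map Sum.inr

/-- Optimum over all one-sided adaptive policies whose responding agents are shown only agents that
have chosen them. -/
def Market.opt {n m : ℕ} (M : Market n m) : ℝ≥0∞ :=
  ⨆ (π : OneSidedPolicy n m) (_ : π.ServesBacklog), π.value M

/-- Optimum over all one-sided adaptive policies, with arbitrary assortments in both phases. -/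
def Market.optUnrestricted {n m : ℕ} (M : Market n m) : ℝ≥0∞ :=
  ⨆ π : OneSidedPolicy n m, π.value M

/-! ### The greedy policy -/

/-- Assortment that the greedy rule shows to the agent `i` of the initiating side: it maximizes the
choice-weighted marginal demand of the responding side given the current backlogs. -/
def greedyAssortment {N K : ℕ} (M : Market N K) (O : M.Oracle) (h : List (Step N K)) (i : Fin N) :
    Finset (Fin K) :=
  O.customer i fun j =>
    (M.supplier j).demand (insert i (backlog h j)) - (M.supplier j).demand (backlog h j)

/-- Greedy processing of the initiating side in the order `σ 0, σ 1, …`. -/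
def greedyFirst {N K : ℕ} (M : Market N K) (O : M.Oracle) (σ : Equiv.Perm (Fin N)) :
    Strategy N K where
  next h hl := PMF.pure (σ ⟨h.length, hl⟩, greedyAssortment M O h (σ ⟨h.length, hl⟩))
  fresh := by
    intro h hl hh a ha
    have key : ∀ h : List (Step N K),
        IsHistory (fun h hl => PMF.pure (σ ⟨h.length, hl⟩,
          greedyAssortment M O h (σ ⟨h.length, hl⟩))) h →
        ∀ x ∈ h.map Prod.fst, (σ.symm x : ℕ) < h.length := by
      intro h
      induction h with
      | nil => simp
      | cons s h ih =>
        rintro ⟨h1, hl, h2⟩ x hx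
        rw [PMF.mem_support_pure_iff, Prod.mk.injEq] at h2
        rw [List.map_cons, List.mem_cons] at hx
        rcases hx with rfl | hx
        · rw [h2.1]; simp
        · exact (ih h1 x hx).trans (by simp)
    rw [PMF.mem_support_pure_iff] at ha
    intro hmem
    have := key h hh _ hmem
    rw [ha] at this
    simp at this

/-- Every responding agent is shown exactly its backlog. -/
def showBacklog {N K : ℕ} (h : List (Step N K)) : Strategy K N where
  next k hl := PMF.pure (⟨k.length, hl⟩, backlog h ⟨k.length, hl⟩)
  fresh := by
    intro k hl hk a ha
    have key : ∀ k : List (Step K N),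
        IsHistory (fun k hl => PMF.pure
          ((⟨k.length, hl⟩ : Fin K), backlog h ⟨k.length, hl⟩)) k →
        ∀ x ∈ k.map Prod.fst, (x : ℕ) < k.length := by
      intro k
      induction k with
      | nil => simp
      | cons s k ih =>
        rintro ⟨h1, hl, h2⟩ x hx
        rw [PMF.mem_support_pure_iff, Prod.mk.injEq] at h2
        rw [List.map_cons, List.mem_cons] at hx
        rcases hx with rfl | hx
        · rw [h2.1]; simp
        · exact (ih h1 x hx).trans (by simp)
    rw [PMF.mem_support_pure_iff] at ha
    intro hmem
    have := key k hk _ hmem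
    rw [ha] at this
    simp at this

/-- The arbitrary-order greedy policy. -/
def greedyPolicy {N K : ℕ} (M : Market N K) (O : M.Oracle) (σ : Equiv.Perm (Fin N)) :
    Policy N K where
  first := greedyFirst M O σ
  second := showBacklog

/-! ### The sampling policy -/

/-- Result of one simulated greedy run: the expected number of matches `∑_j f_j(C_j)` given the final
backlogs `C_j`. -/
def greedyRun {N K : ℕ} (M : Market N K) (O : M.Oracle) (σ : Equiv.Perm (Fin N)) : PMF ℝ :=
  ((greedyFirst M O σ).law M.customer).map fun h =>
    ∑ j : Fin K, (M.supplier j).demand (backlog h j)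

/-- `T` independent draws. -/
def independentRuns (p : PMF ℝ) : ℕ → PMF (List ℝ)
  | 0 => PMF.pure []
  | T + 1 => (independentRuns p T).bind fun l => p.map fun x => x :: l

/-- Law of the average of `T` independent simulated greedy runs. -/
def sampleAverage {N K : ℕ} (M : Market N K) (O : M.Oracle) (σ : Equiv.Perm (Fin N)) (T : ℕ) :
    PMF ℝ :=
  (independentRuns (greedyRun M O σ) T).map fun l => l.sum / T

/-- Joint law of the (independent) estimates for customers first and for suppliers first. -/
def estimates {n m : ℕ} (M : Market n m) (O : M.Oracle) (σC : Equiv.Perm (Fin n))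
    (σS : Equiv.Perm (Fin m)) (T : ℕ) : PMF (ℝ × ℝ) :=
  (sampleAverage M O σC T).bind fun a => (sampleAverage M.swap O.swap σS T).map fun b => (a, b)

/-- The greedy policy on the side with the larger estimate. -/
def selectedPolicy {n m : ℕ} (M : Market n m) (O : M.Oracle) (σC : Equiv.Perm (Fin n))
    (σS : Equiv.Perm (Fin m)) (e : ℝ × ℝ) : OneSidedPolicy n m :=
  open Classical in
  if e.2 ≤ e.1 then .customersFirst (greedyPolicy M O σC)
  else .suppliersFirst (greedyPolicy M.swap O.swap σS)

/-! ### Programs and running time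

A small imperative language over a memory of integer and real arrays, in the unit-cost real-number
model.  The market is accessible only through four instructions: evaluating a choice probability,
calling the assortment oracle, simulating a choice, and actually showing an assortment to an agent. -/

inductive IntExpr where
  | lit (k : ℕ)
  | cell (arr : ℕ) (row col : IntExpr)
  | add (a b : IntExpr)
  | sub (a b : IntExpr)

/-- Integer arrays: name, row, column. -/
abbrev IntMem : Type := ℕ → ℕ → ℕ → ℕ

/-- Real arrays: name, index. -/
abbrev RealMem : Type := ℕ → ℕ → ℝ

def IntExpr.eval (I : IntMem) : IntExpr → ℕ
  | .lit k => k
  | .cell arr row col => I arr (row.eval I) (col.eval I)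
  | .add a b => a.eval I + b.eval I
  | .sub a b => a.eval I - b.eval I

def IntExpr.size : IntExpr → ℕ
  | .lit _ => 1
  | .cell _ row col => row.size + col.size + 1
  | .add a b => a.size + b.size + 1
  | .sub a b => a.size + b.size + 1

inductive RealExpr where
  | ofInt (e : IntExpr)
  | cell (arr : ℕ) (idx : IntExpr)
  | add (a b : RealExpr)
  | sub (a b : RealExpr)
  | mul (a b : RealExpr)
  | div (a b : RealExpr)

def RealExpr.eval (I : IntMem) (R : RealMem) : RealExpr → ℝ
  | .ofInt e => (e.eval I : ℝ)
  | .cell arr idx => R arr (idx.eval I)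
  | .add a b => a.eval I R + b.eval I R
  | .sub a b => a.eval I R - b.eval I R
  | .mul a b => a.eval I R * b.eval I R
  | .div a b => a.eval I R / b.eval I R

def RealExpr.size : RealExpr → ℕ
  | .ofInt e => e.size + 1
  | .cell _ idx => idx.size + 1
  | .add a b => a.size + b.size + 1
  | .sub a b => a.size + b.size + 1
  | .mul a b => a.size + b.size + 1
  | .div a b => a.size + b.size + 1

inductive Side where
  | customer
  | supplier

/-- Sets of agents are stored as rows of an integer array (nonzero entry = member); options are coded
by integers (`0` = outside option, `j + 1` = agent `j`). -/
inductive Stmt where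
  | skip
  | seq (s t : Stmt)
  | setInt (arr : ℕ) (row col e : IntExpr)
  | setReal (arr : ℕ) (idx : IntExpr) (e : RealExpr)
  /-- if `a ≤ b` then `s` else `t` -/
  | ifInt (a b : IntExpr) (s t : Stmt)
  /-- if `a ≤ b` then `s` else `t` -/
  | ifReal (a b : RealExpr) (s t : Stmt)
  /-- for `c = 0, …, e - 1`, with `c` in the cell `(ctr, 0, 0)`; `e` is evaluated once -/
  | loop (ctr : ℕ) (e : IntExpr) (body : Stmt)
  /-- `dst[idx] := φ_agent(opt, A)` with `A` the set in row `row` of `arr` -/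
  | evalChoice (side : Side) (agent opt : IntExpr) (arr : ℕ) (row : IntExpr) (dst : ℕ)
      (idx : IntExpr)
  /-- row `row` of `arr` := answer of the assortment oracle of `agent` for the weights in `w` -/
  | optimize (side : Side) (agent : IntExpr) (w : ℕ) (arr : ℕ) (row : IntExpr)
  /-- simulate the choice of `agent` from the set in row `row` of `arr`; result in `dst[r, c]` -/
  | simulate (side : Side) (agent : IntExpr) (arr : ℕ) (row : IntExpr) (dst : ℕ) (r c : IntExpr)
  /-- process `agent`: show it the set in row `row` of `arr`; its choice is stored in `dst[r, c]` -/
  | process (side : Side) (agent : IntExpr) (arr : ℕ) (row : IntExpr) (dst : ℕ) (r c : IntExpr)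

structure Memory (n m : ℕ) where
  ints : IntMem
  reals : RealMem
  /-- the actual interactions so far, latest first -/
  transcript : Transcript n m
  /-- the running time so far -/
  steps : ℕ

namespace Memory

variable {n m : ℕ}

def tick (s : Memory n m) (c : ℕ) : Memory n m := { s with steps := s.steps + c }

def setInt (s : Memory n m) (arr row col v : ℕ) : Memory n m :=
  { s with ints := fun a r c => if a = arr ∧ r = row ∧ c = col then v else s.ints a r c }

def setReal (s : Memory n m) (arr idx : ℕ) (v : ℝ) : Memory n m :=
  { s with reals := fun a i => if a = arr ∧ i = idx then v else s.reals a i }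

def record (s : Memory n m) (x : Step n m ⊕ Step m n) : Memory n m :=
  { s with transcript := x :: s.transcript }

/-- The set stored in a row of an integer array. -/
def getSet (s : Memory n m) (k arr row : ℕ) : Finset (Fin k) :=
  Finset.univ.filter fun j => s.ints arr row j ≠ 0

/-- Stores a set in a row of an integer array. -/
def putSet (s : Memory n m) {k : ℕ} (arr row : ℕ) (A : Finset (Fin k)) : Memory n m :=
  { s with ints := fun a r c =>
      if h : a = arr ∧ r = row ∧ c < k then (if (⟨c, h.2.2⟩ : Fin k) ∈ A then 1 else 0)
      else s.ints a r c }

/-- Initial memory: `n`, `m`, `T` in the cells `(0, 0, 0)`, `(0, 0, 1)`, `(0, 0, 2)`, the orders of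
the two sides in the arrays `1` and `2`, and zero everywhere else. -/
def init (σC : Equiv.Perm (Fin n)) (σS : Equiv.Perm (Fin m)) (T : ℕ) : Memory n m where
  ints a r c :=
    if r ≠ 0 then 0
    else if a = 0 then (if c = 0 then n else if c = 1 then m else if c = 2 then T else 0)
    else if a = 1 then (if h : c < n then (σC ⟨c, h⟩ : ℕ) else 0)
    else if a = 2 then (if h : c < m then (σS ⟨c, h⟩ : ℕ) else 0)
    else 0
  reals _ _ := 0
  transcript := []
  steps := 0

end Memory

def encodeOption {k : ℕ} : Option (Fin k) → ℕ
  | none => 0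
  | some j => j + 1

def decodeOption (k : ℕ) : ℕ → Option (Fin k)
  | 0 => none
  | j + 1 => if h : j < k then some ⟨j, h⟩ else none

/-- Iterates a randomized loop body. -/
def iterate {α : Type} (body : ℕ → α → PMF α) : ℕ → α → PMF α
  | 0, s => PMF.pure s
  | c + 1, s => (iterate body c s).bind (body c)

/-- Law of the memory after running a program.  Every instruction is charged one step, plus the size
of the expressions it evaluates, plus the size of the sides whose sets or weights it reads or
writes.  Instructions addressed to a nonexistent agent have no effect. -/
def Stmt.run {n m : ℕ} (M : Market n m) (O : M.Oracle) : Stmt → Memory n m → PMF (Memory n m)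
  | .skip, s => PMF.pure (s.tick 1)
  | .seq p q, s => (p.run M O s).bind (q.run M O)
  | .setInt arr row col e, s =>
      PMF.pure ((s.setInt arr (row.eval s.ints) (col.eval s.ints) (e.eval s.ints)).tick
        (1 + row.size + col.size + e.size))
  | .setReal arr idx e, s =>
      PMF.pure ((s.setReal arr (idx.eval s.ints) (e.eval s.ints s.reals)).tick
        (1 + idx.size + e.size))
  | .ifInt a b p q, s =>
      if a.eval s.ints ≤ b.eval s.ints then p.run M O (s.tick (1 + a.size + b.size))
      else q.run M O (s.tick (1 + a.size + b.size))
  | .ifReal a b p q, s =>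
      open Classical in
      if a.eval s.ints s.reals ≤ b.eval s.ints s.reals then
        p.run M O (s.tick (1 + a.size + b.size))
      else q.run M O (s.tick (1 + a.size + b.size))
  | .loop ctr e body, s =>
      iterate (fun c s' => body.run M O ((s'.setInt ctr 0 0 c).tick 1)) (e.eval s.ints)
        (s.tick (1 + e.size))
  | .evalChoice side agent opt arr row dst idx, s =>
      let a := agent.eval s.ints
      let s' := s.tick (1 + agent.size + opt.size + row.size + idx.size + n + m)
      match side with
      | .customer =>
          if h : a < n then
            PMF.pure (s'.setReal dst (idx.eval s.ints) ((M.customer ⟨a, h⟩).prob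
              (decodeOption m (opt.eval s.ints)) (s.getSet m arr (row.eval s.ints))))
          else PMF.pure s'
      | .supplier =>
          if h : a < m then
            PMF.pure (s'.setReal dst (idx.eval s.ints) ((M.supplier ⟨a, h⟩).prob
              (decodeOption n (opt.eval s.ints)) (s.getSet n arr (row.eval s.ints))))
          else PMF.pure s'
  | .optimize side agent w arr row, s =>
      let a := agent.eval s.ints
      let s' := s.tick (1 + agent.size + row.size + n + m)
      match side with
      | .customer =>
          if h : a < n then
            PMF.pure (s'.putSet arr (row.eval s.ints) (O.customer ⟨a, h⟩ fun j => s.reals w j))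
          else PMF.pure s'
      | .supplier =>
          if h : a < m then
            PMF.pure (s'.putSet arr (row.eval s.ints) (O.supplier ⟨a, h⟩ fun i => s.reals w i))
          else PMF.pure s'
  | .simulate side agent arr row dst r c, s =>
      let a := agent.eval s.ints
      let s' := s.tick (1 + agent.size + row.size + r.size + c.size + n + m)
      match side with
      | .customer =>
          if h : a < n then
            ((M.customer ⟨a, h⟩).law (s.getSet m arr (row.eval s.ints))).map fun o =>
              s'.setInt dst (r.eval s.ints) (c.eval s.ints) (encodeOption o)
          else PMF.pure s'
      | .supplier =>
          if h : a < m then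
            ((M.supplier ⟨a, h⟩).law (s.getSet n arr (row.eval s.ints))).map fun o =>
              s'.setInt dst (r.eval s.ints) (c.eval s.ints) (encodeOption o)
          else PMF.pure s'
  | .process side agent arr row dst r c, s =>
      let a := agent.eval s.ints
      let s' := s.tick (1 + agent.size + row.size + r.size + c.size + n + m)
      match side with
      | .customer =>
          if h : a < n then
            ((M.customer ⟨a, h⟩).law (s.getSet m arr (row.eval s.ints))).map fun o =>
              (s'.setInt dst (r.eval s.ints) (c.eval s.ints) (encodeOption o)).record
                (Sum.inl (⟨a, h⟩, s.getSet m arr (row.eval s.ints), o))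
          else PMF.pure s'
      | .supplier =>
          if h : a < m then
            ((M.supplier ⟨a, h⟩).law (s.getSet n arr (row.eval s.ints))).map fun o =>
              (s'.setInt dst (r.eval s.ints) (c.eval s.ints) (encodeOption o)).record
                (Sum.inr (⟨a, h⟩, s.getSet n arr (row.eval s.ints), o))
          else PMF.pure s'

/-- The program carries out the sampling policy with `T` simulated runs per side: it leaves the two
estimates in the real cells `(0, 0)` and `(0, 1)`, and its interactions with the agents are those of
the policy selected by these estimates. -/
def Stmt.ImplementsSamplingPolicy {n m : ℕ} (p : Stmt) (M : Market n m) (O : M.Oracle)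
    (σC : Equiv.Perm (Fin n)) (σS : Equiv.Perm (Fin m)) (T : ℕ) : Prop :=
  (p.run M O (Memory.init σC σS T)).map (fun s => ((s.reals 0 0, s.reals 0 1), s.transcript)) =
    (estimates M O σC σS T).bind fun e =>
      ((selectedPolicy M O σC σS e).transcriptLaw M).map fun tr => (e, tr)

end

/-! Write D for the sum of the responding agents' demands at their backlogs. Showing each responding
agent its full backlog is the best second phase: among subsets of the backlog because demand is
monotone, among all assortments because of weak substitutability. A one-sided policy is therefore
worth at most the mean of D after its first phase, with equality for greedy.

The guarantee 1/2 comes from a potential. Fix an outcome c of greedy with backlogs C_j, and let any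
strategy build a history k with backlogs K_j. The sum of f_j(C_j ∪ K_j), plus the best expected gain
at c of every agent that k has not processed, is a supermartingale (`sum_prob_mul_comparison_le`),
since by submodularity a choice gains no more over C_j ∪ K_j than over C_j. So no strategy collects
more in mean than D(c) plus all best gains at c. Backlogs only grow, so an agent's best gain at c is
at most the one greedy had when it processed that agent. Those conditional gains add up to the
compensator of D, whose mean is the mean of D. Averaging over c bounds every strategy by twice the
greedy value (`mean_totalDemand_le`), and the better of the two sides has value at least OPT/2.

The number of runs depends on the market only through φ_min because the same potential controls the
fluctuations of D: from every greedy history the expected further gain is at most twice the greedy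
value (`greedyExpectation_sub_le`), and any single possible increment is at most twice the greedy
value divided by φ_min (`phiMin_mul_demand_le`). A backward induction turns this into an exponential
moment bound (`greedyExpectation_exp_le`), and Chernoff's method at scale OPT gives both tails. Two
events of probability at most δ remain: the better side has average at most (1/2 - ε/2) OPT, or the
other side has value below (1/2 - ε) OPT but average at least (1/2 - ε/2) OPT. Outside them the
selection is good (`selection_of_estimates`).

For the algorithmic claim an explicit program is verified by coupling its final memory with the
random object it should draw (`Stmt.Draws`). A syntactic frame lemma says what is preserved,
exchanging the two sides halves the work, and the running time is read off from the nesting of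
loops. -/

open scoped ENNReal

noncomputable section

/-! ### Expectations of nonnegative functions -/

namespace PMF

variable {α β : Type*}

/-- The expectation of a nonnegative function. -/
def mean (p : PMF α) (f : α → ℝ≥0∞) : ℝ≥0∞ := ∑' a, p a * f a

theorem mean_pure (a : α) (f : α → ℝ≥0∞) : (PMF.pure a).mean f = f a := by
  unfold mean
  rw [tsum_eq_single a]
  · simp
  · intro b hb
    simp [PMF.pure_apply, hb]

theorem mean_bind (p : PMF α) (q : α → PMF β) (f : β → ℝ≥0∞) :
    (p.bind q).mean f = p.mean fun a => (q a).mean f := by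
  unfold mean
  simp only [PMF.bind_apply, ← ENNReal.tsum_mul_right, ← ENNReal.tsum_mul_left]
  rw [ENNReal.tsum_comm]
  simp only [mul_assoc]

theorem mean_map (p : PMF α) (g : α → β) (f : β → ℝ≥0∞) :
    (p.map g).mean f = p.mean fun a => f (g a) := by
  rw [← PMF.bind_pure_comp, mean_bind]
  simp [mean_pure]

theorem mean_mono (p : PMF α) {f g : α → ℝ≥0∞} (h : ∀ a ∈ p.support, f a ≤ g a) :
    p.mean f ≤ p.mean g := by
  refine ENNReal.tsum_le_tsum fun a => ?_
  by_cases ha : a ∈ p.support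
  · exact mul_le_mul_right (h a ha) _
  · rw [PMF.mem_support_iff, not_not] at ha
    simp [ha]

theorem mean_congr (p : PMF α) {f g : α → ℝ≥0∞} (h : ∀ a ∈ p.support, f a = g a) :
    p.mean f = p.mean g :=
  le_antisymm (p.mean_mono fun a ha => (h a ha).le) (p.mean_mono fun a ha => (h a ha).ge)

theorem mean_const (p : PMF α) (c : ℝ≥0∞) : (p.mean fun _ => c) = c := by
  unfold mean
  rw [ENNReal.tsum_mul_right, p.tsum_coe, one_mul]

theorem mean_mul_right (p : PMF α) (f : α → ℝ≥0∞) (c : ℝ≥0∞) :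
    (p.mean fun a => f a * c) = p.mean f * c := by
  unfold mean
  simp only [← mul_assoc, ENNReal.tsum_mul_right]

theorem mean_ofReal [Fintype α] (p : PMF α) {f : α → ℝ} (hf : ∀ a, 0 ≤ f a) :
    (p.mean fun a => ENNReal.ofReal (f a)) = ENNReal.ofReal (∑ a, (p a).toReal * f a) := by
  unfold mean
  rw [tsum_fintype, ENNReal.ofReal_sum_of_nonneg fun a _ => mul_nonneg ENNReal.toReal_nonneg (hf a)]
  refine Finset.sum_congr rfl fun a _ => ?_
  rw [ENNReal.ofReal_mul ENNReal.toReal_nonneg, ENNReal.ofReal_toReal (p.apply_ne_top a)]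

theorem sum_toReal [Fintype α] (p : PMF α) : ∑ a, (p a).toReal = 1 := by
  have h := p.tsum_coe
  rw [tsum_fintype] at h
  rw [← ENNReal.toReal_sum fun a _ => p.apply_ne_top a, h, ENNReal.toReal_one]

/-- Markov's inequality for the exponential moment, in multiplicative form. -/
theorem toOuterMeasure_le_mean (p : PMF α) (s : Set α) (f : α → ℝ≥0∞) (h : ∀ a ∈ s, 1 ≤ f a) :
    p.toOuterMeasure s ≤ p.mean f := by
  rw [PMF.toOuterMeasure_apply]
  refine ENNReal.tsum_le_tsum fun a => ?_
  by_cases ha : a ∈ s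
  · simpa [ha] using mul_le_mul_right (h a ha) (p a)
  · simp [ha]

theorem one_sub_le_toOuterMeasure (p : PMF α) (s : Set α) {c : ℝ≥0∞}
    (h : p.toOuterMeasure sᶜ ≤ c) : 1 - c ≤ p.toOuterMeasure s := by
  rw [tsub_le_iff_right]
  calc (1 : ℝ≥0∞) = p.toOuterMeasure (s ∪ sᶜ) := by
        rw [Set.union_compl_self, (PMF.toOuterMeasure_apply_eq_one_iff _ _).2 (Set.subset_univ _)]
    _ ≤ p.toOuterMeasure s + p.toOuterMeasure sᶜ := MeasureTheory.measure_union_le _ _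
    _ ≤ _ := add_le_add le_rfl h

end PMF

/-! ### Choice models and demand functions -/

namespace ChoiceModel

variable {k : ℕ} (φ : ChoiceModel k)

theorem prob_nonneg (o : Option (Fin k)) (A : Finset (Fin k)) : 0 ≤ φ.prob o A :=
  ENNReal.toReal_nonneg

theorem prob_of_notMem {j : Fin k} {A : Finset (Fin k)} (h : j ∉ A) : φ.prob (some j) A = 0 := by
  simp [prob, φ.law_eq_zero A j h]

theorem demand_eq_sum_univ (A : Finset (Fin k)) : φ.demand A = ∑ j, φ.prob (some j) A :=
  Finset.sum_subset (Finset.subset_univ A) fun _ _ hj => φ.prob_of_notMem hj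

theorem revenue_eq_sum_univ (θ : Fin k → ℝ) (A : Finset (Fin k)) :
    φ.revenue θ A = ∑ j, θ j * φ.prob (some j) A :=
  Finset.sum_subset (Finset.subset_univ A) fun _ _ hj => by rw [φ.prob_of_notMem hj, mul_zero]

theorem sum_prob (A : Finset (Fin k)) : ∑ o, φ.prob o A = 1 := (φ.law A).sum_toReal

theorem demand_empty : φ.demand ∅ = 0 := by simp [demand]

theorem demand_nonneg (A : Finset (Fin k)) : 0 ≤ φ.demand A :=
  Finset.sum_nonneg fun _ _ => φ.prob_nonneg _ _

theorem revenue_mono {θ θ' : Fin k → ℝ} (h : ∀ j, θ j ≤ θ' j) (A : Finset (Fin k)) :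
    φ.revenue θ A ≤ φ.revenue θ' A :=
  Finset.sum_le_sum fun j _ => mul_le_mul_of_nonneg_right (h j) (φ.prob_nonneg _ _)

theorem revenue_nonneg {θ : Fin k → ℝ} (h : ∀ j, 0 ≤ θ j) (A : Finset (Fin k)) :
    0 ≤ φ.revenue θ A :=
  Finset.sum_nonneg fun j _ => mul_nonneg (h j) (φ.prob_nonneg _ _)

end ChoiceModel

/-- Diminishing returns also when `e` already lies in `B`: the left side is then zero and
monotonicity makes the right side nonnegative. No freshness has to be checked later. -/
theorem IsMonotoneSubmodular.insert_sub_le {k : ℕ} {f : Finset (Fin k) → ℝ}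
    (hf : IsMonotoneSubmodular f) {A B : Finset (Fin k)} (h : A ⊆ B) (e : Fin k) :
    f (insert e B) - f B ≤ f (insert e A) - f A := by
  by_cases he : e ∈ B
  · rw [Finset.insert_eq_of_mem he, sub_self, sub_nonneg]
    exact hf.1 _ _ (Finset.subset_insert e A)
  · exact hf.2 A B e h he

/-- Insert the elements of `A` one by one: each gains at most as much on top of `B` as without `B`.
-/
theorem IsMonotoneSubmodular.union_sub_le {k : ℕ} {f : Finset (Fin k) → ℝ}
    (hf : IsMonotoneSubmodular f) (A B : Finset (Fin k)) :
    f (A ∪ B) - f B ≤ f A - f ∅ := by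
  induction A using Finset.induction_on with
  | empty => simp
  | insert e A _ ih =>
    have := hf.insert_sub_le (Finset.subset_union_left (s₁ := A) (s₂ := B)) e
    rw [Finset.insert_union]
    linarith

/-! ### Histories and backlogs -/

section Histories

variable {N K : ℕ}

theorem backlog_nil (j : Fin K) : backlog ([] : List (Step N K)) j = ∅ := by
  simp [backlog]

theorem mem_backlog {h : List (Step N K)} {j : Fin K} {i : Fin N} :
    i ∈ backlog h j ↔ ∃ A : Finset (Fin K), (i, A, some j) ∈ h := by
  simp [backlog]

theorem backlog_cons_none (i : Fin N) (A : Finset (Fin K)) (h : List (Step N K)) (j : Fin K) :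
    backlog ((i, A, none) :: h) j = backlog h j := by
  ext; simp [mem_backlog]

theorem backlog_cons_some (i : Fin N) (A : Finset (Fin K)) (h : List (Step N K)) (j l : Fin K) :
    backlog ((i, A, some l) :: h) j = if j = l then insert i (backlog h j) else backlog h j := by
  ext x
  split_ifs with hj
  · subst hj
    simp only [mem_backlog, List.mem_cons, Prod.mk.injEq, Finset.mem_insert, and_true]
    constructor
    · rintro ⟨B, ⟨rfl, -⟩ | hB⟩
      · exact Or.inl rfl
      · exact Or.inr ⟨B, hB⟩
    · rintro (rfl | ⟨B, hB⟩)
      · exact ⟨A, Or.inl ⟨rfl, rfl⟩⟩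
      · exact ⟨B, Or.inr hB⟩
  · simp [mem_backlog, hj]

theorem mem_map_fst_of_mem_backlog {h : List (Step N K)} {j : Fin K} {i : Fin N}
    (hi : i ∈ backlog h j) : i ∈ h.map Prod.fst := by
  obtain ⟨A, hA⟩ := mem_backlog.1 hi
  exact List.mem_map.2 ⟨_, hA, rfl⟩

namespace Strategy

variable (σ : Strategy N K) (φ : Fin N → ChoiceModel K)

theorem nodup_of_isHistory {h : List (Step N K)} (hh : IsHistory σ.next h) :
    (h.map Prod.fst).Nodup := by
  induction h with
  | nil => simp
  | cons s h ih =>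
    obtain ⟨h1, hl, h2⟩ := hh
    rw [List.map_cons, List.nodup_cons]
    exact ⟨σ.fresh h hl h1 _ h2, ih h1⟩

theorem isHistory_and_length_of_mem_support (t : ℕ) (ht : t ≤ N) (h : List (Step N K))
    (hh : h ∈ (σ.partialLaw φ t).support) : IsHistory σ.next h ∧ h.length = t := by
  induction t generalizing h with
  | zero =>
    rw [partialLaw, PMF.mem_support_pure_iff] at hh
    subst hh
    exact ⟨trivial, rfl⟩
  | succ t ih =>
    rw [partialLaw, PMF.mem_support_bind_iff] at hh
    obtain ⟨g, hg, hh⟩ := hh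
    obtain ⟨h1, h2⟩ := ih (by omega) g hg
    have hl : g.length < N := by omega
    rw [dif_pos hl, PMF.mem_support_bind_iff] at hh
    obtain ⟨a, ha, hh⟩ := hh
    rw [PMF.mem_support_map_iff] at hh
    obtain ⟨o, -, rfl⟩ := hh
    exact ⟨⟨h1, hl, ha⟩, by simp [h2]⟩

/-- The value 0 in the `else` branch is a placeholder: every history of positive probability after
`t` rounds has length `t`, which is below `N`. -/
theorem partialLaw_succ_mean (t : ℕ) (ht : t < N) (f : List (Step N K) → ℝ≥0∞) :
    (σ.partialLaw φ (t + 1)).mean f = (σ.partialLaw φ t).mean fun h =>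
      if hl : h.length < N then
        (σ.next h hl).mean fun a => ((φ a.1).law a.2).mean fun o => f ((a.1, a.2, o) :: h)
      else 0 := by
  rw [partialLaw, PMF.mean_bind]
  refine PMF.mean_congr _ fun h hh => ?_
  have hl : h.length < N := by
    rw [(σ.isHistory_and_length_of_mem_support φ t ht.le h hh).2]; exact ht
  simp only [dif_pos hl, PMF.mean_bind, PMF.mean_map]

/-- A potential that does not increase in expectation when a fresh agent is processed bounds the
expectation of its terminal value. -/
theorem mean_law_le {f : List (Step N K) → ℝ} (hf : ∀ h, 0 ≤ f h)
    (hstep : ∀ h (hl : h.length < N), IsHistory σ.next h → ∀ a ∈ (σ.next h hl).support,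
      ∑ o, (φ a.1).prob o a.2 * f ((a.1, a.2, o) :: h) ≤ f h) :
    ((σ.law φ).mean fun h => ENNReal.ofReal (f h)) ≤ ENNReal.ofReal (f []) := by
  have key : ∀ t ≤ N, ((σ.partialLaw φ t).mean fun h => ENNReal.ofReal (f h)) ≤
      ENNReal.ofReal (f []) := by
    intro t
    induction t with
    | zero => intro _; rw [partialLaw, PMF.mean_pure]
    | succ t ih =>
      intro ht
      refine le_trans ?_ (ih (by omega))
      rw [partialLaw_succ_mean _ _ _ (by omega)]
      refine PMF.mean_mono _ fun h hh => ?_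
      obtain ⟨h1, h2⟩ := σ.isHistory_and_length_of_mem_support φ t (by omega) h hh
      have hl : h.length < N := by omega
      rw [dif_pos hl]
      refine (PMF.mean_mono _ fun a ha => ?_).trans_eq (PMF.mean_const _ _)
      rw [PMF.mean_ofReal _ fun o => hf _]
      exact ENNReal.ofReal_le_ofReal (hstep h hl h1 a ha)
  exact key N le_rfl

/-- The martingale version of `mean_law_le`, used for greedy and for showing backlogs. -/
theorem mean_law_eq {f : List (Step N K) → ℝ} (hf : ∀ h, 0 ≤ f h)
    (hstep : ∀ h (hl : h.length < N), IsHistory σ.next h → ∀ a ∈ (σ.next h hl).support,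
      ∑ o, (φ a.1).prob o a.2 * f ((a.1, a.2, o) :: h) = f h) :
    ((σ.law φ).mean fun h => ENNReal.ofReal (f h)) = ENNReal.ofReal (f []) := by
  have key : ∀ t ≤ N, ((σ.partialLaw φ t).mean fun h => ENNReal.ofReal (f h)) =
      ENNReal.ofReal (f []) := by
    intro t
    induction t with
    | zero => intro _; rw [partialLaw, PMF.mean_pure]
    | succ t ih =>
      intro ht
      refine Eq.trans ?_ (ih (by omega))
      rw [partialLaw_succ_mean _ _ _ (by omega)]
      refine PMF.mean_congr _ fun h hh => ?_
      obtain ⟨h1, h2⟩ := σ.isHistory_and_length_of_mem_support φ t (by omega) h hh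
      have hl : h.length < N := by omega
      rw [dif_pos hl]
      refine (PMF.mean_congr _ fun a ha => ?_).trans (PMF.mean_const _ _)
      rw [PMF.mean_ofReal _ fun o => hf _]
      exact congrArg ENNReal.ofReal (hstep h hl h1 a ha)
  exact key N le_rfl

theorem isHistory_and_length_of_mem_support_law {h : List (Step N K)}
    (hh : h ∈ (σ.law φ).support) : IsHistory σ.next h ∧ h.length = N :=
  σ.isHistory_and_length_of_mem_support φ N le_rfl h hh

/-- Pigeonhole: `N` rounds without repetition exhaust `Fin N`. -/
theorem mem_map_fst_of_mem_support_law {h : List (Step N K)} (hh : h ∈ (σ.law φ).support)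
    (i : Fin N) : i ∈ h.map Prod.fst := by
  obtain ⟨h1, h2⟩ := σ.isHistory_and_length_of_mem_support_law φ hh
  have hn := σ.nodup_of_isHistory h1
  have hc : (h.map Prod.fst).toFinset = Finset.univ := by
    rw [← Finset.card_eq_iff_eq_univ, List.toFinset_card_of_nodup hn, List.length_map, h2,
      Fintype.card_fin]
  rw [← List.mem_toFinset, hc]
  exact Finset.mem_univ i

end Strategy

end Histories

/-! ### Analysis of the greedy rule -/

section Greedy

variable {N K : ℕ}

/-- The sum of `r i` over the agents `i` that do not occur in a history. -/
def remaining (r : Fin N → ℝ) (h : List (Step N K)) : ℝ :=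
  ∑ i, if i ∈ h.map Prod.fst then 0 else r i

theorem remaining_nil (r : Fin N → ℝ) : remaining r ([] : List (Step N K)) = ∑ i, r i := by
  simp [remaining]

theorem remaining_nonneg {r : Fin N → ℝ} (hr : ∀ i, 0 ≤ r i) (h : List (Step N K)) :
    0 ≤ remaining r h :=
  Finset.sum_nonneg fun i _ => by split_ifs; exacts [le_rfl, hr i]

theorem remaining_le {r : Fin N → ℝ} (hr : ∀ i, 0 ≤ r i) (h : List (Step N K)) :
    remaining r h ≤ ∑ i, r i :=
  Finset.sum_le_sum fun i _ => by split_ifs; exacts [hr i, le_rfl]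

theorem remaining_cons (r : Fin N → ℝ) {h : List (Step N K)} {i : Fin N}
    (hi : i ∉ h.map Prod.fst) (A : Finset (Fin K)) (o : Option (Fin K)) :
    remaining r ((i, A, o) :: h) = remaining r h - r i := by
  unfold remaining
  rw [eq_sub_iff_add_eq, ← Finset.sum_erase_add _ _ (Finset.mem_univ i),
    ← Finset.sum_erase_add Finset.univ (fun x => if x ∈ h.map Prod.fst then (0 : ℝ) else r x)
      (Finset.mem_univ i)]
  simp only [List.map_cons, List.mem_cons, true_or, if_true, add_zero, hi, if_false]
  congr 1
  refine Finset.sum_congr rfl fun x hx => ?_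
  simp [Finset.ne_of_mem_erase hx]

theorem remaining_eq_zero (r : Fin N → ℝ) {h : List (Step N K)}
    (hh : ∀ i, i ∈ h.map Prod.fst) : remaining r h = 0 :=
  Finset.sum_eq_zero fun i _ => if_pos (hh i)

variable (M : Market N K)

/-- The expected number of matches when the responding agents are shown their backlogs. -/
def totalDemand (h : List (Step N K)) : ℝ := ∑ j, (M.supplier j).demand (backlog h j)

/-- The increase of the demand of `j` when `i` joins its backlog. -/
def marginalDemand (h : List (Step N K)) (i : Fin N) (j : Fin K) : ℝ :=
  (M.supplier j).demand (insert i (backlog h j)) - (M.supplier j).demand (backlog h j)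

theorem totalDemand_nil : totalDemand M [] = 0 := by
  simp [totalDemand, backlog_nil, ChoiceModel.demand_empty]

theorem totalDemand_nonneg (h : List (Step N K)) : 0 ≤ totalDemand M h :=
  Finset.sum_nonneg fun _ _ => ChoiceModel.demand_nonneg _ _

theorem totalDemand_cons_none (i : Fin N) (A : Finset (Fin K)) (h : List (Step N K)) :
    totalDemand M ((i, A, none) :: h) = totalDemand M h := by
  simp [totalDemand, backlog_cons_none]

theorem sum_update_eq (F G : Fin K → ℝ) (l : Fin K) :
    ∑ j, (if j = l then G j else F j) = ∑ j, F j + (G l - F l) := by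
  rw [← sub_eq_iff_eq_add', ← Finset.sum_sub_distrib, Finset.sum_eq_single l]
  · simp
  · intro j _ hj; simp [hj]
  · simp

theorem totalDemand_cons_some (i : Fin N) (A : Finset (Fin K)) (h : List (Step N K)) (l : Fin K) :
    totalDemand M ((i, A, some l) :: h) = totalDemand M h + marginalDemand M h i l := by
  unfold totalDemand marginalDemand
  rw [← sum_update_eq (fun j => (M.supplier j).demand (backlog h j))
    fun j => (M.supplier j).demand (insert i (backlog h j))]
  refine Finset.sum_congr rfl fun j _ => ?_
  rw [backlog_cons_some]
  split_ifs <;> rfl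

/-- Expected change of a potential in one round. -/
theorem sum_prob_mul_add (φ : ChoiceModel K) (A : Finset (Fin K)) (c : ℝ) (θ : Fin K → ℝ) :
    ∑ o : Option (Fin K), φ.prob o A * (c + o.elim 0 θ) = c + φ.revenue θ A := by
  simp only [mul_add, Finset.sum_add_distrib, ← Finset.sum_mul, φ.sum_prob, one_mul]
  rw [Fintype.sum_option, ChoiceModel.revenue_eq_sum_univ]
  simp [mul_comm]

theorem totalDemand_cons (i : Fin N) (A : Finset (Fin K)) (h : List (Step N K))
    (o : Option (Fin K)) : totalDemand M ((i, A, o) :: h) =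
      totalDemand M h + o.elim 0 (marginalDemand M h i) := by
  cases o with
  | none => simp [totalDemand_cons_none]
  | some l => simp [totalDemand_cons_some]

/-! ### Supermartingale comparison with a fixed outcome -/

variable {M} (hM : M.HasMonotoneSubmodularDemand) (O : M.Oracle)
include hM

theorem marginalDemand_nonneg (h : List (Step N K)) (i : Fin N) (j : Fin K) :
    0 ≤ marginalDemand M h i j :=
  sub_nonneg.2 ((hM.2 j).1 _ _ (Finset.subset_insert _ _))

theorem marginalDemand_le_demand_singleton (h : List (Step N K)) (i : Fin N) (j : Fin K) :
    marginalDemand M h i j ≤ (M.supplier j).demand {i} := by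
  have := (hM.2 j).insert_sub_le (Finset.empty_subset (backlog h j)) i
  rw [ChoiceModel.demand_empty] at this
  simpa [marginalDemand] using this

theorem marginalDemand_anti {h g : List (Step N K)} {j : Fin K}
    (hs : backlog h j ⊆ backlog g j) (i : Fin N) :
    marginalDemand M g i j ≤ marginalDemand M h i j :=
  (hM.2 j).insert_sub_le hs i

omit hM in
theorem greedyAssortment_eq (h : List (Step N K)) (i : Fin N) :
    greedyAssortment M O h i = O.customer i (marginalDemand M h i) := rfl

omit hM in
/-- The largest expected increase of the total demand that a choice of `i` can yield. -/
def bestGain (h : List (Step N K)) (i : Fin N) : ℝ :=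
  (M.customer i).revenue (marginalDemand M h i) (greedyAssortment M O h i)

theorem revenue_le_bestGain (h : List (Step N K)) (i : Fin N) (A : Finset (Fin K)) :
    (M.customer i).revenue (marginalDemand M h i) A ≤ bestGain O h i :=
  O.customer_optimal i _ (marginalDemand_nonneg hM h i) A

theorem bestGain_nonneg (h : List (Step N K)) (i : Fin N) : 0 ≤ bestGain O h i :=
  ChoiceModel.revenue_nonneg _ (marginalDemand_nonneg hM h i) _

omit hM in
/-- The potential that compares an arbitrary strategy (history `k`) with a final history `c`. -/
def comparison (c k : List (Step N K)) : ℝ :=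
  ∑ j, (M.supplier j).demand (backlog c j ∪ backlog k j) + remaining (bestGain O c) k

theorem totalDemand_le_comparison (c k : List (Step N K)) :
    totalDemand M k ≤ comparison O c k := by
  refine le_add_of_le_of_nonneg ?_ (remaining_nonneg (bestGain_nonneg hM O c) k)
  exact Finset.sum_le_sum fun j _ => (hM.2 j).1 _ _ Finset.subset_union_right

theorem comparison_nonneg (c k : List (Step N K)) : 0 ≤ comparison O c k :=
  (totalDemand_nonneg M k).trans (totalDemand_le_comparison hM O c k)

omit hM in
theorem comparison_nil (c : List (Step N K)) :
    comparison O c [] = totalDemand M c + ∑ i, bestGain O c i := by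
  simp [comparison, totalDemand, backlog_nil, remaining_nil]

/-- Having already collected `k` does not raise the prospects beyond those of a fresh start: the
backlogs of `c` add no more on top of those of `k` than on top of nothing. This gives the bound on
the future gain in `greedyExpectation_sub_le`. -/
theorem comparison_le (c k : List (Step N K)) :
    comparison O c k ≤ totalDemand M k + comparison O c [] := by
  rw [comparison_nil, comparison, totalDemand, totalDemand, ← add_assoc, ← Finset.sum_add_distrib]
  refine add_le_add (Finset.sum_le_sum fun j _ => ?_) (remaining_le (bestGain_nonneg hM O c) k)
  have := (hM.2 j).union_sub_le (backlog c j) (backlog k j)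
  rw [ChoiceModel.demand_empty] at this
  linarith

/-- A choice `l` changes only the demand term of `l`, by a marginal over `backlog c l ∪ backlog k
l`, which submodularity bounds by the marginal over `backlog c l`. Freshness of `i` is what releases
`bestGain O c i` from the remaining sum to pay for it. -/
theorem comparison_cons_le (c : List (Step N K)) {k : List (Step N K)} {i : Fin N}
    (hi : i ∉ k.map Prod.fst) (A : Finset (Fin K)) (o : Option (Fin K)) :
    comparison O c ((i, A, o) :: k) ≤
      comparison O c k - bestGain O c i + o.elim 0 (marginalDemand M c i) := by
  unfold comparison
  rw [remaining_cons _ hi]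
  cases o with
  | none => simp only [backlog_cons_none, Option.elim]; linarith
  | some l =>
    have h1 : ∑ j, (M.supplier j).demand (backlog c j ∪ backlog ((i, A, some l) :: k) j) =
        ∑ j, if j = l then (M.supplier j).demand (insert i (backlog c j ∪ backlog k j))
          else (M.supplier j).demand (backlog c j ∪ backlog k j) := by
      refine Finset.sum_congr rfl fun j _ => ?_
      rw [backlog_cons_some]
      split_ifs
      · rw [Finset.union_insert]
      · rfl
    have h2 := (hM.2 l).insert_sub_le
      (Finset.subset_union_left (s₁ := backlog c l) (s₂ := backlog k l)) i
    rw [h1, sum_update_eq (fun j => (M.supplier j).demand (backlog c j ∪ backlog k j))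
      fun j => (M.supplier j).demand (insert i (backlog c j ∪ backlog k j))]
    simp only [Option.elim, marginalDemand]
    linarith

/-- No way to process a fresh agent increases the comparison potential in expectation. -/
theorem sum_prob_mul_comparison_le (c : List (Step N K)) {k : List (Step N K)} {i : Fin N}
    (hi : i ∉ k.map Prod.fst) (A : Finset (Fin K)) :
    ∑ o, (M.customer i).prob o A * comparison O c ((i, A, o) :: k) ≤ comparison O c k := by
  refine (Finset.sum_le_sum fun o _ => mul_le_mul_of_nonneg_left
    (comparison_cons_le hM O c hi A o) (ChoiceModel.prob_nonneg _ _ _)).trans ?_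
  rw [sum_prob_mul_add]
  linarith [revenue_le_bestGain hM O c i A]

/-- Here `c` is any list, unrelated to `τ`. It can therefore be averaged over greedy outcomes
afterwards while the left side stays constant. -/
theorem mean_totalDemand_le_comparison (τ : Strategy N K) (c : List (Step N K)) :
    ((τ.law M.customer).mean fun k => ENNReal.ofReal (totalDemand M k)) ≤
      ENNReal.ofReal (comparison O c []) := by
  refine (PMF.mean_mono _ fun k _ =>
    ENNReal.ofReal_le_ofReal (totalDemand_le_comparison hM O c k)).trans ?_
  exact τ.mean_law_le _ (comparison_nonneg hM O c) fun k hl hk a ha =>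
    sum_prob_mul_comparison_le hM O c (τ.fresh k hl hk a ha) a.2

omit hM in
/-- Total conditional expectation of the increases of the demand along a greedy history. -/
def compensator : List (Step N K) → ℝ
  | [] => 0
  | s :: h => compensator h + bestGain O h s.1

theorem compensator_nonneg (h : List (Step N K)) : 0 ≤ compensator O h := by
  induction h with
  | nil => exact le_rfl
  | cons s h ih => exact add_nonneg ih (bestGain_nonneg hM O h s.1)

theorem sum_map_bestGain_le_compensator (c : List (Step N K)) (h : List (Step N K))
    (hs : ∀ j, backlog h j ⊆ backlog c j) :
    (h.map fun s => bestGain O c s.1).sum ≤ compensator O h := by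
  induction h with
  | nil => simp [compensator]
  | cons s h ih =>
    have hs' : ∀ j, backlog h j ⊆ backlog c j := fun j x hx => by
      obtain ⟨A, hA⟩ := mem_backlog.1 hx
      exact hs j (mem_backlog.2 ⟨A, List.mem_cons_of_mem _ hA⟩)
    rw [List.map_cons, List.sum_cons, compensator, add_comm]
    -- The assortment that greedy would show at the end `c` was a feasible candidate at the earlier
    -- time `h`, when all marginals were at least as large.
    refine add_le_add (ih hs') (le_trans ?_
      (revenue_le_bestGain hM O h s.1 (greedyAssortment M O c s.1)))
    exact ChoiceModel.revenue_mono _ (fun j => marginalDemand_anti hM (hs' j) s.1) _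

/-- When each agent occurs exactly once in `c`, the sum of best gains over agents is the sum over
the rounds of `c`, which the compensator dominates. -/
theorem comparison_nil_le {c : List (Step N K)} (hn : (c.map Prod.fst).Nodup)
    (hc : ∀ i, i ∈ c.map Prod.fst) :
    comparison O c [] ≤ totalDemand M c + compensator O c := by
  rw [comparison_nil]
  refine add_le_add le_rfl (le_trans (le_of_eq ?_)
    (sum_map_bestGain_le_compensator hM O c c fun _ => subset_rfl))
  have h1 : (Finset.univ : Finset (Fin N)) = (c.map Prod.fst).toFinset := by
    ext i; simpa using hc i
  rw [h1, List.sum_toFinset _ hn, List.map_map]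
  rfl

omit hM

/-! ### Backward expectations along greedy histories -/

variable (σ : Equiv.Perm (Fin N))

/-- Expectation of `g` at the history reached by `r` further greedy rounds. -/
def greedyExpectation (g : List (Step N K) → ℝ) : ℕ → List (Step N K) → ℝ
  | 0, h => g h
  | r + 1, h =>
      if hl : h.length < N then
        ∑ o, (M.customer (σ ⟨h.length, hl⟩)).prob o (greedyAssortment M O h (σ ⟨h.length, hl⟩)) *
          greedyExpectation g r
            ((σ ⟨h.length, hl⟩, greedyAssortment M O h (σ ⟨h.length, hl⟩), o) :: h)
      else g h

theorem greedyExpectation_nonneg {g : List (Step N K) → ℝ} (hg : ∀ h, 0 ≤ g h) (r : ℕ)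
    (h : List (Step N K)) : 0 ≤ greedyExpectation O σ g r h := by
  induction r generalizing h with
  | zero => exact hg h
  | succ r ih =>
    rw [greedyExpectation]
    split_ifs
    · exact Finset.sum_nonneg fun o _ => mul_nonneg (ChoiceModel.prob_nonneg _ _ _) (ih _)
    · exact hg h

theorem mean_greedyFirst_law {g : List (Step N K) → ℝ} (hg : ∀ h, 0 ≤ g h) :
    (((greedyFirst M O σ).law M.customer).mean fun h => ENNReal.ofReal (g h)) =
      ENNReal.ofReal (greedyExpectation O σ g N []) := by
  -- The conditional expectation of the terminal value, with `N - h.length` rounds to go, is a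
  -- martingale along greedy.
  have h1 := (greedyFirst M O σ).mean_law_eq M.customer
    (f := fun h => greedyExpectation O σ g (N - h.length) h)
    (fun h => greedyExpectation_nonneg O σ hg _ h) ?_
  · refine Eq.trans (PMF.mean_congr _ fun h hh => ?_) h1
    rw [((greedyFirst M O σ).isHistory_and_length_of_mem_support_law _ hh).2, Nat.sub_self]
    rfl
  · intro h hl _ a ha
    replace ha : a = _ := (PMF.mem_support_pure_iff _ _).1 ha
    subst ha
    simp only [List.length_cons]
    rw [show N - h.length = (N - (h.length + 1)) + 1 by omega]
    simp [greedyExpectation, hl]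

/-- Total demand minus compensator is a martingale, so the expected growth of the compensator equals
that of the total demand. At the empty history this makes the mean of their sum twice the greedy
value. -/
theorem greedyExpectation_add_compensator (r : ℕ) (h : List (Step N K)) (hr : h.length + r ≤ N) :
    greedyExpectation O σ (fun h => totalDemand M h + compensator O h) r h =
      2 * greedyExpectation O σ (totalDemand M) r h - totalDemand M h + compensator O h := by
  induction r generalizing h with
  | zero => simp only [greedyExpectation]; ring
  | succ r ih =>
    have hl : h.length < N := by omega
    simp only [greedyExpectation, dif_pos hl]
    set i := σ ⟨h.length, hl⟩
    set A := greedyAssortment M O h i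
    have h1 := sum_prob_mul_add (M.customer i) A (totalDemand M h) (marginalDemand M h i)
    simp only [← totalDemand_cons M i A] at h1
    calc _ = ∑ o, (2 * ((M.customer i).prob o A * greedyExpectation O σ (totalDemand M) r
            ((i, A, o) :: h)) - (M.customer i).prob o A * totalDemand M ((i, A, o) :: h) +
            (M.customer i).prob o A * (compensator O h + bestGain O h i)) := by
          refine Finset.sum_congr rfl fun o _ => ?_
          rw [ih _ (by simp only [List.length_cons]; omega)]
          simp only [compensator]
          ring
      _ = _ := by
          rw [Finset.sum_add_distrib, Finset.sum_sub_distrib, ← Finset.mul_sum, h1,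
            ← Finset.sum_mul, ChoiceModel.sum_prob, bestGain]
          ring

/-- The expected number of matches of greedy. -/
def greedyValue : ℝ := greedyExpectation O σ (totalDemand M) N []

theorem greedyValue_nonneg : 0 ≤ greedyValue O σ :=
  greedyExpectation_nonneg O σ (totalDemand_nonneg M) _ _

include hM

/-- What is below the comparison value of every greedy outcome is at most twice the greedy value. -/
theorem le_two_mul_greedyValue {y : ℝ}
    (hy : ∀ c ∈ ((greedyFirst M O σ).law M.customer).support, y ≤ comparison O c []) :
    y ≤ 2 * greedyValue O σ := by
  have h1 : ENNReal.ofReal y ≤ ENNReal.ofReal (2 * greedyValue O σ) := by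
    -- The constant `y` is its own average over greedy outcomes `c`, so the pointwise bounds may be
    -- averaged.
    rw [← PMF.mean_const ((greedyFirst M O σ).law M.customer) (ENNReal.ofReal y)]
    refine (PMF.mean_mono _ fun c hc => ENNReal.ofReal_le_ofReal ((hy c hc).trans
      (comparison_nil_le hM O ((greedyFirst M O σ).nodup_of_isHistory
        ((greedyFirst M O σ).isHistory_and_length_of_mem_support_law _ hc).1)
        ((greedyFirst M O σ).mem_map_fst_of_mem_support_law _ hc)))).trans_eq ?_
    rw [mean_greedyFirst_law (g := fun h => totalDemand M h + compensator O h) O σ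
      fun h => add_nonneg (totalDemand_nonneg M h) (compensator_nonneg hM O h),
      greedyExpectation_add_compensator O σ N [] (by simp)]
    simp [totalDemand_nil, compensator, greedyValue]
  exact (ENNReal.ofReal_le_ofReal_iff (mul_nonneg two_pos.le (greedyValue_nonneg O σ))).1 h1

theorem mean_totalDemand_le (τ : Strategy N K) :
    ((τ.law M.customer).mean fun k => ENNReal.ofReal (totalDemand M k)) ≤
      ENNReal.ofReal (2 * greedyValue O σ) := by
  have h0 := mean_totalDemand_le_comparison hM O τ
  -- The instance `c = []` serves only to show that the mean is finite and can be turned into a real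
  -- number.
  have hne := ne_top_of_le_ne_top ENNReal.ofReal_ne_top (h0 [])
  rw [← ENNReal.ofReal_toReal hne]
  refine ENNReal.ofReal_le_ofReal (le_two_mul_greedyValue hM O σ fun c _ => ?_)
  exact ENNReal.toReal_le_of_le_ofReal (comparison_nonneg hM O c []) (h0 c)

/-- The supermartingale argument again, now for greedy itself restarted at a reachable history `h`;
the outcome `c` remains independent of `h`. -/
theorem greedyExpectation_le_comparison (c : List (Step N K)) (r : ℕ) (h : List (Step N K))
    (hh : IsHistory (greedyFirst M O σ).next h) (hr : h.length + r ≤ N) :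
    greedyExpectation O σ (totalDemand M) r h ≤ comparison O c h := by
  induction r generalizing h with
  | zero => exact totalDemand_le_comparison hM O c h
  | succ r ih =>
    have hl : h.length < N := by omega
    simp only [greedyExpectation, dif_pos hl]
    have hmem : (σ ⟨h.length, hl⟩, greedyAssortment M O h (σ ⟨h.length, hl⟩)) ∈
        ((greedyFirst M O σ).next h hl).support := (PMF.mem_support_pure_iff _ _).2 rfl
    refine le_trans (Finset.sum_le_sum fun o _ => mul_le_mul_of_nonneg_left
      (ih _ ⟨hh, hl, hmem⟩ (by simp only [List.length_cons]; omega))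
      (ChoiceModel.prob_nonneg _ _ _)) ?_
    exact sum_prob_mul_comparison_le hM O c ((greedyFirst M O σ).fresh h hl hh _ hmem) _

/-- Uniform control of the expected future gain at every reachable history. In the exponential
moment it plays the role of a bound on the remaining variance. -/
theorem greedyExpectation_sub_le (r : ℕ) (h : List (Step N K))
    (hh : IsHistory (greedyFirst M O σ).next h) (hr : h.length + r ≤ N) :
    greedyExpectation O σ (totalDemand M) r h - totalDemand M h ≤ 2 * greedyValue O σ := by
  refine le_two_mul_greedyValue hM O σ fun c _ => ?_
  linarith [greedyExpectation_le_comparison hM O σ c r h hh hr, comparison_le hM O c h]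

theorem le_greedyExpectation (r : ℕ) (h : List (Step N K)) :
    totalDemand M h ≤ greedyExpectation O σ (totalDemand M) r h := by
  induction r generalizing h with
  | zero => exact le_rfl
  | succ r ih =>
    rw [greedyExpectation]
    split_ifs with hl
    · set i := σ ⟨h.length, hl⟩
      set A := greedyAssortment M O h i
      have h1 := sum_prob_mul_add (M.customer i) A (totalDemand M h) (marginalDemand M h i)
      simp only [← totalDemand_cons M i A] at h1
      have h2 : (0 : ℝ) ≤ (M.customer i).revenue (marginalDemand M h i) A :=
        ChoiceModel.revenue_nonneg _ (marginalDemand_nonneg hM h i) A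
      refine le_trans (by linarith) (Finset.sum_le_sum fun o _ => mul_le_mul_of_nonneg_left (ih _)
        (ChoiceModel.prob_nonneg _ _ _))
    · exact le_rfl

/-- Consider the strategy that begins by showing `A` to `i`. With the given probability `j` is
chosen, and this alone yields the demand of `{i}`; one step of the supermartingale property at the
empty history suffices. -/
theorem prob_mul_demand_singleton_le (i : Fin N) (j : Fin K) (A : Finset (Fin K)) :
    (M.customer i).prob (some j) A * (M.supplier j).demand {i} ≤ 2 * greedyValue O σ := by
  refine le_two_mul_greedyValue hM O σ fun c _ => ?_
  refine le_trans ?_ (sum_prob_mul_comparison_le hM O c (k := []) (i := i) (by simp) A)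
  refine le_trans ?_ (Finset.single_le_sum (f := fun o => (M.customer i).prob o A *
    comparison O c [(i, A, o)]) (fun o _ => mul_nonneg (ChoiceModel.prob_nonneg _ _ _)
      (comparison_nonneg hM O c _)) (Finset.mem_univ (some j)))
  refine mul_le_mul_of_nonneg_left ?_ (ChoiceModel.prob_nonneg _ _ _)
  refine le_trans ?_ (totalDemand_le_comparison hM O c _)
  rw [totalDemand_cons_some, totalDemand_nil, marginalDemand, backlog_nil,
    ChoiceModel.demand_empty]
  simp

theorem maxProb_mul_demand_singleton_le (i : Fin N) (j : Fin K) :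
    (M.customer i).maxProb j * (M.supplier j).demand {i} ≤ 2 * greedyValue O σ := by
  obtain ⟨A, hA⟩ := exists_eq_ciSup_of_finite
    (f := fun A : Finset (Fin K) => (M.customer i).prob (some j) A)
  rw [ChoiceModel.maxProb, ← hA]
  exact prob_mul_demand_singleton_le hM O σ i j A

/-! ### Exponential moments -/

/-- Exponential moment of the total demand of greedy, when every choice that has positive
probability increases the demand by at most `B` and the expected future increase is at most `V`. -/
theorem greedyExpectation_exp_le {s s' B V : ℝ} (hsB : Real.exp (s * B) = 1 + s' * B)
    (hV : 2 * greedyValue O σ ≤ V) (hsV : s' * V < 1)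
    (hB : ∀ (i : Fin N) (j : Fin K) (A : Finset (Fin K)), 0 < (M.customer i).prob (some j) A →
      (M.supplier j).demand {i} ≤ B)
    (r : ℕ) (h : List (Step N K)) (hh : IsHistory (greedyFirst M O σ).next h)
    (hr : h.length + r ≤ N) :
    greedyExpectation O σ (fun h => Real.exp (s * totalDemand M h)) r h ≤
      Real.exp (s * totalDemand M h) * (1 + s' / (1 - s' * V) *
        (greedyExpectation O σ (totalDemand M) r h - totalDemand M h)) := by
  have hpos : 0 < 1 - s' * V := by linarith
  -- `s'` is the slope of the chord of x ↦ exp(s x) over [0, B]. The coefficient `a` solves a = s'(1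
  -- + aV), exactly what closes the induction when the future gain is at most `V`.
  set a := s' / (1 - s' * V) with ha
  have ha1 : a = s' * (1 + a * V) := by rw [ha]; field_simp; ring
  -- `a` and `s'` have the same sign, so the product term is monotone in the future gain and both
  -- tails are treated at once.
  have ha2 : 0 ≤ a * s' := by rw [ha, div_mul_eq_mul_div]; exact div_nonneg (mul_self_nonneg _) hpos.le
  have ha3 : 0 ≤ 1 + a * V := by
    have : 1 + a * V = 1 / (1 - s' * V) := by rw [ha]; field_simp; ring
    rw [this]; positivity
  induction r generalizing h with
  | zero => simp [greedyExpectation]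
  | succ r ih =>
    have hl : h.length < N := by omega
    simp only [greedyExpectation, dif_pos hl]
    have hmem : (σ ⟨h.length, hl⟩, greedyAssortment M O h (σ ⟨h.length, hl⟩)) ∈
        ((greedyFirst M O σ).next h hl).support := (PMF.mem_support_pure_iff _ _).2 rfl
    set i := σ ⟨h.length, hl⟩
    set A := greedyAssortment M O h i
    set e := Real.exp (s * totalDemand M h) with he
    have hstep : ∀ o : Option (Fin K), (M.customer i).prob o A *
        greedyExpectation O σ (fun h => Real.exp (s * totalDemand M h)) r ((i, A, o) :: h) ≤
        (M.customer i).prob o A * (e * (1 + a *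
          (greedyExpectation O σ (totalDemand M) r ((i, A, o) :: h) - totalDemand M h))) := by
      intro o
      rcases (ChoiceModel.prob_nonneg (M.customer i) o A).eq_or_lt with h0 | h0
      -- Choices of probability zero must be discarded here, since `B` bounds only the demands of
      -- possible choices.
      · rw [← h0, zero_mul, zero_mul]
      refine mul_le_mul_of_nonneg_left ?_ h0.le
      have hh' : IsHistory (greedyFirst M O σ).next ((i, A, o) :: h) := ⟨hh, hl, hmem⟩
      have hr' : ((i, A, o) :: h).length + r ≤ N := by simp only [List.length_cons]; omega
      refine (ih _ hh' hr').trans ?_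
      have hW := (greedyExpectation_sub_le hM O σ r _ hh' hr').trans hV
      have hW0 := le_greedyExpectation hM O σ r ((i, A, o) :: h)
      generalize greedyExpectation O σ (totalDemand M) r ((i, A, o) :: h) = Z at hW hW0 ⊢
      have hD : 0 ≤ o.elim 0 (marginalDemand M h i) ∧ o.elim 0 (marginalDemand M h i) ≤ B ∨
          o.elim 0 (marginalDemand M h i) = 0 := by
        cases o with
        | none => exact Or.inr rfl
        | some j => exact Or.inl ⟨marginalDemand_nonneg hM h i j,
            (marginalDemand_le_demand_singleton hM h i j).trans (hB i j A h0)⟩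
      rw [totalDemand_cons] at hW hW0 ⊢
      generalize o.elim 0 (marginalDemand M h i) = D at hD hW hW0 ⊢
      have hexp : Real.exp (s * D) ≤ 1 + s' * D := by
        rcases hD with ⟨hD0, hDB⟩ | rfl
        · rcases hD0.eq_or_lt with rfl | hD0
          · simp
          have hB0 : 0 < B := hD0.trans_le hDB
          -- Convexity places exp below its chord between 0 and `s * B`, where the chord values are
          -- 1 and `1 + s' * B`.
          have hc := convexOn_exp.2 (Set.mem_univ (s * B)) (Set.mem_univ (0 : ℝ))
            (div_nonneg hD0.le hB0.le) (sub_nonneg.2 ((div_le_one hB0).2 hDB)) (by ring)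
          simp only [smul_eq_mul, mul_zero, add_zero, Real.exp_zero, mul_one, hsB] at hc
          have e1 : D / B * (s * B) = s * D := by field_simp
          have e2 : D / B * (1 + s' * B) + (1 - D / B) = 1 + s' * D := by field_simp; ring
          rwa [e1, e2] at hc
        · simp
      have hD0 : 0 ≤ D := by rcases hD with hD | rfl; exacts [hD.1, le_rfl]
      rw [mul_add s, Real.exp_add, mul_assoc]
      refine mul_le_mul_of_nonneg_left ?_ (Real.exp_pos _).le
      set W := Z - (totalDemand M h + D) with hWdef
      have hfac : 0 ≤ 1 + a * W := by
        rcases le_total 0 a with ha0 | ha0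
        · have : 0 ≤ W := by rw [hWdef]; linarith
          positivity
        -- For negative `a` the bound W ≤ V gives 1 + aW ≥ 1 + aV ≥ 0.
        · nlinarith
      calc Real.exp (s * D) * (1 + a * W) ≤ (1 + s' * D) * (1 + a * W) :=
            mul_le_mul_of_nonneg_right hexp hfac
        _ = 1 + a * W + D * s' + D * (a * s') * W := by ring
        _ ≤ 1 + a * W + D * s' + D * (a * s') * V := by
            have : D * (a * s') * W ≤ D * (a * s') * V :=
              mul_le_mul_of_nonneg_left hW (mul_nonneg hD0 ha2)
            linarith
        _ = 1 + a * W + D * (s' * (1 + a * V)) := by ring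
        _ = 1 + a * (Z - totalDemand M h) := by rw [← ha1, hWdef]; ring
    refine (Finset.sum_le_sum fun o _ => hstep o).trans_eq ?_
    have : ∀ o : Option (Fin K), (M.customer i).prob o A * (e * (1 + a *
          (greedyExpectation O σ (totalDemand M) r ((i, A, o) :: h) - totalDemand M h))) =
        (M.customer i).prob o A * (e * (1 - a * totalDemand M h)) + e * a *
          ((M.customer i).prob o A * greedyExpectation O σ (totalDemand M) r ((i, A, o) :: h)) :=
      fun o => by ring
    simp only [this]
    rw [Finset.sum_add_distrib, ← Finset.sum_mul, ChoiceModel.sum_prob, ← Finset.mul_sum]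
    ring

end Greedy

/-! ### Values of policies -/

section Values

variable {N K : ℕ}

/-- Freshness of `j` ensures that the pair `(i, j)` has not been counted before. -/
theorem matchCount_cons (h : List (Step N K)) {k : List (Step K N)} {j : Fin K}
    (hj : j ∉ k.map Prod.fst) (A : Finset (Fin N)) (o : Option (Fin N)) :
    (matchCount h ((j, A, o) :: k) : ℝ) =
      matchCount h k + o.elim 0 fun i => if i ∈ backlog h j then 1 else 0 := by
  unfold matchCount
  cases o with
  | none => simp [backlog_cons_none]
  | some i =>
    have hnot : (i, j) ∉ Finset.univ.filter
        fun p : Fin N × Fin K => p.1 ∈ backlog h p.2 ∧ p.2 ∈ backlog k p.1 := by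
      simp only [Finset.mem_filter, Finset.mem_univ, true_and, not_and]
      exact fun _ hk => hj (mem_map_fst_of_mem_backlog hk)
    by_cases hi : i ∈ backlog h j
    · have : (Finset.univ.filter fun p : Fin N × Fin K =>
          p.1 ∈ backlog h p.2 ∧ p.2 ∈ backlog ((j, A, some i) :: k) p.1) =
          insert (i, j) (Finset.univ.filter
            fun p : Fin N × Fin K => p.1 ∈ backlog h p.2 ∧ p.2 ∈ backlog k p.1) := by
        ext ⟨x, y⟩
        simp only [Finset.mem_filter, Finset.mem_univ, true_and, Finset.mem_insert,
          Prod.mk.injEq, backlog_cons_some]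
        split_ifs with hx
        · subst hx
          simp only [Finset.mem_insert, true_and]
          constructor
          · rintro ⟨h1, h2 | h2⟩
            exacts [Or.inl h2, Or.inr ⟨h1, h2⟩]
          · rintro (rfl | ⟨h1, h2⟩)
            exacts [⟨hi, Or.inl rfl⟩, ⟨h1, Or.inr h2⟩]
        · simp [hx]
      rw [this, Finset.card_insert_of_notMem hnot]
      simp [hi]
    · have : (Finset.univ.filter fun p : Fin N × Fin K =>
          p.1 ∈ backlog h p.2 ∧ p.2 ∈ backlog ((j, A, some i) :: k) p.1) =
          Finset.univ.filter
            fun p : Fin N × Fin K => p.1 ∈ backlog h p.2 ∧ p.2 ∈ backlog k p.1 := by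
        ext ⟨x, y⟩
        simp only [Finset.mem_filter, Finset.mem_univ, true_and, backlog_cons_some]
        split_ifs with hx
        · subst hx
          simp only [Finset.mem_insert]
          constructor
          · rintro ⟨h1, rfl | h2⟩
            exacts [absurd h1 hi, ⟨h1, h2⟩]
          · rintro ⟨h1, h2⟩
            exact ⟨h1, Or.inr h2⟩
        · rfl
      rw [this]
      simp [hi]

variable (M : Market N K)

/-- Matches so far plus the demands of the responding agents that are still to be processed. -/
def matchPotential (h : List (Step N K)) (k : List (Step K N)) : ℝ :=
  matchCount h k + remaining (fun j => (M.supplier j).demand (backlog h j)) k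

theorem matchPotential_nonneg (h : List (Step N K)) (k : List (Step K N)) :
    0 ≤ matchPotential M h k :=
  add_nonneg (Nat.cast_nonneg _) (remaining_nonneg (fun _ => ChoiceModel.demand_nonneg _ _) _)

theorem matchPotential_nil (h : List (Step N K)) : matchPotential M h [] = totalDemand M h := by
  simp [matchPotential, matchCount, backlog_nil, remaining_nil, totalDemand]

/-- Probability that an agent that is shown `A` chooses an element of `C`. -/
def ChoiceModel.hit {k : ℕ} (φ : ChoiceModel k) (C A : Finset (Fin k)) : ℝ :=
  φ.revenue (fun i => if i ∈ C then 1 else 0) A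

theorem ChoiceModel.hit_eq {k : ℕ} (φ : ChoiceModel k) (C A : Finset (Fin k)) :
    φ.hit C A = ∑ i ∈ A ∩ C, φ.prob (some i) A := by
  simp [hit, revenue, Finset.sum_ite_mem]

theorem ChoiceModel.hit_of_subset {k : ℕ} (φ : ChoiceModel k) {C A : Finset (Fin k)}
    (h : A ⊆ C) : φ.hit C A = φ.demand A := by
  rw [hit_eq, Finset.inter_eq_left.2 h, demand]

/-- Deleting from `A` everything outside `C` does not lower the probability of any option that
remains, so the hit probability is at most the demand of `A ∩ C`. -/
theorem ChoiceModel.WeaklySubstitutable.hit_le {k : ℕ} {φ : ChoiceModel k}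
    (hφ : φ.WeaklySubstitutable) (hf : IsMonotoneSubmodular φ.demand) (C A : Finset (Fin k)) :
    φ.hit C A ≤ φ.demand C := by
  rw [hit_eq]
  refine (Finset.sum_le_sum fun i hi => (hφ _ _ Finset.inter_subset_left).2 i hi).trans
    (hf.1 _ _ Finset.inter_subset_right)

/-- The drift of the potential is the hit probability minus the demand at the backlog. It vanishes
when the backlog itself is shown, and its sign decides between supermartingale and martingale. -/
theorem sum_prob_mul_matchPotential (h : List (Step N K)) {k : List (Step K N)} {j : Fin K}
    (hj : j ∉ k.map Prod.fst) (A : Finset (Fin N)) :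
    ∑ o, (M.supplier j).prob o A * matchPotential M h ((j, A, o) :: k) =
      matchPotential M h k +
        ((M.supplier j).hit (backlog h j) A - (M.supplier j).demand (backlog h j)) := by
  have h1 : ∀ o, matchPotential M h ((j, A, o) :: k) =
      (matchPotential M h k - (M.supplier j).demand (backlog h j)) +
        o.elim 0 fun i => if i ∈ backlog h j then 1 else 0 := by
    intro o
    rw [matchPotential, matchCount_cons h hj, remaining_cons _ hj, matchPotential]
    ring
  simp only [h1]
  rw [sum_prob_mul_add, ← ChoiceModel.hit]
  ring

theorem matchCount_eq_matchPotential (τ : Strategy K N) (h : List (Step N K))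
    {k : List (Step K N)} (hk : k ∈ (τ.law M.supplier).support) :
    (matchCount h k : ℝ≥0∞) = ENNReal.ofReal (matchPotential M h k) := by
  rw [matchPotential, remaining_eq_zero _ (τ.mem_map_fst_of_mem_support_law _ hk), add_zero,
    ENNReal.ofReal_natCast]

theorem Policy.expectedMatches_eq_mean (π : Policy N K) :
    π.expectedMatches M = (π.first.law M.customer).mean fun h =>
      ((π.second h).law M.supplier).mean fun k => ENNReal.ofReal (matchPotential M h k) := by
  calc π.expectedMatches M = (π.law M).mean fun r => (matchCount r.1 r.2 : ℝ≥0∞) := rfl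
    _ = _ := by
      rw [Policy.law, PMF.mean_bind]
      simp only [PMF.mean_map]
      exact PMF.mean_congr _ fun h _ => PMF.mean_congr _ fun k hk =>
        matchCount_eq_matchPotential M _ h hk

theorem Policy.expectedMatches_le (π : Policy N K)
    (hπ : ∀ (h : List (Step N K)) (k : List (Step K N)) (hl : k.length < K),
      ∀ b ∈ ((π.second h).next k hl).support,
        (M.supplier b.1).hit (backlog h b.1) b.2 ≤ (M.supplier b.1).demand (backlog h b.1)) :
    π.expectedMatches M ≤
      (π.first.law M.customer).mean fun h => ENNReal.ofReal (totalDemand M h) := by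
  rw [Policy.expectedMatches_eq_mean]
  refine PMF.mean_mono _ fun h _ => ?_
  rw [← matchPotential_nil]
  refine (π.second h).mean_law_le _ (matchPotential_nonneg M h) fun k hl hk b hb => ?_
  rw [sum_prob_mul_matchPotential M h ((π.second h).fresh k hl hk b hb)]
  linarith [hπ h k hl b hb]

theorem expectedMatches_showBacklog (τ : Strategy N K) :
    (Policy.mk τ showBacklog).expectedMatches M =
      (τ.law M.customer).mean fun h => ENNReal.ofReal (totalDemand M h) := by
  rw [Policy.expectedMatches_eq_mean]
  refine PMF.mean_congr _ fun h _ => ?_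
  rw [← matchPotential_nil]
  refine (showBacklog h).mean_law_eq _ (matchPotential_nonneg M h) fun k hl hk b hb => ?_
  rw [sum_prob_mul_matchPotential M h ((showBacklog h).fresh k hl hk b hb)]
  replace hb : b = _ := (PMF.mem_support_pure_iff _ _).1 hb
  subst hb
  rw [ChoiceModel.hit_of_subset _ subset_rfl, sub_self, add_zero]

theorem servesBacklog_showBacklog (τ : Strategy N K) : (Policy.mk τ showBacklog).ServesBacklog := by
  intro h k hl b hb
  replace hb : b = _ := (PMF.mem_support_pure_iff _ _).1 hb
  subst hb
  exact subset_rfl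

theorem expectedMatches_greedyPolicy (O : M.Oracle) (σ : Equiv.Perm (Fin N)) :
    (greedyPolicy M O σ).expectedMatches M = ENNReal.ofReal (greedyValue O σ) := by
  rw [greedyPolicy, expectedMatches_showBacklog, mean_greedyFirst_law O σ (totalDemand_nonneg M)]
  rfl

variable {M}

theorem Policy.ServesBacklog.expectedMatches_le (hM : M.HasMonotoneSubmodularDemand)
    {π : Policy N K} (hπ : π.ServesBacklog) : π.expectedMatches M ≤
      (π.first.law M.customer).mean fun h => ENNReal.ofReal (totalDemand M h) := by
  refine π.expectedMatches_le M fun h k hl b hb => ?_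
  rw [ChoiceModel.hit_of_subset _ (hπ h k hl b hb)]
  exact (hM.2 b.1).1 _ _ (hπ h k hl b hb)

theorem Policy.ServesBacklog.expectedMatches_le_greedyValue (hM : M.HasMonotoneSubmodularDemand)
    (O : M.Oracle) (σ : Equiv.Perm (Fin N)) {π : Policy N K} (hπ : π.ServesBacklog) :
    π.expectedMatches M ≤ ENNReal.ofReal (2 * greedyValue O σ) :=
  (hπ.expectedMatches_le hM).trans (mean_totalDemand_le hM O σ π.first)

theorem Policy.expectedMatches_le_showBacklog (hM : M.HasMonotoneSubmodularDemand)
    (hw : M.WeaklySubstitutable) (π : Policy N K) : π.expectedMatches M ≤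
      (Policy.mk π.first showBacklog).expectedMatches M := by
  rw [expectedMatches_showBacklog]
  exact π.expectedMatches_le M fun h k hl b _ => (hw.2 b.1).hit_le (hM.2 b.1) _ _

end Values

/-! ### The benchmark, the greedy values of both sides, and φ_min -/

section Market

variable {n m : ℕ} {M : Market n m}

theorem Market.HasMonotoneSubmodularDemand.swap (hM : M.HasMonotoneSubmodularDemand) :
    M.swap.HasMonotoneSubmodularDemand :=
  ⟨hM.2, hM.1⟩

/-- Replacing the second phase of any policy by showing backlogs loses nothing and yields an
admissible policy for the restricted optimum. -/
theorem Market.opt_eq_optUnrestricted (hM : M.HasMonotoneSubmodularDemand)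
    (hw : M.WeaklySubstitutable) : M.opt = M.optUnrestricted := by
  refine le_antisymm (iSup_le fun π => iSup_le fun _ => le_iSup (fun π => π.value M) π)
    (iSup_le fun π => ?_)
  cases π with
  | customersFirst π =>
    refine (π.expectedMatches_le_showBacklog hM hw).trans ?_
    exact le_iSup₂_of_le (.customersFirst ⟨π.first, showBacklog⟩)
      (servesBacklog_showBacklog π.first) le_rfl
  | suppliersFirst π =>
    refine (π.expectedMatches_le_showBacklog hM.swap ⟨hw.2, hw.1⟩).trans ?_
    exact le_iSup₂_of_le (.suppliersFirst ⟨π.first, showBacklog⟩)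
      (servesBacklog_showBacklog π.first) le_rfl

theorem Market.opt_le (hM : M.HasMonotoneSubmodularDemand) (O : M.Oracle)
    (σC : Equiv.Perm (Fin n)) (σS : Equiv.Perm (Fin m)) :
    M.opt ≤ ENNReal.ofReal (2 * max (greedyValue O σC) (greedyValue O.swap σS)) := by
  refine iSup₂_le fun π hπ => ?_
  cases π with
  | customersFirst π =>
    refine (Policy.ServesBacklog.expectedMatches_le_greedyValue hM O σC hπ).trans
      (ENNReal.ofReal_le_ofReal ?_)
    linarith [le_max_left (greedyValue O σC) (greedyValue O.swap σS)]
  | suppliersFirst π =>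
    refine (Policy.ServesBacklog.expectedMatches_le_greedyValue hM.swap O.swap σS hπ).trans
      (ENNReal.ofReal_le_ofReal ?_)
    linarith [le_max_right (greedyValue O σC) (greedyValue O.swap σS)]

theorem Market.greedyValue_le_opt (O : M.Oracle) (σC : Equiv.Perm (Fin n)) :
    ENNReal.ofReal (greedyValue O σC) ≤ M.opt := by
  rw [← expectedMatches_greedyPolicy]
  exact le_iSup₂_of_le (.customersFirst (greedyPolicy M O σC))
    (servesBacklog_showBacklog _) le_rfl

theorem Market.greedyValue_swap_le_opt (O : M.Oracle) (σS : Equiv.Perm (Fin m)) :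
    ENNReal.ofReal (greedyValue O.swap σS) ≤ M.opt := by
  rw [← expectedMatches_greedyPolicy]
  exact le_iSup₂_of_le (.suppliersFirst (greedyPolicy M.swap O.swap σS))
    (servesBacklog_showBacklog _) le_rfl

theorem Market.phiMin_swap (M : Market n m) : M.swap.phiMin = M.phiMin := by
  rw [Market.phiMin, Set.union_comm]
  rfl

theorem ChoiceModel.prob_le_maxProb {k : ℕ} (φ : ChoiceModel k) (j : Fin k)
    (A : Finset (Fin k)) : φ.prob (some j) A ≤ φ.maxProb j :=
  le_ciSup (f := fun A : Finset (Fin k) => φ.prob (some j) A) (Set.finite_range _).bddAbove A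

theorem ChoiceModel.maxProb_le_one {k : ℕ} (φ : ChoiceModel k) (j : Fin k) : φ.maxProb j ≤ 1 :=
  ciSup_le fun A => (ENNReal.toReal_mono ENNReal.one_ne_top ((φ.law A).coe_le_one _)).trans_eq
    ENNReal.toReal_one

/-- The hypothesis makes the set of positive values nonempty; being finite, it attains its infimum.
For an empty set `sInf` would return 0. -/
theorem Market.phiMin_spec (M : Market n m) {i : Fin n} {j : Fin m}
    (h : 0 < (M.customer i).maxProb j) :
    0 < M.phiMin ∧ M.phiMin ≤ (M.customer i).maxProb j ∧ M.phiMin ≤ 1 := by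
  have hfin : ({p | 0 < p ∧ ∃ (i : Fin n) (j : Fin m), p = (M.customer i).maxProb j} ∪
      {p | 0 < p ∧ ∃ (j : Fin m) (i : Fin n), p = (M.supplier j).maxProb i}).Finite := by
    refine Set.Finite.union ?_ ?_
    · refine (Set.finite_range fun x : Fin n × Fin m => (M.customer x.1).maxProb x.2).subset ?_
      rintro p ⟨-, i, j, rfl⟩
      exact ⟨(i, j), rfl⟩
    · refine (Set.finite_range fun x : Fin m × Fin n => (M.supplier x.1).maxProb x.2).subset ?_
      rintro p ⟨-, i, j, rfl⟩
      exact ⟨(i, j), rfl⟩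
  have hmem : M.phiMin ∈ _ := Set.Nonempty.csInf_mem ⟨_, Or.inl ⟨h, i, j, rfl⟩⟩ hfin
  have hle : M.phiMin ≤ (M.customer i).maxProb j :=
    csInf_le hfin.bddBelow (Or.inl ⟨h, i, j, rfl⟩)
  refine ⟨?_, hle, hle.trans (ChoiceModel.maxProb_le_one _ _)⟩
  rcases hmem with hmem | hmem
  exacts [hmem.1, hmem.1]

/-- A choice that can occur has positive `maxProb`, hence one of at least φ_min. This converts the
one-step bound into a bound on all possible increments of the total demand. -/
theorem phiMin_mul_demand_le (hM : M.HasMonotoneSubmodularDemand) (O : M.Oracle)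
    (σ : Equiv.Perm (Fin n)) {i : Fin n} {j : Fin m} {A : Finset (Fin m)}
    (h : 0 < (M.customer i).prob (some j) A) :
    M.phiMin * (M.supplier j).demand {i} ≤ 2 * greedyValue O σ := by
  obtain ⟨-, h1, -⟩ := M.phiMin_spec (h.trans_le (ChoiceModel.prob_le_maxProb _ j A))
  exact (mul_le_mul_of_nonneg_right h1 (ChoiceModel.demand_nonneg _ _)).trans
    (maxProb_mul_demand_singleton_le hM O σ i j)

/-- Otherwise no initiating agent can ever choose anybody, and greedy collects nothing. -/
theorem phiMin_pos_of_greedyValue_pos (O : M.Oracle) (σ : Equiv.Perm (Fin n))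
    (h : 0 < greedyValue O σ) : 0 < M.phiMin ∧ M.phiMin ≤ 1 := by
  by_contra hcon
  have hzero : ∀ i j A, (M.customer i).prob (some j) A = 0 := by
    intro i j A
    by_contra h0
    have h1 := M.phiMin_spec (((ChoiceModel.prob_nonneg _ _ _).lt_of_ne' h0).trans_le
      (ChoiceModel.prob_le_maxProb (M.customer i) j A))
    exact hcon ⟨h1.1, h1.2.2⟩
  have key : ∀ r h, greedyExpectation O σ (totalDemand M) r h = totalDemand M h := by
    intro r
    induction r with
    | zero => intro h; rfl
    | succ r ih =>
      intro h
      rw [greedyExpectation]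
      split_ifs
      · simp only [ih, totalDemand_cons, sum_prob_mul_add]
        rw [ChoiceModel.revenue, Finset.sum_eq_zero fun j _ => by rw [hzero, mul_zero], add_zero]
      · rfl
  rw [greedyValue, key, totalDemand_nil] at h
  exact h.false

end Market

/-! ### Concentration of the estimates -/

section Concentration

/-- The left side of the second bound is the coefficient `a` of `greedyExpectation_exp_le`, up to
scaling. With w = exp x - 1 one has w ≤ x + x², and |(x + 4x²) w φ| ≤ (5/2) x²; the 4 absorbs both
errors because 1 + 5/2 ≤ 4. -/
theorem exp_sub_one_div_le {x φ : ℝ} (hx : |x| ≤ 1 / 4) (h0 : 0 ≤ φ) (h1 : φ ≤ 1) :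
    (Real.exp x - 1) * φ < 1 ∧
      (Real.exp x - 1) / (1 - (Real.exp x - 1) * φ) ≤ x + 4 * x ^ 2 := by
  have hw := Real.abs_exp_sub_one_sub_id_le (x := x) (by linarith)
  set w := Real.exp x - 1
  have hsq : x ^ 2 ≤ |x| / 4 := by rw [← sq_abs]; nlinarith [abs_nonneg x]
  have hx1 : |x + 4 * x ^ 2| ≤ 2 * |x| :=
    (abs_add_le _ _).trans (by rw [abs_of_nonneg (by positivity : 0 ≤ 4 * x ^ 2)]; linarith)
  have hw1 : |w| ≤ 5 / 4 * |x| := by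
    calc |w| = |(w - x) + x| := by ring_nf
      _ ≤ |w - x| + |x| := abs_add_le _ _
      _ ≤ _ := by linarith
  have hwφ : |w * φ| ≤ |w| := by
    rw [abs_mul, abs_of_nonneg h0]
    exact mul_le_of_le_one_right (abs_nonneg w) h1
  have hlt : w * φ < 1 := by linarith [le_abs_self (w * φ)]
  refine ⟨hlt, ?_⟩
  rw [div_le_iff₀ (by linarith)]
  have hprod : |(x + 4 * x ^ 2) * (w * φ)| ≤ 5 / 2 * x ^ 2 := by
    rw [abs_mul]
    nlinarith [sq_abs x, mul_le_mul hx1 (hwφ.trans hw1) (abs_nonneg _) (by positivity)]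
  have := (abs_le.1 hprod).2
  have := (abs_le.1 hw).2
  nlinarith [sq_nonneg x]

variable {N K : ℕ} {M : Market N K}

theorem independentRuns_mean_exp (p : PMF ℝ) (s : ℝ) (T : ℕ) :
    ((independentRuns p T).mean fun l => ENNReal.ofReal (Real.exp (s * l.sum))) =
      (p.mean fun y => ENNReal.ofReal (Real.exp (s * y))) ^ T := by
  induction T with
  | zero => simp [independentRuns, PMF.mean_pure]
  | succ T ih =>
    rw [independentRuns, PMF.mean_bind, pow_succ, ← ih, ← PMF.mean_mul_right]
    refine PMF.mean_congr _ fun l _ => ?_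
    rw [PMF.mean_map, mul_comm, ← PMF.mean_mul_right]
    refine PMF.mean_congr _ fun y _ => ?_
    rw [List.sum_cons, mul_add, Real.exp_add, ENNReal.ofReal_mul (Real.exp_pos _).le]

/-- Chernoff bound for the average of independent greedy runs. -/
theorem sampleAverage_tail_le (hM : M.HasMonotoneSubmodularDemand) (O : M.Oracle)
    (σ : Equiv.Perm (Fin N)) {T : ℕ} (hT : 0 < T) {V φ x : ℝ} (hV : 0 < V) (hφ : 0 < φ)
    (hφ1 : φ ≤ 1) (hx : |x| ≤ 1 / 4) (hE : greedyValue O σ ≤ V)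
    (hB : ∀ (i : Fin N) (j : Fin K) (A : Finset (Fin K)), 0 < (M.customer i).prob (some j) A →
      φ * (M.supplier j).demand {i} ≤ 2 * V) (c : ℝ) :
    (sampleAverage M O σ T).toOuterMeasure {a | 0 ≤ x * (a - c)} ≤ ENNReal.ofReal
      (Real.exp (T * (φ / (2 * V) * ((x + 4 * x ^ 2) * greedyValue O σ - x * c)))) := by
  obtain ⟨h1, h2⟩ := exp_sub_one_div_le hx hφ.le hφ1
  -- `U` bounds a single increment and 2V the future gain. With s = x/U the chord slope is (exp x -
  -- 1)/U, and multiplied by 2V it becomes (exp x - 1)φ.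
  set U := 2 * V / φ with hU
  have hU0 : 0 < U := by positivity
  have hφU : φ * U = 2 * V := by rw [hU]; field_simp
  have hexp := greedyExpectation_exp_le hM O σ (s := x / U) (s' := (Real.exp x - 1) / U) (B := U)
    (V := 2 * V) (by rw [div_mul_cancel₀ _ hU0.ne', div_mul_cancel₀ _ hU0.ne']; ring)
    (by linarith) (by rw [← hφU]; convert h1 using 1; field_simp)
    (fun i j A h => by rw [hU, le_div_iff₀ hφ, mul_comm]; exact hB i j A h) N [] trivial (by simp)
  rw [totalDemand_nil, mul_zero, Real.exp_zero, one_mul, sub_zero, ← greedyValue] at hexp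
  have hmean : ((greedyRun M O σ).mean fun y => ENNReal.ofReal (Real.exp (x / U * y))) ≤
      ENNReal.ofReal (Real.exp ((x + 4 * x ^ 2) / U * greedyValue O σ)) := by
    rw [greedyRun, PMF.mean_map]
    refine (mean_greedyFirst_law (g := fun h => Real.exp (x / U * totalDemand M h)) O σ
      fun h => (Real.exp_pos _).le).trans_le (ENNReal.ofReal_le_ofReal (hexp.trans ?_))
    refine le_trans ?_ (Real.add_one_le_exp _)
    rw [add_comm]
    refine add_le_add (mul_le_mul_of_nonneg_right ?_ (greedyValue_nonneg O σ)) le_rfl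
    rw [← hφU, le_div_iff₀ hU0]
    refine le_of_eq_of_le ?_ h2
    rw [show (Real.exp x - 1) / U * (φ * U) = (Real.exp x - 1) * φ by field_simp]
    field_simp
  have hT' : (T : ℝ) ≠ 0 := by positivity
  -- Exponential Markov inequality; the sign of `x` decides whether the event is an upper or a lower
  -- tail at `c`.
  refine (PMF.toOuterMeasure_le_mean _ _
    (fun a => ENNReal.ofReal (Real.exp (T * (x / U * (a - c))))) ?_).trans ?_
  · intro a ha
    rw [ENNReal.one_le_ofReal, Real.one_le_exp_iff]
    refine mul_nonneg (Nat.cast_nonneg _) ?_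
    rw [div_mul_eq_mul_div]
    exact div_nonneg ha hU0.le
  · rw [sampleAverage, PMF.mean_map]
    have e1 : ∀ l : List ℝ, ENNReal.ofReal (Real.exp (T * (x / U * (l.sum / T - c)))) =
        ENNReal.ofReal (Real.exp (x / U * l.sum)) *
          ENNReal.ofReal (Real.exp (-(T * (x / U * c)))) := by
      intro l
      rw [← ENNReal.ofReal_mul (Real.exp_pos _).le, ← Real.exp_add]
      congr 2
      field_simp
      ring
    simp only [e1]
    rw [PMF.mean_mul_right, independentRuns_mean_exp]
    refine (mul_le_mul_left (pow_le_pow_left' hmean T) _).trans_eq ?_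
    rw [← ENNReal.ofReal_pow (Real.exp_pos _).le, ← Real.exp_nat_mul,
      ← ENNReal.ofReal_mul (Real.exp_pos _).le, ← Real.exp_add, hU]
    congr 2
    field_simp
    ring

variable (hM : M.HasMonotoneSubmodularDemand) (O : M.Oracle) (σ : Equiv.Perm (Fin N))
  {T : ℕ} (hT : 0 < T) {V φ ε δ : ℝ} (hV : 0 < V) (hφ : 0 < φ) (hφ1 : φ ≤ 1) (hε : 0 < ε)
  (hε1 : ε ≤ 1 / 2) (hδ : 0 < δ) (hTδ : 64 * (Real.log (1 / δ) / (ε ^ 2 * φ)) ≤ T)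
  (hE : greedyValue O σ ≤ V)
  (hB : ∀ (i : Fin N) (j : Fin K) (A : Finset (Fin K)), 0 < (M.customer i).prob (some j) A →
    φ * (M.supplier j).demand {i} ≤ 2 * V)
include hM hT hV hφ hφ1 hε hε1 hδ hTδ hE hB

/-- The constant 64 arises here: the factor φ/(2V) times -(ε²/32)V is -ε²φ/64, and `T` such terms
reach log δ. -/
theorem sampleAverage_le_of_exponent {x : ℝ} (hx : |x| = ε / 8) {c : ℝ}
    (hc : (x + 4 * x ^ 2) * greedyValue O σ - x * c ≤ -(ε ^ 2 / 32) * V) :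
    (sampleAverage M O σ T).toOuterMeasure {a | 0 ≤ x * (a - c)} ≤ ENNReal.ofReal δ := by
  refine (sampleAverage_tail_le hM O σ hT hV hφ hφ1 (by rw [hx]; linarith) hE hB c).trans
    (ENNReal.ofReal_le_ofReal ?_)
  rw [← Real.exp_log hδ]
  refine Real.exp_le_exp.2 ?_
  rw [one_div, Real.log_inv, ← mul_div_assoc, div_le_iff₀ (by positivity)] at hTδ
  calc (T : ℝ) * (φ / (2 * V) * ((x + 4 * x ^ 2) * greedyValue O σ - x * c)) ≤
      T * (φ / (2 * V) * (-(ε ^ 2 / 32) * V)) := by gcongr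
    _ = -(T * (ε ^ 2 * φ)) / 64 := by field_simp; ring
    _ ≤ Real.log δ := by linarith

/-- With x = ε/8 the exponent is at most V(-ε²/32 - ε³/16). The scale is `V`, however small the
greedy value of this side may be. -/
theorem sampleAverage_upper_tail (hlow : greedyValue O σ ≤ (1 / 2 - ε) * V) :
    (sampleAverage M O σ T).toOuterMeasure {a | (1 / 2 - ε / 2) * V ≤ a} ≤
      ENNReal.ofReal δ := by
  refine le_trans (MeasureTheory.measure_mono fun a ha => ?_)
    (sampleAverage_le_of_exponent hM O σ hT hV hφ hφ1 hε hε1 hδ hTδ hE hB (x := ε / 8)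
      (abs_of_pos (by positivity)) (c := (1 / 2 - ε / 2) * V) ?_)
  · exact mul_nonneg (by positivity) (sub_nonneg.2 (Set.mem_ofPred.1 ha))
  · have : (ε / 8 + 4 * (ε / 8) ^ 2) * greedyValue O σ ≤
        (ε / 8 + 4 * (ε / 8) ^ 2) * ((1 / 2 - ε) * V) := by gcongr
    have h3 : 0 ≤ ε ^ 3 * V := by positivity
    nlinarith

/-- With x = -ε/8 and greedy value V/2 the exponent is exactly -(ε²/32)V; a larger greedy value only
lowers it. -/
theorem sampleAverage_lower_tail (hhigh : V / 2 ≤ greedyValue O σ) :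
    (sampleAverage M O σ T).toOuterMeasure {a | a ≤ (1 / 2 - ε / 2) * V} ≤
      ENNReal.ofReal δ := by
  refine le_trans (MeasureTheory.measure_mono fun a ha => ?_)
    (sampleAverage_le_of_exponent hM O σ hT hV hφ hφ1 hε hε1 hδ hTδ hE hB (x := -(ε / 8))
      (by rw [abs_neg, abs_of_pos (by positivity)]) (c := (1 / 2 - ε / 2) * V) ?_)
  · exact mul_nonneg_of_nonpos_of_nonpos (neg_nonpos.2 (by positivity)) (sub_nonpos.2 (Set.mem_ofPred.1 ha))
  · have : (ε / 8 - 4 * (ε / 8) ^ 2) * (V / 2) ≤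
        (ε / 8 - 4 * (ε / 8) ^ 2) * greedyValue O σ :=
      mul_le_mul_of_nonneg_left hhigh (by nlinarith)
    nlinarith

end Concentration

/-! ### Choosing the side by the larger estimate -/

section Selection

variable {n m : ℕ} {M : Market n m}

theorem estimates_map_fst (O : M.Oracle) (σC : Equiv.Perm (Fin n)) (σS : Equiv.Perm (Fin m))
    (T : ℕ) : (estimates M O σC σS T).map Prod.fst = sampleAverage M O σC T := by
  rw [estimates, PMF.map_bind]
  simp only [PMF.map_comp]
  conv_rhs => rw [← PMF.bind_pure (sampleAverage M O σC T)]
  congr 1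
  funext a
  exact PMF.map_const _ _

theorem estimates_map_snd (O : M.Oracle) (σC : Equiv.Perm (Fin n)) (σS : Equiv.Perm (Fin m))
    (T : ℕ) : (estimates M O σC σS T).map Prod.snd = sampleAverage M.swap O.swap σS T := by
  rw [estimates, PMF.map_bind]
  simp only [PMF.map_comp]
  conv_rhs => rw [← PMF.bind_const (sampleAverage M O σC T) (sampleAverage M.swap O.swap σS T)]
  congr 1
  funext a
  exact PMF.map_id _

theorem selectedPolicy_value_of_le (O : M.Oracle) (σC : Equiv.Perm (Fin n))
    (σS : Equiv.Perm (Fin m)) {e : ℝ × ℝ} (h : e.2 ≤ e.1) :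
    (selectedPolicy M O σC σS e).value M = ENNReal.ofReal (greedyValue O σC) := by
  rw [selectedPolicy, if_pos h]
  exact expectedMatches_greedyPolicy M O σC

theorem selectedPolicy_value_of_lt (O : M.Oracle) (σC : Equiv.Perm (Fin n))
    (σS : Equiv.Perm (Fin m)) {e : ℝ × ℝ} (h : e.1 < e.2) :
    (selectedPolicy M O σC σS e).value M = ENNReal.ofReal (greedyValue O.swap σS) := by
  rw [selectedPolicy, if_neg (not_le.2 h)]
  exact expectedMatches_greedyPolicy M.swap O.swap σS

/-- Deterministic part of the analysis: outside two unlikely events the selection is good. -/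
theorem selection_of_estimates (O : M.Oracle) (σC : Equiv.Perm (Fin n))
    (σS : Equiv.Perm (Fin m)) {V ε : ℝ} (hV : 0 < V) (hε : 0 < ε) {e : ℝ × ℝ}
    (hC : (1 / 2 - ε) * V ≤ greedyValue O σC ∨ e.1 < (1 / 2 - ε / 2) * V)
    (hS : (1 / 2 - ε) * V ≤ greedyValue O.swap σS ∨ e.2 < (1 / 2 - ε / 2) * V)
    (hmax : (1 / 2 - ε / 2) * V < max e.1 e.2) :
    ENNReal.ofReal ((1 / 2 - ε) * V) ≤ (selectedPolicy M O σC σS e).value M ∧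
      ENNReal.ofReal ((1 / 2 - ε) * V) ≤ ENNReal.ofReal (max e.1 e.2) := by
  refine ⟨?_, ENNReal.ofReal_le_ofReal (le_trans ?_ hmax.le)⟩
  · rcases le_or_gt e.2 e.1 with h | h
    · rw [selectedPolicy_value_of_le O σC σS h]
      rw [max_eq_left h] at hmax
      exact ENNReal.ofReal_le_ofReal (hC.resolve_right hmax.not_gt)
    · rw [selectedPolicy_value_of_lt O σC σS h]
      rw [max_eq_right h.le] at hmax
      exact ENNReal.ofReal_le_ofReal (hS.resolve_right hmax.not_gt)
  · nlinarith

theorem estimates_good (hM : M.HasMonotoneSubmodularDemand) (O : M.Oracle)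
    (σC : Equiv.Perm (Fin n)) (σS : Equiv.Perm (Fin m)) {ε δ : ℝ} (hε : 0 < ε) (hδ : 0 < δ)
    (hδ1 : δ < 1) (T : ℕ) (hT : 64 * (Real.log (1 / δ) / (ε ^ 2 * M.phiMin)) ≤ T) :
    ENNReal.ofReal (1 - 2 * δ) ≤ (estimates M O σC σS T).toOuterMeasure
      {e | ENNReal.ofReal (1 / 2 - ε) * M.opt ≤ (selectedPolicy M O σC σS e).value M ∧
        ENNReal.ofReal (1 / 2 - ε) * M.opt ≤ ENNReal.ofReal (max e.1 e.2)} := by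
  have hopt := Market.opt_le hM O σC σS
  have hne := ne_top_of_le_ne_top ENNReal.ofReal_ne_top hopt
  set V := M.opt.toReal with hVdef
  have hoptV : M.opt = ENNReal.ofReal V := (ENNReal.ofReal_toReal hne).symm
  have hV2 : V ≤ 2 * max (greedyValue O σC) (greedyValue O.swap σS) :=
    ENNReal.toReal_le_of_le_ofReal (by
      have := greedyValue_nonneg O σC
      have := le_max_left (greedyValue O σC) (greedyValue O.swap σS)
      linarith) hopt
  have hCV : greedyValue O σC ≤ V := by
    have h := Market.greedyValue_le_opt O σC
    rw [hoptV] at h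
    exact (ENNReal.ofReal_le_ofReal_iff ENNReal.toReal_nonneg).1 h
  have hSV : greedyValue O.swap σS ≤ V := by
    have h := Market.greedyValue_swap_le_opt O σS
    rw [hoptV] at h
    exact (ENNReal.ofReal_le_ofReal_iff ENNReal.toReal_nonneg).1 h
  have hone : ENNReal.ofReal (1 - 2 * δ) ≤ 1 := ENNReal.ofReal_le_one.2 (by linarith)
  -- If ε ≥ 1/2 or OPT = 0 there is nothing to prove. Excluding this case first also excludes φ_min
  -- = 0, where the required number of runs degenerates to 0 by the convention for division.
  by_cases htriv : ENNReal.ofReal (1 / 2 - ε) * M.opt = 0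
  · simp only [htriv, zero_le, and_self, Set.ofPred_true]
    rwa [(PMF.toOuterMeasure_apply_eq_one_iff _ _).2 (Set.subset_univ _)]
  rw [mul_eq_zero, not_or, ENNReal.ofReal_eq_zero, not_le, hoptV, ENNReal.ofReal_eq_zero,
    not_le] at htriv
  obtain ⟨hε1, hV⟩ := htriv
  have hφ : 0 < M.phiMin ∧ M.phiMin ≤ 1 := by
    rcases lt_max_iff.1 (by linarith : 0 < max (greedyValue O σC) (greedyValue O.swap σS)) with h | h
    · exact phiMin_pos_of_greedyValue_pos O σC h
    · rw [← M.phiMin_swap]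
      exact phiMin_pos_of_greedyValue_pos O.swap σS h
  -- δ < 1 makes the logarithm positive, so there is at least one run and the average is a genuine
  -- one.
  have hT0 : 0 < T := by
    have h1 : 0 < Real.log (1 / δ) := Real.log_pos (by rw [lt_div_iff₀ hδ]; linarith)
    have h2 : 0 < 64 * (Real.log (1 / δ) / (ε ^ 2 * M.phiMin)) := by
      have := hφ.1
      positivity
    exact_mod_cast h2.trans_le hT
  have hBC : ∀ (i : Fin n) (j : Fin m) (A : Finset (Fin m)), 0 < (M.customer i).prob (some j) A →
      M.phiMin * (M.supplier j).demand {i} ≤ 2 * V := fun i j A h =>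
    (phiMin_mul_demand_le hM O σC h).trans (by linarith)
  have hBS : ∀ (i : Fin m) (j : Fin n) (A : Finset (Fin n)),
      0 < (M.swap.customer i).prob (some j) A →
      M.phiMin * (M.swap.supplier j).demand {i} ≤ 2 * V := fun i j A h => by
    rw [← M.phiMin_swap]
    exact (phiMin_mul_demand_le hM.swap O.swap σS h).trans (by linarith)
  set c := (1 / 2 - ε / 2) * V
  -- the two unlikely events
  have hC1 : (1 / 2 - ε) * V ≤ greedyValue O σC ∨
      (estimates M O σC σS T).toOuterMeasure {e | c ≤ e.1} ≤ ENNReal.ofReal δ := by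
    refine (le_total _ _).imp_right fun h => ?_
    have := sampleAverage_upper_tail hM O σC hT0 hV hφ.1 hφ.2 hε (by linarith) hδ hT hCV hBC h
    rwa [← estimates_map_fst O σC σS, PMF.toOuterMeasure_map_apply] at this
  have hS1 : (1 / 2 - ε) * V ≤ greedyValue O.swap σS ∨
      (estimates M O σC σS T).toOuterMeasure {e | c ≤ e.2} ≤ ENNReal.ofReal δ := by
    refine (le_total _ _).imp_right fun h => ?_
    have := sampleAverage_upper_tail hM.swap O.swap σS hT0 hV hφ.1 hφ.2 hε (by linarith) hδ hT
      hSV hBS h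
    rwa [← estimates_map_snd O σC σS, PMF.toOuterMeasure_map_apply] at this
  have hδδ : ENNReal.ofReal (1 - 2 * δ) = 1 - (ENNReal.ofReal δ + ENNReal.ofReal δ) := by
    rw [ENNReal.ofReal_sub _ (by linarith), ENNReal.ofReal_one, two_mul,
      ENNReal.ofReal_add hδ.le hδ.le]
  rw [hδδ, hoptV, ← ENNReal.ofReal_mul hε1.le]
  -- The side with the larger greedy value has at least V/2, so its estimate is rarely low; the
  -- other side matters only if its value is below (1/2 - ε)V, and then its estimate is rarely high.
  rcases le_total (greedyValue O.swap σS) (greedyValue O σC) with hside | hside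
  · rw [max_eq_left hside] at hV2
    have hlow := sampleAverage_lower_tail hM O σC hT0 hV hφ.1 hφ.2 hε (by linarith) hδ hT hCV hBC
      (by linarith)
    rw [← estimates_map_fst O σC σS, PMF.toOuterMeasure_map_apply] at hlow
    have hClow : (1 / 2 - ε) * V ≤ greedyValue O σC := by nlinarith
    refine PMF.one_sub_le_toOuterMeasure _ _ ?_
    rcases hS1 with hS1 | hS1
    · refine (MeasureTheory.measure_mono fun e he => ?_).trans (hlow.trans le_self_add)
      by_contra hcon
      exact he (selection_of_estimates O σC σS hV hε (Or.inl hClow) (Or.inl hS1)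
        (lt_max_of_lt_left (not_le.1 hcon)))
    · refine (MeasureTheory.measure_mono fun e he => ?_).trans
        ((MeasureTheory.measure_union_le _ _).trans (add_le_add hlow hS1))
      by_contra hcon
      rw [Set.mem_union, not_or] at hcon
      exact he (selection_of_estimates O σC σS hV hε (Or.inl hClow) (Or.inr (not_le.1 hcon.2))
        (lt_max_of_lt_left (not_le.1 hcon.1)))
  · rw [max_eq_right hside] at hV2
    have hlow := sampleAverage_lower_tail hM.swap O.swap σS hT0 hV hφ.1 hφ.2 hε (by linarith) hδ hT
      hSV hBS (by linarith)
    rw [← estimates_map_snd O σC σS, PMF.toOuterMeasure_map_apply] at hlow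
    have hSlow : (1 / 2 - ε) * V ≤ greedyValue O.swap σS := by nlinarith
    refine PMF.one_sub_le_toOuterMeasure _ _ ?_
    rcases hC1 with hC1 | hC1
    · refine (MeasureTheory.measure_mono fun e he => ?_).trans (hlow.trans le_self_add)
      by_contra hcon
      exact he (selection_of_estimates O σC σS hV hε (Or.inl hC1) (Or.inl hSlow)
        (lt_max_of_lt_right (not_le.1 hcon)))
    · refine (MeasureTheory.measure_mono fun e he => ?_).trans
        ((MeasureTheory.measure_union_le _ _).trans (add_le_add hlow hC1))
      by_contra hcon
      rw [Set.mem_union, not_or] at hcon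
      exact he (selection_of_estimates O σC σS hV hε (Or.inr (not_le.1 hcon.2)) (Or.inl hSlow)
        (lt_max_of_lt_right (not_le.1 hcon.1)))

end Selection

/-! ### Frames: what a program does not modify -/

namespace Stmt

/-- The program never writes to the integer array `a`. -/
def KeepsInt (a : ℕ) : Stmt → Prop
  | .skip => True
  | .seq p q => p.KeepsInt a ∧ q.KeepsInt a
  | .setInt arr _ _ _ => a ≠ arr
  | .setReal _ _ _ => True
  | .ifInt _ _ p q => p.KeepsInt a ∧ q.KeepsInt a
  | .ifReal _ _ p q => p.KeepsInt a ∧ q.KeepsInt a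
  | .loop ctr _ p => a ≠ ctr ∧ p.KeepsInt a
  | .evalChoice _ _ _ _ _ _ _ => True
  | .optimize _ _ _ arr _ => a ≠ arr
  | .simulate _ _ _ _ dst _ _ => a ≠ dst
  | .process _ _ _ _ dst _ _ => a ≠ dst

/-- The program never writes to the real array `a`. -/
def KeepsReal (a : ℕ) : Stmt → Prop
  | .skip => True
  | .seq p q => p.KeepsReal a ∧ q.KeepsReal a
  | .setInt _ _ _ _ => True
  | .setReal arr _ _ => a ≠ arr
  | .ifInt _ _ p q => p.KeepsReal a ∧ q.KeepsReal a
  | .ifReal _ _ p q => p.KeepsReal a ∧ q.KeepsReal a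
  | .loop _ _ p => p.KeepsReal a
  | .evalChoice _ _ _ _ _ dst _ => a ≠ dst
  | .optimize _ _ _ _ _ => True
  | .simulate _ _ _ _ _ _ _ => True
  | .process _ _ _ _ _ _ _ => True

/-- The program never shows an assortment to an actual agent. -/
def KeepsTranscript : Stmt → Prop
  | .seq p q => p.KeepsTranscript ∧ q.KeepsTranscript
  | .ifInt _ _ p q => p.KeepsTranscript ∧ q.KeepsTranscript
  | .ifReal _ _ p q => p.KeepsTranscript ∧ q.KeepsTranscript
  | .loop _ _ p => p.KeepsTranscript
  | .process _ _ _ _ _ _ _ => False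
  | _ => True

end Stmt

section Frame

variable {n m : ℕ}

/-- The memories `s` and `s'` agree on everything that `p` does not write to. -/
structure Frame (p : Stmt) (s s' : Memory n m) : Prop where
  ints : ∀ a, p.KeepsInt a → s'.ints a = s.ints a
  reals : ∀ a, p.KeepsReal a → s'.reals a = s.reals a
  transcript : p.KeepsTranscript → s'.transcript = s.transcript

theorem Memory.setInt_ints_of_ne (s : Memory n m) {a arr : ℕ} (h : a ≠ arr) (r c v : ℕ) :
    (s.setInt arr r c v).ints a = s.ints a := by
  funext; simp [Memory.setInt, h]

theorem Memory.setReal_reals_of_ne (s : Memory n m) {a arr : ℕ} (h : a ≠ arr) (i : ℕ) (v : ℝ) :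
    (s.setReal arr i v).reals a = s.reals a := by
  funext; simp [Memory.setReal, h]

theorem Memory.putSet_ints_of_ne (s : Memory n m) {a arr k : ℕ} (h : a ≠ arr) (r : ℕ)
    (A : Finset (Fin k)) : (s.putSet arr r A).ints a = s.ints a := by
  funext; simp [Memory.putSet, h]

/-- A relation that holds along every iteration of a loop holds along the loop. -/
theorem iterate_support {α : Type} (body : ℕ → α → PMF α) (R : ℕ → α → Prop) (e : ℕ) (a0 : α)
    (h0 : R 0 a0)
    (hstep : ∀ c < e, ∀ a, R c a → ∀ b ∈ (body c a).support, R (c + 1) b) :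
    ∀ b ∈ (iterate body e a0).support, R e b := by
  induction e with
  | zero =>
    intro b hb
    rw [iterate, PMF.mem_support_pure_iff] at hb
    exact hb ▸ h0
  | succ e ih =>
    intro b hb
    rw [iterate, PMF.mem_support_bind_iff] at hb
    obtain ⟨a, ha, hb⟩ := hb
    exact hstep e (Nat.lt_succ_self e) a
      (ih (fun c hc => hstep c (hc.trans (Nat.lt_succ_self e))) a ha) b hb

/-- Lets each specification mention only what a program computes: preservation of all other arrays
reduces to a syntactic check. -/
theorem Stmt.frame (M : Market n m) (O : M.Oracle) (p : Stmt) (s : Memory n m) :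
    ∀ s' ∈ (p.run M O s).support, Frame p s s' := by
  induction p generalizing s with
  | skip =>
    intro s' hs
    rw [Stmt.run, PMF.mem_support_pure_iff] at hs
    subst hs
    exact ⟨fun _ _ => rfl, fun _ _ => rfl, fun _ => rfl⟩
  | seq p q ihp ihq =>
    intro s' hs
    rw [Stmt.run, PMF.mem_support_bind_iff] at hs
    obtain ⟨t, ht, hs⟩ := hs
    have h1 := ihp s t ht
    have h2 := ihq t s' hs
    exact ⟨fun a h => (h2.ints a h.2).trans (h1.ints a h.1),
      fun a h => (h2.reals a h.2).trans (h1.reals a h.1),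
      fun h => (h2.transcript h.2).trans (h1.transcript h.1)⟩
  | setInt arr row col e =>
    intro s' hs
    rw [Stmt.run, PMF.mem_support_pure_iff] at hs
    subst hs
    exact ⟨fun a h => s.setInt_ints_of_ne h _ _ _, fun _ _ => rfl, fun _ => rfl⟩
  | setReal arr idx e =>
    intro s' hs
    rw [Stmt.run, PMF.mem_support_pure_iff] at hs
    subst hs
    exact ⟨fun _ _ => rfl, fun a h => s.setReal_reals_of_ne h _ _, fun _ => rfl⟩
  | ifInt a b p q ihp ihq =>
    intro s' hs
    rw [Stmt.run] at hs
    split_ifs at hs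
    · have h1 := ihp _ s' hs
      exact ⟨fun a h => h1.ints a h.1, fun a h => h1.reals a h.1, fun h => h1.transcript h.1⟩
    · have h1 := ihq _ s' hs
      exact ⟨fun a h => h1.ints a h.2, fun a h => h1.reals a h.2, fun h => h1.transcript h.2⟩
  | ifReal a b p q ihp ihq =>
    intro s' hs
    rw [Stmt.run] at hs
    split_ifs at hs
    · have h1 := ihp _ s' hs
      exact ⟨fun a h => h1.ints a h.1, fun a h => h1.reals a h.1, fun h => h1.transcript h.1⟩
    · have h1 := ihq _ s' hs
      exact ⟨fun a h => h1.ints a h.2, fun a h => h1.reals a h.2, fun h => h1.transcript h.2⟩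
  | loop ctr e p ih =>
    rw [Stmt.run]
    refine iterate_support _ (fun _ s' => Frame (.loop ctr e p) s s') _ _
      ⟨fun _ _ => rfl, fun _ _ => rfl, fun _ => rfl⟩ fun c _ t ht s' hs => ?_
    have h1 := ih _ s' hs
    exact ⟨fun a h => (h1.ints a h.2).trans
        ((t.setInt_ints_of_ne h.1 0 0 c).trans (ht.ints a h)),
      fun a h => (h1.reals a h).trans (ht.reals a h),
      fun h => (h1.transcript h).trans (ht.transcript h)⟩
  | evalChoice side agent opt arr row dst idx =>
    intro s' hs
    cases side <;> simp only [Stmt.run] at hs <;> split_ifs at hs <;>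
      rw [PMF.mem_support_pure_iff] at hs <;> subst hs
    exacts [⟨fun _ _ => rfl, fun a h => Memory.setReal_reals_of_ne _ h _ _, fun _ => rfl⟩,
      ⟨fun _ _ => rfl, fun _ _ => rfl, fun _ => rfl⟩,
      ⟨fun _ _ => rfl, fun a h => Memory.setReal_reals_of_ne _ h _ _, fun _ => rfl⟩,
      ⟨fun _ _ => rfl, fun _ _ => rfl, fun _ => rfl⟩]
  | optimize side agent w arr row =>
    intro s' hs
    cases side <;> simp only [Stmt.run] at hs <;> split_ifs at hs <;>
      rw [PMF.mem_support_pure_iff] at hs <;> subst hs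
    exacts [⟨fun a h => Memory.putSet_ints_of_ne _ h _ _, fun _ _ => rfl, fun _ => rfl⟩,
      ⟨fun _ _ => rfl, fun _ _ => rfl, fun _ => rfl⟩,
      ⟨fun a h => Memory.putSet_ints_of_ne _ h _ _, fun _ _ => rfl, fun _ => rfl⟩,
      ⟨fun _ _ => rfl, fun _ _ => rfl, fun _ => rfl⟩]
  | simulate side agent arr row dst r c =>
    intro s' hs
    cases side <;> simp only [Stmt.run] at hs <;> split_ifs at hs <;>
      simp only [PMF.mem_support_map_iff, PMF.mem_support_pure_iff] at hs
    · obtain ⟨o, -, rfl⟩ := hs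
      exact ⟨fun a h => Memory.setInt_ints_of_ne _ h _ _ _, fun _ _ => rfl, fun _ => rfl⟩
    · subst hs
      exact ⟨fun _ _ => rfl, fun _ _ => rfl, fun _ => rfl⟩
    · obtain ⟨o, -, rfl⟩ := hs
      exact ⟨fun a h => Memory.setInt_ints_of_ne _ h _ _ _, fun _ _ => rfl, fun _ => rfl⟩
    · subst hs
      exact ⟨fun _ _ => rfl, fun _ _ => rfl, fun _ => rfl⟩
  | process side agent arr row dst r c =>
    intro s' hs
    cases side <;> simp only [Stmt.run] at hs <;> split_ifs at hs <;>
      simp only [PMF.mem_support_map_iff, PMF.mem_support_pure_iff] at hs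
    · obtain ⟨o, -, rfl⟩ := hs
      exact ⟨fun a h => Memory.setInt_ints_of_ne _ h _ _ _, fun _ _ => rfl, fun h => h.elim⟩
    · subst hs
      exact ⟨fun _ _ => rfl, fun _ _ => rfl, fun _ => rfl⟩
    · obtain ⟨o, -, rfl⟩ := hs
      exact ⟨fun a h => Memory.setInt_ints_of_ne _ h _ _ _, fun _ _ => rfl, fun h => h.elim⟩
    · subst hs
      exact ⟨fun _ _ => rfl, fun _ _ => rfl, fun _ => rfl⟩

end Frame

/-! ### Running time -/

namespace Stmt

/-- Every loop bound is one of the three input sizes. -/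
def BoundedLoops : Stmt → Prop
  | .seq p q => p.BoundedLoops ∧ q.BoundedLoops
  | .ifInt _ _ p q => p.BoundedLoops ∧ q.BoundedLoops
  | .ifReal _ _ p q => p.BoundedLoops ∧ q.BoundedLoops
  | .loop _ e p => (∃ c ≤ 2, e = .cell 0 (.lit 0) (.lit c)) ∧ p.BoundedLoops
  | _ => True

/-- Nesting depth of loops over the agents, plus one. -/
def sizeDegree : Stmt → ℕ
  | .seq p q => max p.sizeDegree q.sizeDegree
  | .ifInt _ _ p q => max p.sizeDegree q.sizeDegree
  | .ifReal _ _ p q => max p.sizeDegree q.sizeDegree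
  | .loop _ (.cell 0 (.lit 0) (.lit 2)) p => p.sizeDegree
  | .loop _ _ p => p.sizeDegree + 1
  | _ => 1

/-- Nesting depth of loops over the simulated runs. -/
def runDegree : Stmt → ℕ
  | .seq p q => max p.runDegree q.runDegree
  | .ifInt _ _ p q => max p.runDegree q.runDegree
  | .ifReal _ _ p q => max p.runDegree q.runDegree
  | .loop _ (.cell 0 (.lit 0) (.lit 2)) p => p.runDegree + 1
  | .loop _ _ p => p.runDegree
  | _ => 0

/-- Leading coefficient of the bound on the running time. -/
def costCoeff : Stmt → ℕ
  | .skip => 1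
  | .seq p q => p.costCoeff + q.costCoeff
  | .setInt _ row col e => 1 + row.size + col.size + e.size
  | .setReal _ idx e => 1 + idx.size + e.size
  | .ifInt a b p q => 1 + a.size + b.size + (p.costCoeff + q.costCoeff)
  | .ifReal a b p q => 1 + a.size + b.size + (p.costCoeff + q.costCoeff)
  | .loop _ e p => 1 + e.size + (1 + p.costCoeff)
  | .evalChoice _ agent opt _ row _ idx => 1 + agent.size + opt.size + row.size + idx.size
  | .optimize _ agent _ _ row => 1 + agent.size + row.size
  | .simulate _ agent _ row _ r c => 1 + agent.size + row.size + r.size + c.size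
  | .process _ agent _ row _ r c => 1 + agent.size + row.size + r.size + c.size

/-- Bound on the running time with `n` customers, `m` suppliers and `T` runs. -/
def costBound (n m T : ℕ) (p : Stmt) : ℕ :=
  p.costCoeff * ((n + m + 1) ^ p.sizeDegree * (T + 1) ^ p.runDegree)

theorem steps_le_of_iterate {n m : ℕ} (body : ℕ → Memory n m → PMF (Memory n m))
    (Q : Memory n m → Prop) (b e : ℕ) (s : Memory n m) (hQ : Q s)
    (hb : ∀ c s, Q s → ∀ s' ∈ (body c s).support, Q s' ∧ s'.steps ≤ s.steps + b) :
    ∀ s' ∈ (iterate body e s).support, s'.steps ≤ s.steps + e * b := by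
  intro s' hs
  refine (iterate_support body (fun c t => Q t ∧ t.steps ≤ s.steps + c * b) e s
    ⟨hQ, by omega⟩ ?_ s' hs).2
  rintro c - t ⟨h1, h2⟩ t' ht'
  obtain ⟨h3, h4⟩ := hb c t h1 t' ht'
  exact ⟨h3, by rw [add_mul]; omega⟩

theorem steps_le {n m : ℕ} (M : Market n m) (O : M.Oracle) (T : ℕ) (p : Stmt)
    (hp : p.BoundedLoops) (h0 : p.KeepsInt 0) (s : Memory n m) (hn : s.ints 0 0 0 = n)
    (hm : s.ints 0 0 1 = m) (hT : s.ints 0 0 2 = T) :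
    ∀ s' ∈ (p.run M O s).support, s'.steps ≤ s.steps + p.costBound n m T := by
  have hone : ∀ a b : ℕ, 1 ≤ (n + m + 1) ^ a * (T + 1) ^ b := fun a b =>
    Nat.mul_pos (pow_pos (by omega) _) (pow_pos (by omega) _)
  -- Basic instructions may be charged n + m, which is why degrees start at 1 in n + m + 1.
  have hatom : ∀ k : ℕ, k + 1 ≤ (k + 1) * ((n + m + 1) ^ 1 * (T + 1) ^ 0) ∧
      k + 1 + n + m ≤ (k + 1) * ((n + m + 1) ^ 1 * (T + 1) ^ 0) := by
    intro k
    rw [pow_one, pow_zero, mul_one]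
    constructor <;> nlinarith [Nat.zero_le (k * (n + m))]
  have hmono : ∀ {a b c d : ℕ}, a ≤ b → c ≤ d →
      (n + m + 1) ^ a * (T + 1) ^ c ≤ (n + m + 1) ^ b * (T + 1) ^ d := fun hab hcd =>
    Nat.mul_le_mul (Nat.pow_le_pow_right (by omega) hab) (Nat.pow_le_pow_right (by omega) hcd)
  have hbranch : ∀ k p q : _, k + costBound n m T p ≤ (k + (p.costCoeff + q.costCoeff)) *
      ((n + m + 1) ^ max p.sizeDegree q.sizeDegree * (T + 1) ^ max p.runDegree q.runDegree) ∧
      k + costBound n m T q ≤ (k + (p.costCoeff + q.costCoeff)) *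
      ((n + m + 1) ^ max p.sizeDegree q.sizeDegree * (T + 1) ^ max p.runDegree q.runDegree) := by
    intro k p q
    have h1 := Nat.mul_le_mul_left p.costCoeff
      (hmono (le_max_left p.sizeDegree q.sizeDegree) (le_max_left p.runDegree q.runDegree))
    have h2 := Nat.mul_le_mul_left q.costCoeff
      (hmono (le_max_right p.sizeDegree q.sizeDegree) (le_max_right p.runDegree q.runDegree))
    have h3 := Nat.mul_le_mul_left k
      (hone (max p.sizeDegree q.sizeDegree) (max p.runDegree q.runDegree))
    simp only [costBound, add_mul]
    omega
  induction p generalizing s with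
  | skip =>
    intro s' hs
    rw [Stmt.run, PMF.mem_support_pure_iff] at hs
    subst hs
    exact Nat.add_le_add_left (hatom 0).1 _
  | seq p q ihp ihq =>
    intro s' hs
    rw [Stmt.run, PMF.mem_support_bind_iff] at hs
    obtain ⟨t, ht, hs⟩ := hs
    have hf := (p.frame M O s t ht).ints 0 h0.1
    have h1 := ihp hp.1 h0.1 s hn hm hT t ht
    have h2 := ihq hp.2 h0.2 t (by rw [hf, hn]) (by rw [hf, hm]) (by rw [hf, hT]) s' hs
    have h3 := Nat.mul_le_mul_left p.costCoeff
      (hmono (le_max_left p.sizeDegree q.sizeDegree) (le_max_left p.runDegree q.runDegree))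
    have h4 := Nat.mul_le_mul_left q.costCoeff
      (hmono (le_max_right p.sizeDegree q.sizeDegree) (le_max_right p.runDegree q.runDegree))
    simp only [costBound, costCoeff, sizeDegree, runDegree, add_mul] at *
    omega
  | setInt arr row col e =>
    intro s' hs
    rw [Stmt.run, PMF.mem_support_pure_iff] at hs
    subst hs
    have := (hatom (row.size + col.size + e.size)).1
    simp only [costBound, costCoeff, sizeDegree, runDegree, Memory.tick, Memory.setInt]
    rw [show 1 + row.size + col.size + e.size = row.size + col.size + e.size + 1 by omega]
    omega
  | setReal arr idx e =>
    intro s' hs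
    rw [Stmt.run, PMF.mem_support_pure_iff] at hs
    subst hs
    have := (hatom (idx.size + e.size)).1
    simp only [costBound, costCoeff, sizeDegree, runDegree, Memory.tick, Memory.setReal]
    rw [show 1 + idx.size + e.size = idx.size + e.size + 1 by omega]
    omega
  | ifInt a b p q ihp ihq =>
    intro s' hs
    have h3 := hbranch (1 + a.size + b.size) p q
    rw [Stmt.run] at hs
    split_ifs at hs
    · have h1 := ihp hp.1 h0.1 (s.tick (1 + a.size + b.size)) hn hm hT s' hs
      simp only [Memory.tick] at h1
      exact h1.trans (by rw [add_assoc]; exact Nat.add_le_add_left h3.1 _)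
    · have h1 := ihq hp.2 h0.2 (s.tick (1 + a.size + b.size)) hn hm hT s' hs
      simp only [Memory.tick] at h1
      exact h1.trans (by rw [add_assoc]; exact Nat.add_le_add_left h3.2 _)
  | ifReal a b p q ihp ihq =>
    intro s' hs
    have h3 := hbranch (1 + a.size + b.size) p q
    rw [Stmt.run] at hs
    split_ifs at hs
    · have h1 := ihp hp.1 h0.1 (s.tick (1 + a.size + b.size)) hn hm hT s' hs
      simp only [Memory.tick] at h1
      exact h1.trans (by rw [add_assoc]; exact Nat.add_le_add_left h3.1 _)
    · have h1 := ihq hp.2 h0.2 (s.tick (1 + a.size + b.size)) hn hm hT s' hs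
      simp only [Memory.tick] at h1
      exact h1.trans (by rw [add_assoc]; exact Nat.add_le_add_left h3.2 _)
  | loop ctr e p ih =>
    intro s' hs
    obtain ⟨⟨c, hc2, rfl⟩, hp⟩ := hp
    rw [Stmt.run] at hs
    -- Array 0 is never written, so the sizes stored there keep their values and bound the inner
    -- loops in every iteration.
    have h1 := steps_le_of_iterate _ (fun t : Memory n m => t.ints 0 = s.ints 0)
      (1 + p.costBound n m T) _ (s.tick _) rfl (fun c t ht t' ht' => by
        have e1 : ((t.setInt ctr 0 0 c).tick 1).ints 0 = s.ints 0 :=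
          (t.setInt_ints_of_ne h0.1 0 0 c).trans ht
        refine ⟨((p.frame M O _ t' ht').ints 0 h0.2).trans e1, ?_⟩
        have h2 := ih hp h0.2 _ (by rw [e1, hn]) (by rw [e1, hm]) (by rw [e1, hT]) t' ht'
        simp only [Memory.tick, Memory.setInt] at h2
        omega) s' hs
    simp only [IntExpr.eval, Memory.tick] at h1
    refine h1.trans ?_
    rw [add_assoc]
    refine Nat.add_le_add_left ?_ _
    -- A loop of `B ≤ k` iterations multiplies the monomial `X` by `k`, that is n + m + 1 or T + 1;
    -- the overhead goes into the coefficient.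
    have h5 : ∀ B X : ℕ, 1 ≤ X → ∀ k c : ℕ, 1 ≤ k → B ≤ k →
        1 + c + B * (1 + p.costCoeff * X) ≤ (1 + c + (1 + p.costCoeff)) * (X * k) := by
      intro B X hX k c hk hB
      have hXk : 1 ≤ X * k := Nat.mul_pos hX hk
      calc 1 + c + B * (1 + p.costCoeff * X) ≤ 1 + c + k * (X + p.costCoeff * X) := by gcongr
        _ = (1 + c) * 1 + (1 + p.costCoeff) * (X * k) := by ring
        _ ≤ (1 + c) * (X * k) + (1 + p.costCoeff) * (X * k) := by gcongr
        _ = _ := by ring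
    have hX := hone p.sizeDegree p.runDegree
    have hc : c = 0 ∨ c = 1 ∨ c = 2 := by omega
    simp only [costBound, costCoeff]
    rcases hc with rfl | rfl | rfl
    · rw [hn]
      simp only [sizeDegree, runDegree]
      refine (h5 n _ hX (n + m + 1) _ (by omega) (by omega)).trans_eq ?_
      ring
    · rw [hm]
      simp only [sizeDegree, runDegree]
      refine (h5 m _ hX (n + m + 1) _ (by omega) (by omega)).trans_eq ?_
      ring
    · rw [hT]
      simp only [sizeDegree, runDegree]
      refine (h5 T _ hX (T + 1) _ (by omega) (by omega)).trans_eq ?_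
      ring
  | evalChoice side agent opt arr row dst idx =>
    intro s' hs
    have := (hatom (agent.size + opt.size + row.size + idx.size)).2
    rw [show agent.size + opt.size + row.size + idx.size + 1 =
      1 + agent.size + opt.size + row.size + idx.size by omega] at this
    cases side <;> simp only [Stmt.run] at hs <;> split_ifs at hs <;>
      rw [PMF.mem_support_pure_iff] at hs <;> subst hs <;>
      simp only [costBound, costCoeff, sizeDegree, runDegree, Memory.tick, Memory.setReal] <;> omega
  | optimize side agent w arr row =>
    intro s' hs
    have := (hatom (agent.size + row.size)).2
    rw [show agent.size + row.size + 1 = 1 + agent.size + row.size by omega] at this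
    cases side <;> simp only [Stmt.run] at hs <;> split_ifs at hs <;>
      rw [PMF.mem_support_pure_iff] at hs <;> subst hs <;>
      simp only [costBound, costCoeff, sizeDegree, runDegree, Memory.tick, Memory.putSet] <;> omega
  | simulate side agent arr row dst r c =>
    intro s' hs
    have := (hatom (agent.size + row.size + r.size + c.size)).2
    rw [show agent.size + row.size + r.size + c.size + 1 =
      1 + agent.size + row.size + r.size + c.size by omega] at this
    cases side <;> simp only [Stmt.run] at hs <;> split_ifs at hs <;>
      simp only [PMF.mem_support_map_iff, PMF.mem_support_pure_iff] at hs <;>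
      obtain ⟨o, -, rfl⟩ := hs <;>
      simp only [costBound, costCoeff, sizeDegree, runDegree, Memory.tick, Memory.setInt] <;>
      omega
  | process side agent arr row dst r c =>
    intro s' hs
    have := (hatom (agent.size + row.size + r.size + c.size)).2
    rw [show agent.size + row.size + r.size + c.size + 1 =
      1 + agent.size + row.size + r.size + c.size by omega] at this
    cases side <;> simp only [Stmt.run] at hs <;> split_ifs at hs <;>
      simp only [PMF.mem_support_map_iff, PMF.mem_support_pure_iff] at hs <;>
      obtain ⟨o, -, rfl⟩ := hs <;>
      simp only [costBound, costCoeff, sizeDegree, runDegree, Memory.tick, Memory.setInt,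
        Memory.record] <;>
      omega

end Stmt

/-! ### Exchanging the two sides -/

def Side.swap : Side → Side
  | .customer => .supplier
  | .supplier => .customer

/-- The program with the roles of the two sides exchanged. -/
def Stmt.swap : Stmt → Stmt
  | .skip => .skip
  | .seq p q => .seq p.swap q.swap
  | .setInt arr row col e => .setInt arr row col e
  | .setReal arr idx e => .setReal arr idx e
  | .ifInt a b p q => .ifInt a b p.swap q.swap
  | .ifReal a b p q => .ifReal a b p.swap q.swap
  | .loop ctr e p => .loop ctr e p.swap
  | .evalChoice side agent opt arr row dst idx =>
      .evalChoice side.swap agent opt arr row dst idx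
  | .optimize side agent w arr row => .optimize side.swap agent w arr row
  | .simulate side agent arr row dst r c => .simulate side.swap agent arr row dst r c
  | .process side agent arr row dst r c => .process side.swap agent arr row dst r c

section Swap

variable {n m : ℕ}

/-- The arrays are not permuted, so the cells holding the two sizes stay in place. For this reason
the code takes the positions of the sizes as parameters. -/
def Memory.swap (s : Memory n m) : Memory m n where
  ints := s.ints
  reals := s.reals
  transcript := s.transcript.map Sum.swap
  steps := s.steps

theorem Memory.swap_swap (s : Memory n m) : s.swap.swap = s := by
  cases s
  simp [Memory.swap]

theorem iterate_map {α β : Type} (f : α → β) (body : ℕ → α → PMF α) (body' : ℕ → β → PMF β)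
    (h : ∀ c a, body' c (f a) = (body c a).map f) (e : ℕ) (a : α) :
    iterate body' e (f a) = (iterate body e a).map f := by
  induction e with
  | zero => simp [iterate, PMF.pure_map]
  | succ e ih =>
    rw [iterate, iterate, ih, PMF.bind_map, PMF.map_bind]
    congr 1
    funext a
    exact h e a

/-- Reduces every statement about suppliers initiating to the case of customers initiating; the
specifications below treat only the latter. -/
theorem Stmt.run_swap (M : Market n m) (O : M.Oracle) (p : Stmt) (s : Memory n m) :
    p.swap.run M.swap O.swap s.swap = (p.run M O s).map Memory.swap := by
  have hcomm : ∀ k : ℕ, k + m + n = k + n + m := fun k => by omega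
  induction p generalizing s with
  | skip => simp only [Stmt.swap, Stmt.run, PMF.pure_map]; rfl
  | seq p q ihp ihq =>
    simp only [Stmt.swap, Stmt.run]
    rw [ihp, PMF.bind_map, PMF.map_bind]
    congr 1
    funext t
    exact ihq t
  | setInt arr row col e => simp only [Stmt.swap, Stmt.run, PMF.pure_map]; rfl
  | setReal arr idx e => simp only [Stmt.swap, Stmt.run, PMF.pure_map]; rfl
  | ifInt a b p q ihp ihq =>
    simp only [Stmt.swap, Stmt.run]
    split_ifs with h1 h2 h2
    exacts [ihp (s.tick _), absurd h1 h2, absurd h2 h1, ihq (s.tick _)]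
  | ifReal a b p q ihp ihq =>
    simp only [Stmt.swap, Stmt.run]
    split_ifs with h1 h2 h2
    exacts [ihp (s.tick _), absurd h1 h2, absurd h2 h1, ihq (s.tick _)]
  | loop ctr e p ih =>
    simp only [Stmt.swap, Stmt.run]
    exact iterate_map Memory.swap _ _ (fun c t => ih ((t.setInt ctr 0 0 c).tick 1)) _ (s.tick _)
  | evalChoice side agent opt arr row dst idx =>
    cases side <;> simp only [Stmt.swap, Side.swap, Stmt.run] <;> rw [hcomm] <;>
      split_ifs with h1 h2 h2 <;>
      first
        | exact absurd h1 h2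
        | exact absurd h2 h1
        | (rw [PMF.pure_map]; rfl)
  | optimize side agent w arr row =>
    cases side <;> simp only [Stmt.swap, Side.swap, Stmt.run] <;> rw [hcomm] <;>
      split_ifs with h1 h2 h2 <;>
      first
        | exact absurd h1 h2
        | exact absurd h2 h1
        | (rw [PMF.pure_map]; rfl)
  | simulate side agent arr row dst r c =>
    cases side <;> simp only [Stmt.swap, Side.swap, Stmt.run] <;> rw [hcomm] <;>
      split_ifs with h1 h2 h2 <;>
      first
        | exact absurd h1 h2
        | exact absurd h2 h1
        | (rw [PMF.pure_map]; rfl)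
        | (rw [PMF.map_comp]; rfl)
  | process side agent arr row dst r c =>
    cases side <;> simp only [Stmt.swap, Side.swap, Stmt.run] <;> rw [hcomm] <;>
      split_ifs with h1 h2 h2 <;>
      first
        | exact absurd h1 h2
        | exact absurd h2 h1
        | (rw [PMF.pure_map]; rfl)
        | (rw [PMF.map_comp]; rfl)

end Swap

/-! ### Program logic -/

theorem PMF.bind_congr_support {α β : Type*} (p : PMF α) {f g : α → PMF β}
    (h : ∀ a ∈ p.support, f a = g a) : p.bind f = p.bind g := by
  ext b
  rw [PMF.bind_apply, PMF.bind_apply]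
  refine tsum_congr fun a => ?_
  by_cases ha : a ∈ p.support
  · rw [h a ha]
  · rw [PMF.mem_support_iff, not_not] at ha
    rw [ha, zero_mul, zero_mul]

section Logic

variable {n m : ℕ} {M : Market n m} {O : M.Oracle} {α β : Type}

/-- Started in `s`, the program `p` draws a result `a` with law `μ` and ends in a memory that
satisfies `P a`: the law of the final memory is coupled with `μ`. -/
def Stmt.Draws (M : Market n m) (O : M.Oracle) (p : Stmt) (s : Memory n m) (μ : PMF α)
    (P : α → Memory n m → Prop) : Prop :=
  ∃ w : PMF (α × Memory n m), w.map Prod.fst = μ ∧ w.map Prod.snd = p.run M O s ∧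
    ∀ x ∈ w.support, P x.1 x.2

/-- Started in `s`, the program `p` ends in a memory that satisfies `P`. -/
def Stmt.Ends (M : Market n m) (O : M.Oracle) (p : Stmt) (s : Memory n m)
    (P : Memory n m → Prop) : Prop :=
  ∀ s' ∈ (p.run M O s).support, P s'

namespace Stmt.Ends

variable {p q : Stmt} {s : Memory n m} {P Q : Memory n m → Prop}

theorem mono (h : p.Ends M O s P) (hP : ∀ s', P s' → Frame p s s' → Q s') : p.Ends M O s Q :=
  fun s' hs => hP s' (h s' hs) (p.frame M O s s' hs)

theorem of_run_eq {t : Memory n m} (h : p.run M O s = PMF.pure t) (hP : P t) :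
    p.Ends M O s P := by
  intro s' hs
  rw [h, PMF.mem_support_pure_iff] at hs
  exact hs ▸ hP

theorem seq (hp : p.Ends M O s P) (hq : ∀ s', P s' → Frame p s s' → q.Ends M O s' Q) :
    (Stmt.seq p q).Ends M O s Q := by
  intro t ht
  rw [Stmt.run, PMF.mem_support_bind_iff] at ht
  obtain ⟨s', hs, ht⟩ := ht
  exact hq s' (hp s' hs) (p.frame M O s s' hs) t ht

theorem loop {ctr : ℕ} {e : IntExpr} {E : ℕ} (he : e.eval s.ints = E)
    (I : ℕ → Memory n m → Prop) (h0 : ∀ k, I 0 (s.tick k))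
    (hstep : ∀ c < E, ∀ t, I c t → p.Ends M O ((t.setInt ctr 0 0 c).tick 1) (I (c + 1))) :
    (Stmt.loop ctr e p).Ends M O s (I E) := by
  intro s' hs
  rw [Stmt.run, he] at hs
  exact iterate_support _ I E _ (h0 _) (fun c hc t ht t' ht' => hstep c hc t ht t' ht') s' hs

end Stmt.Ends

namespace Stmt.Draws

variable {p q : Stmt} {s : Memory n m} {μ : PMF α} {P : α → Memory n m → Prop}

theorem mono {P' : α → Memory n m → Prop} (h : p.Draws M O s μ P)
    (hP : ∀ a ∈ μ.support, ∀ s', P a s' → Frame p s s' → P' a s') : p.Draws M O s μ P' := by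
  obtain ⟨w, h1, h2, h3⟩ := h
  refine ⟨w, h1, h2, fun x hx => hP x.1 ?_ x.2 (h3 x hx) (p.frame M O s x.2 ?_)⟩
  · rw [← h1, PMF.mem_support_map_iff]
    exact ⟨x, hx, rfl⟩
  · rw [← h2, PMF.mem_support_map_iff]
    exact ⟨x, hx, rfl⟩

theorem of_ends {P : Memory n m → Prop} (h : p.Ends M O s P) (a0 : α) :
    p.Draws M O s (PMF.pure a0) fun _ s' => P s' := by
  refine ⟨(p.run M O s).map fun s' => (a0, s'), ?_, ?_, fun x hx => ?_⟩
  · rw [PMF.map_comp]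
    exact PMF.map_const _ _
  · rw [PMF.map_comp]
    exact PMF.map_id _
  · obtain ⟨s', hs, rfl⟩ := (PMF.mem_support_map_iff _ _ _).1 hx
    exact h s' hs

theorem of_run_eq_map {f : α → Memory n m} (h : p.run M O s = μ.map f)
    (hP : ∀ a, P a (f a)) : p.Draws M O s μ P := by
  refine ⟨μ.map fun a => (a, f a), ?_, ?_, fun x hx => ?_⟩
  · rw [PMF.map_comp]
    exact PMF.map_id _
  · rw [PMF.map_comp, h]
    rfl
  · obtain ⟨a, -, rfl⟩ := (PMF.mem_support_map_iff _ _ _).1 hx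
    exact hP a

theorem map (h : p.Draws M O s μ P) (f : α → β) {Q : β → Memory n m → Prop}
    (hQ : ∀ a ∈ μ.support, ∀ s', P a s' → Frame p s s' → Q (f a) s') :
    p.Draws M O s (μ.map f) Q := by
  obtain ⟨w, h1, h2, h3⟩ := h.mono hQ
  refine ⟨w.map fun x => (f x.1, x.2), ?_, ?_, fun x hx => ?_⟩
  · rw [← h1, PMF.map_comp, PMF.map_comp]
    rfl
  · rw [PMF.map_comp]
    exact h2
  · obtain ⟨a, ha, rfl⟩ := (PMF.mem_support_map_iff _ _ _).1 hx
    exact h3 a ha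

/-- Gluing of couplings, stated for arbitrary kernels rather than statements so that it serves both
sequencing and the iterations of a loop. -/
theorem bind_run {f : Memory n m → PMF (Memory n m)} {ν : α → PMF β}
    {Q : β → Memory n m → Prop} {r : PMF (Memory n m)}
    (hp : ∃ w : PMF (α × Memory n m), w.map Prod.fst = μ ∧ w.map Prod.snd = r ∧
      ∀ x ∈ w.support, P x.1 x.2)
    (hq : ∀ a ∈ μ.support, ∀ s', P a s' → ∃ w : PMF (β × Memory n m), w.map Prod.fst = ν a ∧
      w.map Prod.snd = f s' ∧ ∀ x ∈ w.support, Q x.1 x.2) :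
    ∃ w : PMF (β × Memory n m), w.map Prod.fst = μ.bind ν ∧ w.map Prod.snd = r.bind f ∧
      ∀ x ∈ w.support, Q x.1 x.2 := by
  obtain ⟨w, h1, h2, h3⟩ := hp
  have h4 : ∀ x : α × Memory n m, ∃ w' : PMF (β × Memory n m), x ∈ w.support →
      w'.map Prod.fst = ν x.1 ∧ w'.map Prod.snd = f x.2 ∧ ∀ y ∈ w'.support, Q y.1 y.2 := by
    intro x
    by_cases hx : x ∈ w.support
    · obtain ⟨w', h⟩ := hq x.1 (by
        rw [← h1, PMF.mem_support_map_iff]; exact ⟨x, hx, rfl⟩) x.2 (h3 x hx)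
      exact ⟨w', fun _ => h⟩
    -- Off the support of `w` no coupling is available, and an arbitrary value is harmless.
    · have b : β := (ν x.1).support_nonempty.choose
      exact ⟨PMF.pure (b, x.2), fun h => absurd h hx⟩
  choose w' hw' using h4
  refine ⟨w.bind w', ?_, ?_, fun y hy => ?_⟩
  · rw [PMF.map_bind, ← h1, PMF.bind_map]
    exact PMF.bind_congr_support _ fun x hx => (hw' x hx).1
  · rw [PMF.map_bind, ← h2, PMF.bind_map]
    exact PMF.bind_congr_support _ fun x hx => (hw' x hx).2.1
  · rw [PMF.mem_support_bind_iff] at hy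
    obtain ⟨x, hx, hy⟩ := hy
    exact (hw' x hx).2.2 y hy

theorem seq {ν : α → PMF β} {Q : β → Memory n m → Prop} (hp : p.Draws M O s μ P)
    (hq : ∀ a ∈ μ.support, ∀ s', P a s' → Frame p s s' → q.Draws M O s' (ν a) Q) :
    (Stmt.seq p q).Draws M O s (μ.bind ν) Q :=
  bind_run (hp.mono fun a _ s' h hf => (⟨h, hf⟩ : P a s' ∧ Frame p s s'))
    fun a ha s' h => hq a ha s' h.1 h.2

theorem ends_seq {R : Memory n m → Prop} {ν : PMF β} {Q : β → Memory n m → Prop}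
    (hp : p.Ends M O s R) (hq : ∀ s', R s' → Frame p s s' → q.Draws M O s' ν Q) :
    (Stmt.seq p q).Draws M O s ν Q := by
  have := (of_ends hp ()).seq (ν := fun _ => ν) (fun _ _ => hq)
  rwa [PMF.pure_bind] at this

theorem seq_ends {Q : α → Memory n m → Prop} (hp : p.Draws M O s μ P)
    (hq : ∀ a ∈ μ.support, ∀ s', P a s' → Frame p s s' → q.Ends M O s' (Q a)) :
    (Stmt.seq p q).Draws M O s μ Q := by
  have := hp.seq (ν := PMF.pure) (Q := Q) fun a ha s' h hf =>
    (of_ends (hq a ha s' h hf) a).mono fun b hb t ht _ => by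
      rw [PMF.mem_support_pure_iff] at hb
      exact hb ▸ ht
  rwa [PMF.bind_pure] at this

/-- The loop follows a Markov chain with marginals `μ` and kernels `ν`. Both the greedy histories
and the list of independent runs have this form. -/
theorem loop {ctr : ℕ} {e : IntExpr} {E : ℕ} (he : e.eval s.ints = E) (μ : ℕ → PMF α)
    (ν : ℕ → α → PMF α) (hμ : ∀ t, μ (t + 1) = (μ t).bind (ν t)) {a0 : α}
    (hμ0 : μ 0 = PMF.pure a0) (I : ℕ → α → Memory n m → Prop) (h0 : ∀ k, I 0 a0 (s.tick k))
    (hstep : ∀ c < E, ∀ a ∈ (μ c).support, ∀ t, I c a t →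
      p.Draws M O ((t.setInt ctr 0 0 c).tick 1) (ν c a) (I (c + 1))) :
    (Stmt.loop ctr e p).Draws M O s (μ E) (I E) := by
  unfold Stmt.Draws
  rw [Stmt.run, he]
  clear he
  induction E with
  | zero =>
    refine ⟨PMF.pure (a0, s.tick (1 + e.size)), ?_, ?_, fun x hx => ?_⟩
    · rw [PMF.pure_map, hμ0]
    · rw [PMF.pure_map, iterate]
    · rw [PMF.mem_support_pure_iff] at hx
      exact hx ▸ h0 _
  | succ E ih =>
    rw [hμ, iterate]
    exact bind_run (ih fun c hc => hstep c (hc.trans (Nat.lt_succ_self E)))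
      fun a ha s' h => hstep E (Nat.lt_succ_self E) a ha s' h

/-- A coupling fixes the law of whatever `P` determines and leaves scratch cells and the step
counter unconstrained. -/
theorem map_run {γ : Type} (h : p.Draws M O s μ P) (view : Memory n m → γ) (v : α → γ)
    (hv : ∀ a s', P a s' → view s' = v a) : (p.run M O s).map view = μ.map v := by
  obtain ⟨w, h1, h2, h3⟩ := h
  rw [← h1, ← h2, PMF.map_comp, PMF.map_comp, ← PMF.bind_pure_comp, ← PMF.bind_pure_comp]
  exact PMF.bind_congr_support _ fun x hx => congrArg PMF.pure (hv x.1 x.2 (h3 x hx))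

theorem swap {s : Memory n m} {P : α → Memory m n → Prop}
    (h : p.Draws M.swap O.swap s.swap μ P) : p.swap.Draws M O s μ fun a s' => P a s'.swap := by
  obtain ⟨w, h1, h2, h3⟩ := h
  refine ⟨w.map fun x => (x.1, x.2.swap), ?_, ?_, fun x hx => ?_⟩
  · rw [PMF.map_comp]
    exact h1
  · have h4 := Stmt.run_swap M.swap O.swap p s.swap
    rw [Memory.swap_swap] at h4
    refine Eq.trans ?_ h4.symm
    rw [← h2, PMF.map_comp, PMF.map_comp]
    rfl
  · obtain ⟨y, hy, rfl⟩ := (PMF.mem_support_map_iff _ _ _).1 hx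
    simpa only [Memory.swap_swap] using h3 y hy

end Stmt.Draws

end Logic

/-! ### The program -/

-- Integer arrays: 0 sizes; 1, 2 orders; 3 to 6 counters for runs, rounds, responding agents and
-- initiating agents; 7 the backlogs, one row per responding agent; 8 the assortment; 9 the last
-- choice; 11 a saved backlog entry; 12 the current initiating agent. Real arrays: 0 estimates; 1
-- weights; 2 running total; 3 a choice probability; 4 a demand; 5 a saved demand.
namespace Code

/-- The input size number `c`: customers, suppliers, simulated runs. -/
def size (c : ℕ) : IntExpr := .cell 0 (.lit 0) (.lit c)

/-- A scalar integer variable. -/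
def var (a : ℕ) : IntExpr := .cell a (.lit 0) (.lit 0)

/-- A scalar real variable. -/
def rvar (a : ℕ) : RealExpr := .cell a (.lit 0)

/-- Demand of the responding agent `var 5` at its backlog, stored in `rvar 4`. -/
def demand (side : Side) (cN : ℕ) : Stmt :=
  .seq (.setReal 4 (.lit 0) (.ofInt (.lit 0)))
    (.loop 6 (size cN)
      (.seq (.evalChoice side.swap (var 5) (.add (var 6) (.lit 1)) 7 (var 5) 3 (.lit 0))
        (.setReal 4 (.lit 0) (.add (rvar 4) (rvar 3)))))

/-- Marginal demand of the responding agent `var 5` for the initiating agent `var 12`, stored in the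
entry `var 5` of the weights. -/
def weight (side : Side) (cN : ℕ) : Stmt :=
  .seq (demand side cN)
  (.seq (.setReal 5 (.lit 0) (rvar 4))
  (.seq (.setInt 11 (.lit 0) (.lit 0) (.cell 7 (var 5) (var 12)))
  (.seq (.setInt 7 (var 5) (var 12) (.lit 1))
  (.seq (demand side cN)
  (.seq (.setInt 7 (var 5) (var 12) (var 11))
  (.setReal 1 (var 5) (.sub (rvar 4) (rvar 5))))))))

/-- Obtaining a choice of the agent `var 12`, simulated or real. -/
def choice (side : Side) (real : Bool) : Stmt :=
  if real then .process side (var 12) 8 (.lit 0) 9 (.lit 0) (.lit 0)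
  else .simulate side (var 12) 8 (.lit 0) 9 (.lit 0) (.lit 0)

/-- One round of greedy, for the agent number `var 4` of the order stored in `ord`. -/
def greedyRound (side : Side) (cN cK ord : ℕ) (real : Bool) : Stmt :=
  .seq (.setInt 12 (.lit 0) (.lit 0) (.cell ord (.lit 0) (var 4)))
  (.seq (.loop 5 (size cK) (weight side cN))
  (.seq (.optimize side (var 12) 1 8 (.lit 0))
  (.seq (choice side real)
  (.ifInt (var 9) (.lit 0) .skip (.setInt 7 (.sub (var 9) (.lit 1)) (var 12) (.lit 1))))))

/-- Greedy processing of the initiating side. -/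
def phase (side : Side) (cN cK ord : ℕ) (real : Bool) : Stmt :=
  .seq (.loop 5 (size cK) (.loop 6 (size cN) (.setInt 7 (var 5) (var 6) (.lit 0))))
    (.loop 4 (size cN) (greedyRound side cN cK ord real))

/-- Adds the demands of the responding agents to `rvar 2`. -/
def accumulate (side : Side) (cN cK : ℕ) : Stmt :=
  .loop 5 (size cK) (.seq (demand side cN) (.setReal 2 (.lit 0) (.add (rvar 2) (rvar 4))))

/-- Total of the simulated runs, stored in `rvar 2`. -/
def sample (side : Side) (cN cK ord : ℕ) : Stmt :=
  .seq (.setReal 2 (.lit 0) (.ofInt (.lit 0)))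
    (.loop 3 (size 2) (.seq (phase side cN cK ord false) (accumulate side cN cK)))

/-- Greedy on the actual agents. -/
def execute (side : Side) (cN cK ord : ℕ) : Stmt :=
  .seq (phase side cN cK ord true)
    (.loop 5 (size cK) (.process side.swap (var 5) 7 (var 5) 9 (.lit 0) (.lit 0)))

/-- The sampling policy. -/
def samplingPolicy : Stmt :=
  .seq (sample .customer 0 1 1)
  (.seq (.setReal 0 (.lit 0) (.div (rvar 2) (.ofInt (size 2))))
  (.seq (sample .supplier 1 0 2)
  (.seq (.setReal 0 (.lit 1) (.div (rvar 2) (.ofInt (size 2))))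
  (.ifReal (.cell 0 (.lit 1)) (.cell 0 (.lit 0)) (execute .customer 0 1 1)
    (execute .supplier 1 0 2)))))

end Code

/-! ### Correctness of the subroutines, with customers initiating -/

section Specification

open Code

variable {N K : ℕ} {M : Market N K} {O : M.Oracle} {cN cK ord : ℕ}

theorem Memory.mem_getSet {n m : ℕ} (s : Memory n m) {k arr row : ℕ} {j : Fin k} :
    j ∈ s.getSet k arr row ↔ s.ints arr row j ≠ 0 := by
  simp [Memory.getSet]

theorem Memory.getSet_congr {n m : ℕ} {s t : Memory n m} {k arr row : ℕ}
    (h : s.ints arr = t.ints arr) : s.getSet k arr row = t.getSet k arr row := by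
  simp [Memory.getSet, h]

theorem Memory.setInt_tick_ints_of_ne {n m : ℕ} (s : Memory n m) {a arr : ℕ} (h : a ≠ arr)
    (r c v k : ℕ) : ((s.setInt arr r c v).tick k).ints a = s.ints a :=
  s.setInt_ints_of_ne h r c v

theorem Memory.setReal_tick_reals_of_ne {n m : ℕ} (s : Memory n m) {a arr : ℕ} (h : a ≠ arr)
    (i : ℕ) (v : ℝ) (k : ℕ) : ((s.setReal arr i v).tick k).reals a = s.reals a :=
  s.setReal_reals_of_ne h i v

theorem Memory.getSet_putSet {n m : ℕ} (s : Memory n m) {k : ℕ} (arr row : ℕ)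
    (A : Finset (Fin k)) : (s.putSet arr row A).getSet k arr row = A := by
  ext j
  simp [Memory.mem_getSet, Memory.putSet]

theorem Memory.getSet_setInt_one {n m : ℕ} (s : Memory n m) {k : ℕ} (arr row r : ℕ) (i : Fin k) :
    (s.setInt arr r i 1).getSet k arr row =
      if row = r then insert i (s.getSet k arr row) else s.getSet k arr row := by
  ext x
  split_ifs with h
  · subst h
    by_cases hx : x = i
    · simp [Memory.mem_getSet, Memory.setInt, hx]
    · simp [Memory.mem_getSet, Memory.setInt, hx, Fin.val_ne_of_ne hx]
  · simp [Memory.mem_getSet, Memory.setInt, h]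

theorem Memory.setInt_setInt_self {n m : ℕ} (s : Memory n m) (arr r c v : ℕ) :
    ((s.setInt arr r c v).setInt arr r c (s.ints arr r c)).ints = s.ints := by
  funext a x y
  simp only [Memory.setInt]
  split_ifs with h
  · obtain ⟨rfl, rfl, rfl⟩ := h; rfl
  · rfl

theorem ends_setReal {n m : ℕ} {M : Market n m} {O : M.Oracle} {s : Memory n m} {arr : ℕ}
    {idx : IntExpr} {e : RealExpr} {P : Memory n m → Prop}
    (h : P ((s.setReal arr (idx.eval s.ints) (e.eval s.ints s.reals)).tick
      (1 + idx.size + e.size))) : (Stmt.setReal arr idx e).Ends M O s P :=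
  .of_run_eq (by rw [Stmt.run]) h

theorem ends_setInt {n m : ℕ} {M : Market n m} {O : M.Oracle} {s : Memory n m} {arr : ℕ}
    {row col e : IntExpr} {P : Memory n m → Prop}
    (h : P ((s.setInt arr (row.eval s.ints) (col.eval s.ints) (e.eval s.ints)).tick
      (1 + row.size + col.size + e.size))) : (Stmt.setInt arr row col e).Ends M O s P :=
  .of_run_eq (by rw [Stmt.run]) h

theorem Fin.sum_range_extend {k : ℕ} (f : Fin k → ℝ) :
    ∑ j ∈ Finset.range k, (if h : j < k then f ⟨j, h⟩ else 0) = ∑ j, f j := by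
  rw [Finset.sum_range]
  exact Finset.sum_congr rfl fun j _ => by simp

theorem ends_ifInt {n m : ℕ} {M : Market n m} {O : M.Oracle} {s : Memory n m} {a b : IntExpr}
    {p q : Stmt} {P : Memory n m → Prop}
    (hp : a.eval s.ints ≤ b.eval s.ints → p.Ends M O (s.tick (1 + a.size + b.size)) P)
    (hq : ¬ a.eval s.ints ≤ b.eval s.ints → q.Ends M O (s.tick (1 + a.size + b.size)) P) :
    (Stmt.ifInt a b p q).Ends M O s P := by
  intro s' hs
  rw [Stmt.run] at hs
  split_ifs at hs with h
  exacts [hp h s' hs, hq h s' hs]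

/-- `Code.demand` computes the demand of the responding agent at its stored backlog. -/
theorem demand_ends {s : Memory N K} (hN : s.ints 0 0 cN = N) {j : Fin K}
    (hj : s.ints 5 0 0 = j) : (demand .customer cN).Ends M O s fun s' =>
      s'.reals 4 0 = (M.supplier j).demand (s.getSet N 7 j) := by
  set F : ℕ → ℝ := fun i => if h : i < N then
    (M.supplier j).prob (some ⟨i, h⟩) (s.getSet N 7 j) else 0 with hF
  have key : (demand .customer cN).Ends M O s fun s' =>
      s'.reals 4 0 = ∑ i ∈ Finset.range N, F i := by
    refine Stmt.Ends.seq (P := fun t => t.reals 4 0 = 0 ∧ t.ints = s.ints)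
      (ends_setReal ⟨by simp [Memory.setReal, Memory.tick, RealExpr.eval, IntExpr.eval], rfl⟩)
      fun t ⟨ht4, hti⟩ _ => ?_
    refine (Stmt.Ends.loop (E := N) (by rw [hti]; exact hN)
      (fun c t => t.reals 4 0 = ∑ i ∈ Finset.range c, F i ∧ t.ints 5 = s.ints 5 ∧
        t.ints 7 = s.ints 7) (fun k => ⟨by rw [Finset.sum_range_zero]; exact ht4,
          by rw [← hti]; rfl, by rw [← hti]; rfl⟩) ?_).mono
      fun t h _ => h.1
    rintro c hc t ⟨h4, h5, h7⟩
    set t1 := (t.setInt 6 0 0 c).tick 1 with ht1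
    have e5' : t1.ints 5 = s.ints 5 := h5
    have e5 : t1.ints 5 0 0 = j := by rw [e5', hj]
    have e7 : t1.ints 7 = s.ints 7 := h7
    have e6 : t1.ints 6 0 0 = c := by simp [ht1, Memory.setInt, Memory.tick]
    have e4 : t1.reals 4 0 = ∑ i ∈ Finset.range c, F i := h4
    clear_value t1
    refine Stmt.Ends.mono (P := fun t' => t'.reals 4 0 = ∑ i ∈ Finset.range (c + 1), F i) ?_
      fun t' h hf => ⟨h, (hf.ints 5 (by simp [Stmt.KeepsInt])).trans e5',
        (hf.ints 7 (by simp [Stmt.KeepsInt])).trans e7⟩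
    refine Stmt.Ends.seq (P := fun t' => t'.reals 3 0 = F c) ?_ fun t' h3 hf => ends_setReal ?_
    · refine .of_run_eq (t := (t1.tick (1 + (var 5).size + ((var 6).add (.lit 1)).size +
        (var 5).size + (IntExpr.lit 0).size + N + K)).setReal 3 0 (F c)) ?_ ?_
      · simp only [Stmt.run, Side.swap, var, IntExpr.eval, e5, e6, Fin.is_lt, dif_pos]
        simp only [Fin.eta, hF, dif_pos hc, decodeOption, Memory.getSet_congr e7]
      · simp [Memory.setReal]
    · have : t'.reals 4 = t1.reals 4 := hf.reals 4 (by simp [Stmt.KeepsReal])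
      simp [Memory.setReal, Memory.tick, RealExpr.eval, IntExpr.eval, rvar, this, e4, h3,
        Finset.sum_range_succ]
  refine key.mono fun s' h _ => ?_
  -- The loop runs over all initiating agents, not only the backlog; those outside it contribute
  -- probability zero.
  rw [h, ChoiceModel.demand_eq_sum_univ, ← Fin.sum_range_extend]

/-- The marginal is computed in place: `i` is inserted into the backlog row, the demand is evaluated
again, and the saved entry is put back. Hence array 7 is unchanged even if `i` was already a member.
-/
theorem weight_ends {s : Memory N K} (hN : s.ints 0 0 cN = N) {j : Fin K}
    (hj : s.ints 5 0 0 = j) {i : Fin N} (hi : s.ints 12 0 0 = i) :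
    (weight .customer cN).Ends M O s fun s' => s'.ints 7 = s.ints 7 ∧
      s'.reals 1 = (s.setReal 1 j ((M.supplier j).demand (insert i (s.getSet N 7 j)) -
        (M.supplier j).demand (s.getSet N 7 j))).reals 1 := by
  set C := s.getSet N 7 j with hC
  refine Stmt.Ends.seq (P := fun t => (t.reals 4 0 = (M.supplier j).demand C ∧
      t.reals 1 = s.reals 1) ∧ t.ints 7 = s.ints 7 ∧ t.ints 5 = s.ints 5 ∧
      t.ints 12 = s.ints 12 ∧ t.ints 0 = s.ints 0)
    ((demand_ends hN hj).mono fun t h hf => ⟨⟨h, hf.reals 1 (by simp [demand, Stmt.KeepsReal])⟩,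
      hf.ints 7 (by simp [demand, Stmt.KeepsInt]), hf.ints 5 (by simp [demand, Stmt.KeepsInt]),
      hf.ints 12 (by simp [demand, Stmt.KeepsInt]), hf.ints 0 (by simp [demand, Stmt.KeepsInt])⟩) ?_
  rintro t ⟨⟨h4, h1⟩, hint⟩ -
  refine Stmt.Ends.seq (P := fun t => (t.reals 5 0 = (M.supplier j).demand C ∧
      t.reals 1 = s.reals 1) ∧ t.ints 7 = s.ints 7 ∧ t.ints 5 = s.ints 5 ∧
      t.ints 12 = s.ints 12 ∧ t.ints 0 = s.ints 0) (ends_setReal ⟨⟨?_, ?_⟩, hint⟩) ?_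
  · simpa [Memory.setReal, Memory.tick, RealExpr.eval, IntExpr.eval, rvar] using h4
  · exact (t.setReal_tick_reals_of_ne (by norm_num) _ _ _).trans h1
  clear h4 h1 hint
  rintro t ⟨hreal, h7, h5, h12, h0⟩ -
  refine Stmt.Ends.seq (P := fun t => (t.reals 5 0 = (M.supplier j).demand C ∧
      t.reals 1 = s.reals 1) ∧ t.ints 11 0 0 = s.ints 7 j i ∧ t.ints 7 = s.ints 7 ∧
      t.ints 5 = s.ints 5 ∧ t.ints 12 = s.ints 12 ∧ t.ints 0 = s.ints 0)
    (ends_setInt ⟨hreal, ?_, (t.setInt_tick_ints_of_ne (by norm_num) _ _ _ _).trans h7,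
      (t.setInt_tick_ints_of_ne (by norm_num) _ _ _ _).trans h5,
      (t.setInt_tick_ints_of_ne (by norm_num) _ _ _ _).trans h12,
      (t.setInt_tick_ints_of_ne (by norm_num) _ _ _ _).trans h0⟩) ?_
  · simp [Memory.setInt, Memory.tick, IntExpr.eval, var, h7, h5, h12, hj, hi]
  clear hreal h7 h5 h12 h0
  rintro t ⟨hreal, h11, h7, h5, h12, h0⟩ -
  refine Stmt.Ends.seq (P := fun t => (t.reals 5 0 = (M.supplier j).demand C ∧
      t.reals 1 = s.reals 1) ∧ t.ints 11 0 0 = s.ints 7 j i ∧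
      t.ints 7 = (s.setInt 7 j i 1).ints 7 ∧
      t.ints 5 = s.ints 5 ∧ t.ints 12 = s.ints 12 ∧ t.ints 0 = s.ints 0)
    (ends_setInt ⟨hreal, ?_, ?_,
      (t.setInt_tick_ints_of_ne (by norm_num) _ _ _ _).trans h5,
      (t.setInt_tick_ints_of_ne (by norm_num) _ _ _ _).trans h12,
      (t.setInt_tick_ints_of_ne (by norm_num) _ _ _ _).trans h0⟩) ?_
  · rw [← h11]
    exact congrFun (congrFun (t.setInt_tick_ints_of_ne (by norm_num) _ _ _ _) 0) 0
  · funext r c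
    simp [Memory.setInt, Memory.tick, IntExpr.eval, var, h7, h5, h12, hj, hi]
  clear hreal h11 h7 h5 h12 h0
  rintro t ⟨hreal, h11, h7, h5, h12, h0⟩ -
  refine Stmt.Ends.seq (P := fun t => (t.reals 4 0 = (M.supplier j).demand (insert i C) ∧
      t.reals 5 0 = (M.supplier j).demand C ∧
      t.reals 1 = s.reals 1) ∧ t.ints 11 0 0 = s.ints 7 j i ∧
      t.ints 7 = (s.setInt 7 j i 1).ints 7 ∧
      t.ints 5 = s.ints 5 ∧ t.ints 12 = s.ints 12 ∧ t.ints 0 = s.ints 0)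
    ((demand_ends (j := j) (by rw [h0, hN]) (by rw [h5, hj])).mono fun t' h hf => ⟨⟨?_, ?_, ?_⟩,
      ?_, ?_, ?_, ?_, ?_⟩) ?_
  · rw [h, Memory.getSet_congr h7, Memory.getSet_setInt_one, if_pos rfl]
  · rw [hf.reals 5 (by simp [demand, Stmt.KeepsReal])]
    exact hreal.1
  · rw [hf.reals 1 (by simp [demand, Stmt.KeepsReal])]
    exact hreal.2
  · rw [hf.ints 11 (by simp [demand, Stmt.KeepsInt]), h11]
  · rw [hf.ints 7 (by simp [demand, Stmt.KeepsInt]), h7]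
  · rw [hf.ints 5 (by simp [demand, Stmt.KeepsInt]), h5]
  · rw [hf.ints 12 (by simp [demand, Stmt.KeepsInt]), h12]
  · rw [hf.ints 0 (by simp [demand, Stmt.KeepsInt]), h0]
  clear hreal h11 h7 h5 h12 h0
  rintro t ⟨hreal, h11, h7, h5, h12, -⟩ -
  refine Stmt.Ends.seq (P := fun t => (t.reals 4 0 = (M.supplier j).demand (insert i C) ∧
      t.reals 5 0 = (M.supplier j).demand C ∧
      t.reals 1 = s.reals 1) ∧ t.ints 7 = s.ints 7 ∧ t.ints 5 = s.ints 5)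
    (ends_setInt ⟨hreal, ?_, (t.setInt_tick_ints_of_ne (by norm_num) _ _ _ _).trans h5⟩) ?_
  · rw [← s.setInt_setInt_self 7 j i 1]
    funext r c
    simp [Memory.setInt, Memory.tick, IntExpr.eval, var, h7, h5, h12, hj, hi, h11]
  clear hreal h11 h7 h5 h12
  rintro t ⟨⟨h4, h5r, h1⟩, h7, h5⟩ -
  refine ends_setReal ⟨h7, ?_⟩
  funext r
  simp [Memory.setReal, Memory.tick, RealExpr.eval, IntExpr.eval, var, rvar, h4, h5r, h1, h5, hj]

theorem weights_ends {s : Memory N K} (hN : s.ints 0 0 cN = N) (hK : s.ints 0 0 cK = K)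
    {i : Fin N} (hi : s.ints 12 0 0 = i) :
    (Stmt.loop 5 (size cK) (weight .customer cN)).Ends M O s fun s' => s'.ints 7 = s.ints 7 ∧
      ∀ j : Fin K, s'.reals 1 j = (M.supplier j).demand (insert i (s.getSet N 7 j)) -
        (M.supplier j).demand (s.getSet N 7 j) := by
  refine (Stmt.Ends.loop (s := s) (e := size cK) (E := K) hK (fun c t => (t.ints 7 = s.ints 7 ∧ t.ints 12 = s.ints 12 ∧
    t.ints 0 = s.ints 0) ∧ ∀ j : Fin K, (j : ℕ) < c → t.reals 1 j =
      (M.supplier j).demand (insert i (s.getSet N 7 j)) - (M.supplier j).demand (s.getSet N 7 j))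
    (fun k => ⟨⟨rfl, rfl, rfl⟩, fun j hj => absurd hj (Nat.not_lt_zero _)⟩) ?_).mono
    fun t h _ => ⟨h.1.1, fun j => h.2 j j.2⟩
  rintro c hc t ⟨⟨h7, h12, h0⟩, h1⟩
  set t1 := (t.setInt 5 0 0 c).tick 1 with ht1
  have e5 : t1.ints 5 0 0 = (⟨c, hc⟩ : Fin K) := by simp [ht1, Memory.setInt, Memory.tick]
  have e7 : t1.ints 7 = s.ints 7 := h7
  have e12 : t1.ints 12 = s.ints 12 := h12
  have e0 : t1.ints 0 = s.ints 0 := h0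
  have e1 : t1.reals 1 = t.reals 1 := rfl
  clear_value t1
  refine (weight_ends (by rw [e0, hN]) e5 (by rw [e12, hi])).mono fun t' h hf =>
    ⟨⟨h.1.trans e7, (hf.ints 12 (by simp [weight, demand, Stmt.KeepsInt])).trans e12,
      (hf.ints 0 (by simp [weight, demand, Stmt.KeepsInt])).trans e0⟩, fun j hj => ?_⟩
  rw [h.2, Memory.getSet_congr e7]
  by_cases hjc : (j : ℕ) = c
  · have : j = ⟨c, hc⟩ := Fin.ext hjc
    subst this
    simp [Memory.setReal]
  · simp only [Memory.setReal, hjc, and_false, if_false]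
    rw [e1]
    exact h1 j (by omega)

/-- The transcript after the initiating side has made the choices in `h`. -/
def trace (real : Bool) (h : List (Step N K)) (tr : Transcript N K) : Transcript N K :=
  if real then h.map Sum.inl ++ tr else tr

theorem choice_draws (real : Bool) {s : Memory N K} {i : Fin N} (hi : s.ints 12 0 0 = i)
    {h : List (Step N K)} {tr : Transcript N K} (htr : s.transcript = trace real h tr) :
    (choice .customer real).Draws M O s ((M.customer i).law (s.getSet K 8 0)) fun o s' =>
      s'.ints 9 0 0 = encodeOption o ∧
        s'.transcript = trace real ((i, s.getSet K 8 0, o) :: h) tr := by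
  cases real with
  | true =>
    refine .of_run_eq_map (f := fun o => (((s.tick (1 + (var 12).size + (IntExpr.lit 0).size +
      (IntExpr.lit 0).size + (IntExpr.lit 0).size + N + K)).setInt 9 0 0 (encodeOption o)).record
      (Sum.inl (i, s.getSet K 8 0, o)))) ?_ fun o => ⟨?_, ?_⟩
    · simp only [choice, if_true, Stmt.run, var, IntExpr.eval, hi, Fin.is_lt, dif_pos]
    · simp [Memory.setInt, Memory.record]
    · simp only [trace, if_true] at htr ⊢
      simp only [Memory.record, Memory.setInt, Memory.tick, htr, List.map_cons, List.cons_append]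
  | false =>
    refine .of_run_eq_map (f := fun o => ((s.tick (1 + (var 12).size + (IntExpr.lit 0).size +
      (IntExpr.lit 0).size + (IntExpr.lit 0).size + N + K)).setInt 9 0 0 (encodeOption o))) ?_ fun o => ⟨?_, ?_⟩
    · simp only [choice, Bool.false_eq_true, if_false, Stmt.run, var, IntExpr.eval, hi, Fin.is_lt,
        dif_pos]
    · simp [Memory.setInt]
    · exact htr

theorem recordChoice_ends {s : Memory N K} {i : Fin N} (hi : s.ints 12 0 0 = i)
    {h : List (Step N K)} (hB : ∀ j : Fin K, s.getSet N 7 j = backlog h j) {o : Option (Fin K)}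
    (ho : s.ints 9 0 0 = encodeOption o) (A : Finset (Fin K)) :
    (Stmt.ifInt (var 9) (.lit 0) .skip
      (.setInt 7 (.sub (var 9) (.lit 1)) (var 12) (.lit 1))).Ends M O s fun s' =>
        ∀ j : Fin K, s'.getSet N 7 j = backlog ((i, A, o) :: h) j := by
  cases o with
  | none =>
    refine ends_ifInt (fun _ => .of_run_eq (by rw [Stmt.run]) fun j => ?_) fun hne => ?_
    · rw [backlog_cons_none, ← hB]
      rfl
    · exact absurd (by simp [var, IntExpr.eval, ho, encodeOption]) hne
  | some l =>
    refine ends_ifInt (fun hle => ?_) fun _ => ends_setInt fun j => ?_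
    · simp [var, IntExpr.eval, ho, encodeOption] at hle
    · rw [backlog_cons_some, ← hB]
      have := s.getSet_setInt_one 7 j l i
      simp only [Fin.val_inj] at this
      -- The code of a chosen agent is its index plus one, so subtracting one gives its backlog row.
      rw [← this]
      refine Memory.getSet_congr ?_
      funext r c
      simp [Memory.setInt, Memory.tick, var, IntExpr.eval, ho, hi, encodeOption]

theorem optimize_ends {s : Memory N K} {i : Fin N} (hi : s.ints 12 0 0 = i) :
    (Stmt.optimize .customer (var 12) 1 8 (.lit 0)).Ends M O s fun s' =>
      s'.getSet K 8 0 = O.customer i fun j => s.reals 1 j := by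
  refine .of_run_eq (t := (s.tick (1 + (var 12).size + (IntExpr.lit 0).size + N + K)).putSet 8 0
    (O.customer i fun j => s.reals 1 j)) ?_
    (Memory.getSet_putSet _ 8 0 _)
  simp only [Stmt.run, var, IntExpr.eval, hi, Fin.is_lt, dif_pos]

/-- The memory holds the sizes of the two sides and the order of the initiating side. -/
structure HasInputs (s : Memory N K) (cN cK ord : ℕ) (σ : Equiv.Perm (Fin N)) : Prop where
  initiating : s.ints 0 0 cN = N
  responding : s.ints 0 0 cK = K
  order : ∀ (t : ℕ) (ht : t < N), s.ints ord 0 t = σ ⟨t, ht⟩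

variable {σ : Equiv.Perm (Fin N)}

theorem HasInputs.congr {s t : Memory N K} (h : HasInputs s cN cK ord σ)
    (h0 : t.ints 0 = s.ints 0) (h1 : t.ints ord = s.ints ord) : HasInputs t cN cK ord σ :=
  ⟨by rw [h0, h.1], by rw [h0, h.2], by rw [h1]; exact h.3⟩

/-- The drawn object is the extended history itself, although the memory keeps only its backlogs:
greedy decisions depend on the past through nothing else. -/
theorem greedyRound_draws (real : Bool) {s : Memory N K} (hs : HasInputs s cN cK ord σ)
    {t : ℕ} (ht : t < N) (h4 : s.ints 4 0 0 = t) {h : List (Step N K)}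
    (hB : ∀ j : Fin K, s.getSet N 7 j = backlog h j) {tr : Transcript N K}
    (htr : s.transcript = trace real h tr) :
    (greedyRound .customer cN cK ord real).Draws M O s
      (((M.customer (σ ⟨t, ht⟩)).law (greedyAssortment M O h (σ ⟨t, ht⟩))).map fun o =>
        (σ ⟨t, ht⟩, greedyAssortment M O h (σ ⟨t, ht⟩), o) :: h)
      fun h' s' => (∀ j : Fin K, s'.getSet N 7 j = backlog h' j) ∧
        s'.transcript = trace real h' tr := by
  set i := σ ⟨t, ht⟩ with hi
  refine .ends_seq (R := fun t => t.ints 12 0 0 = i ∧ t.ints 7 = s.ints 7 ∧ t.ints 0 = s.ints 0 ∧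
    t.transcript = s.transcript) (ends_setInt ⟨?_, ?_, ?_, rfl⟩) ?_
  · simp [Memory.setInt, Memory.tick, var, IntExpr.eval, h4, hs.order t ht, hi]
  · exact s.setInt_tick_ints_of_ne (by norm_num) _ _ _ _
  · exact s.setInt_tick_ints_of_ne (by norm_num) _ _ _ _
  rintro t1 ⟨h12, h7, h0, ht1⟩ -
  refine .ends_seq (R := fun t => t.ints 12 0 0 = i ∧ t.ints 7 = s.ints 7 ∧
    t.transcript = s.transcript ∧ ∀ j : Fin K, t.reals 1 j = marginalDemand M h i j)
    ((weights_ends (by rw [h0, hs.1]) (by rw [h0, hs.2]) h12).mono fun t' h' hf =>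
      ⟨?_, h'.1.trans h7, ?_, fun j => ?_⟩) ?_
  · rw [hf.ints 12 (by simp [weight, demand, Stmt.KeepsInt]), h12]
  · rw [hf.transcript (by simp [weight, demand, Stmt.KeepsTranscript]), ht1]
  · rw [h'.2, Memory.getSet_congr h7, hB]
    rfl
  clear h12 h7 h0 ht1
  rintro t1 ⟨h12, h7, ht1, hw⟩ -
  refine .ends_seq (R := fun t => t.getSet K 8 0 = greedyAssortment M O h i ∧
    t.ints 12 0 0 = i ∧ t.ints 7 = s.ints 7 ∧ t.transcript = s.transcript)
    ((optimize_ends h12).mono fun t' h' hf => ⟨?_, ?_, ?_, ?_⟩) ?_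
  · rw [h', greedyAssortment_eq]
    exact congrArg _ (funext hw)
  · rw [hf.ints 12 (by simp [Stmt.KeepsInt]), h12]
  · rw [hf.ints 7 (by simp [Stmt.KeepsInt]), h7]
  · rw [hf.transcript trivial, ht1]
  clear h12 h7 ht1 hw
  rintro t1 ⟨h8, h12, h7, ht1⟩ -
  rw [← h8]
  have hc : (choice .customer real).KeepsInt 12 ∧ (choice .customer real).KeepsInt 7 := by
    cases real <;> simp [choice, Stmt.KeepsInt]
  refine Stmt.Draws.map (P := fun o s' => (∀ j : Fin K, s'.getSet N 7 j =
      backlog ((i, t1.getSet K 8 0, o) :: h) j) ∧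
        s'.transcript = trace real ((i, t1.getSet K 8 0, o) :: h) tr)
    ((choice_draws real h12 (ht1.trans htr)).seq_ends fun o _ t2 h2 hf => ?_) _
    fun _ _ _ h' _ => h'
  refine (recordChoice_ends (by rw [hf.ints 12 hc.1, h12]) (fun j => ?_) h2.1 _).mono
    fun t' h' hf' => ⟨h', ?_⟩
  · rw [Memory.getSet_congr ((hf.ints 7 hc.2).trans h7), hB]
  · rw [hf'.transcript (by simp [Stmt.KeepsTranscript]), h2.2]

/-- Needed because the same table is reused by all runs and by both sides. The inner invariant keeps
the finished rows and the finished part of row `c`. -/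
theorem clear_ends {s : Memory N K} (hN : s.ints 0 0 cN = N) (hK : s.ints 0 0 cK = K) :
    (Stmt.loop 5 (size cK) (.loop 6 (size cN) (.setInt 7 (var 5) (var 6) (.lit 0)))).Ends M O s
      fun s' => ∀ j : Fin K, s'.getSet N 7 j = ∅ := by
  refine (Stmt.Ends.loop (s := s) (e := size cK) (E := K) hK (fun c t => t.ints 0 = s.ints 0 ∧
    ∀ j < c, ∀ i < N, t.ints 7 j i = 0)
    (fun k => ⟨rfl, fun j hj => absurd hj (Nat.not_lt_zero _)⟩) ?_).mono fun t h _ j => ?_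
  · rintro c hc t ⟨h0, h7⟩
    set t1 := (t.setInt 5 0 0 c).tick 1 with ht1
    have e5 : t1.ints 5 0 0 = c := by simp [ht1, Memory.setInt, Memory.tick]
    have e7 : ∀ j < c, ∀ i < N, t1.ints 7 j i = 0 := h7
    have e0 : t1.ints 0 = s.ints 0 := h0
    clear_value t1
    refine (Stmt.Ends.loop (s := t1) (e := size cN) (E := N) ((congrFun (congrFun e0 0) cN).trans hN)
      (fun d t => t.ints 5 = t1.ints 5 ∧ (∀ j < c, ∀ i < N, t.ints 7 j i = 0) ∧
        ∀ i < d, t.ints 7 c i = 0)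
      (fun k => ⟨rfl, e7, fun j hj => absurd hj (Nat.not_lt_zero _)⟩) ?_).mono
      fun t' h hf => ⟨(hf.ints 0 (by simp [Stmt.KeepsInt])).trans e0, fun j hj i hi => ?_⟩
    · rintro d hd t ⟨g5, g7, g7'⟩
      set t2 := (t.setInt 6 0 0 d).tick 1 with ht2
      have f6 : t2.ints 6 0 0 = d := by simp [ht2, Memory.setInt, Memory.tick]
      have f5 : t2.ints 5 = t1.ints 5 := g5
      have f7 : t2.ints 7 = t.ints 7 := rfl
      clear_value t2
      refine ends_setInt ⟨?_, fun j hj i hi => ?_, fun i hi => ?_⟩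
      · exact (t2.setInt_tick_ints_of_ne (by norm_num) _ _ _ _).trans f5
      · simp only [Memory.setInt, Memory.tick, IntExpr.eval, f7, g7 j hj i hi]
        split_ifs <;> rfl
      · simp only [Memory.setInt, Memory.tick, IntExpr.eval, var, f5, e5, f6, f7, true_and]
        split_ifs with hid
        · rfl
        · exact g7' i (by omega)
    · rcases Nat.lt_succ_iff_lt_or_eq.1 hj with hj | rfl
      exacts [h.2.1 j hj i hi, h.2.2 i hi]
  · ext i
    simp [Memory.mem_getSet, h.2 j j.2 i i.2]

theorem phase_draws (real : Bool) {s : Memory N K} (hs : HasInputs s cN cK ord σ)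
    (hord : ord ≤ 2) : (phase .customer cN cK ord real).Draws M O s
      ((greedyFirst M O σ).law M.customer) fun h s' =>
        (∀ j : Fin K, s'.getSet N 7 j = backlog h j) ∧
          s'.transcript = trace real h s.transcript := by
  refine .ends_seq (clear_ends hs.1 hs.2) fun t0 hB0 hf0 => ?_
  have ht0 : HasInputs t0 cN cK ord σ := hs.congr
    (hf0.ints 0 (by simp [Stmt.KeepsInt]))
    (hf0.ints ord (by simp only [Stmt.KeepsInt]; omega))
  have htr0 : t0.transcript = s.transcript := hf0.transcript trivial
  refine (Stmt.Draws.loop (s := t0) (e := size cN) (E := N) ht0.1 ((greedyFirst M O σ).partialLaw M.customer)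
    (fun _ h => if hl : h.length < N then
      ((greedyFirst M O σ).next h hl).bind fun a =>
        ((M.customer a.1).law a.2).map fun o => (a.1, a.2, o) :: h
      else PMF.pure h) (fun _ => rfl) (a0 := []) rfl
    (fun _ h t => HasInputs t cN cK ord σ ∧ (∀ j : Fin K, t.getSet N 7 j = backlog h j) ∧
      t.transcript = trace real h s.transcript) (fun k => ⟨ht0.congr rfl rfl, fun j => ?_, ?_⟩) ?_).mono
    fun h _ t h' _ => h'.2
  · rw [backlog_nil]
    exact hB0 j
  · cases real <;> exact htr0
  rintro c hc h hh t ⟨h1, h2, h3⟩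
  -- The round counter coincides with the length of the history, the index by which `greedyFirst`
  -- reads the order.
  obtain ⟨-, rfl⟩ := (greedyFirst M O σ).isHistory_and_length_of_mem_support M.customer c hc.le h hh
  simp only [dif_pos hc]
  rw [show (greedyFirst M O σ).next h hc = PMF.pure (σ ⟨h.length, hc⟩,
    greedyAssortment M O h (σ ⟨h.length, hc⟩)) from rfl, PMF.pure_bind]
  have hne : ord ≠ 4 := by omega
  -- The order survives because its array number is at most 2, below all scratch arrays.
  set t1 := (t.setInt 4 0 0 h.length).tick 1 with ht1
  have e4 : t1.ints 4 0 0 = h.length := by simp [ht1, Memory.setInt, Memory.tick]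
  have e : HasInputs t1 cN cK ord σ :=
    h1.congr (t.setInt_tick_ints_of_ne (a := 0) (arr := 4) (by norm_num) 0 0 _ 1)
      (t.setInt_tick_ints_of_ne hne 0 0 _ 1)
  have e7 : ∀ j : Fin K, t1.getSet N 7 j = backlog h j := h2
  have etr : t1.transcript = trace real h s.transcript := h3
  clear_value t1
  refine (greedyRound_draws real e hc e4 e7 etr).mono fun h' _ t' h4 hf => ⟨e.congr ?_ ?_, h4⟩
  · exact hf.ints 0 (by cases real <;> simp [greedyRound, choice, weight, demand, Stmt.KeepsInt])
  · exact hf.ints ord (by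
      cases real <;> simp [greedyRound, choice, weight, demand, Stmt.KeepsInt] <;> omega)

theorem accumulate_ends {s : Memory N K} (hN : s.ints 0 0 cN = N) (hK : s.ints 0 0 cK = K)
    {h : List (Step N K)} (hB : ∀ j : Fin K, s.getSet N 7 j = backlog h j) :
    (accumulate .customer cN cK).Ends M O s fun s' =>
      s'.reals 2 0 = s.reals 2 0 + totalDemand M h := by
  set F : ℕ → ℝ := fun j => if h' : j < K then
    (M.supplier ⟨j, h'⟩).demand (backlog h ⟨j, h'⟩) else 0 with hF
  have hsum : totalDemand M h = ∑ j ∈ Finset.range K, F j :=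
    (Fin.sum_range_extend fun j => (M.supplier j).demand (backlog h j)).symm
  rw [hsum]
  refine (Stmt.Ends.loop (s := s) (e := size cK) (E := K) hK (fun c t => (t.ints 0 = s.ints 0 ∧ t.ints 7 = s.ints 7) ∧
    t.reals 2 0 = s.reals 2 0 + ∑ j ∈ Finset.range c, F j)
    (fun k => ⟨⟨rfl, rfl⟩, by rw [Finset.sum_range_zero, add_zero]; rfl⟩) ?_).mono
    fun t h' _ => h'.2
  rintro c hc t ⟨⟨h0, h7⟩, h2⟩
  set t1 := (t.setInt 5 0 0 c).tick 1 with ht1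
  have e5 : t1.ints 5 0 0 = (⟨c, hc⟩ : Fin K) := by simp [ht1, Memory.setInt, Memory.tick]
  have e7 : t1.ints 7 = s.ints 7 := h7
  have e0 : t1.ints 0 = s.ints 0 := h0
  have e2 : t1.reals 2 0 = s.reals 2 0 + ∑ j ∈ Finset.range c, F j := h2
  clear_value t1
  refine Stmt.Ends.mono (P := fun t => t.reals 2 0 =
      s.reals 2 0 + ∑ j ∈ Finset.range (c + 1), F j) ?_
    fun t' h' hf => ⟨⟨(hf.ints 0 (by simp [demand, Stmt.KeepsInt])).trans e0,
      (hf.ints 7 (by simp [demand, Stmt.KeepsInt])).trans e7⟩, h'⟩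
  refine Stmt.Ends.seq (demand_ends (by rw [e0, hN]) e5) fun t2 h4 hf => ends_setReal ?_
  have : t2.reals 2 = t1.reals 2 := hf.reals 2 (by simp [demand, Stmt.KeepsReal])
  rw [Memory.getSet_congr e7, hB] at h4
  simp [Memory.setReal, Memory.tick, RealExpr.eval, IntExpr.eval, rvar, this, e2, h4,
    Finset.sum_range_succ, hF, hc, add_assoc]

/-- Independence of the runs: the law of a phase does not depend on the scratch left by earlier
runs, since the table is cleared and the inputs are intact. -/
theorem sample_draws {s : Memory N K} (hs : HasInputs s cN cK ord σ) (hord : ord ≤ 2) {T : ℕ}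
    (hT : s.ints 0 0 2 = T) : (sample .customer cN cK ord).Draws M O s
      (independentRuns (greedyRun M O σ) T) fun l s' => s'.reals 2 0 = l.sum := by
  refine .ends_seq (R := fun t => t.reals 2 0 = 0 ∧ t.ints = s.ints)
    (ends_setReal ⟨by simp [Memory.setReal, Memory.tick, RealExpr.eval, IntExpr.eval], rfl⟩)
    fun t0 ⟨h2, hint⟩ _ => ?_
  refine (Stmt.Draws.loop (E := T) (by rw [hint]; exact hT) (independentRuns (greedyRun M O σ))
    (fun _ l => (greedyRun M O σ).map fun x => x :: l) (fun _ => rfl) (a0 := []) rfl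
    (fun _ l t => HasInputs t cN cK ord σ ∧ t.reals 2 0 = l.sum)
    (fun k => ⟨hs.congr (congrFun hint 0) (congrFun hint ord), ?_⟩) ?_).mono
    fun l _ t h _ => h.2
  · rw [List.sum_nil]
    exact h2
  rintro c - l - t ⟨h1, h3⟩
  set t1 := (t.setInt 3 0 0 c).tick 1 with ht1
  have hne : ord ≠ 3 := by omega
  have e : HasInputs t1 cN cK ord σ :=
    h1.congr (t.setInt_tick_ints_of_ne (a := 0) (arr := 3) (by norm_num) 0 0 _ 1)
      (t.setInt_tick_ints_of_ne hne 0 0 _ 1)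
  have e2 : t1.reals 2 0 = l.sum := h3
  clear_value t1
  rw [greedyRun]
  refine Stmt.Draws.map (P := fun x t => t.reals 2 0 = l.sum + x) (Stmt.Draws.map
    (P := fun h t => t.reals 2 0 = l.sum + totalDemand M h) ?_ _ fun _ _ _ h _ => h) _
    fun x _ t' h hf => ⟨e.congr ?_ ?_, ?_⟩
  · refine (phase_draws false e hord).seq_ends fun h _ t2 h4 hf => ?_
    have f0 : t2.ints 0 = t1.ints 0 := hf.ints 0 (by
      simp [phase, greedyRound, choice, weight, demand, Stmt.KeepsInt])
    refine (accumulate_ends (by rw [f0, e.1]) (by rw [f0, e.2]) h4.1).mono fun t' h' _ => ?_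
    rw [h', hf.reals 2 (by simp [phase, greedyRound, choice, weight, demand, Stmt.KeepsReal]), e2]
  · exact hf.ints 0 (by
      simp [accumulate, phase, greedyRound, choice, weight, demand, Stmt.KeepsInt])
  · exact hf.ints ord (by
      simp [accumulate, phase, greedyRound, choice, weight, demand, Stmt.KeepsInt]; omega)
  · rw [h, List.sum_cons, add_comm]

theorem execute_draws {s : Memory N K} (hs : HasInputs s cN cK ord σ) (hord : ord ≤ 2) :
    (execute .customer cN cK ord).Draws M O s ((greedyPolicy M O σ).law M) fun r s' =>
      s'.transcript = r.2.map Sum.inr ++ (r.1.map Sum.inl ++ s.transcript) := by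
  refine (phase_draws true hs hord).seq fun h _ t0 h0 hf => ?_
  have hK : t0.ints 0 0 cK = K := by
    rw [hf.ints 0 (by simp [phase, greedyRound, choice, weight, demand, Stmt.KeepsInt]), hs.2]
  refine Stmt.Draws.map (P := fun k t => t.transcript =
    k.map Sum.inr ++ (h.map Sum.inl ++ s.transcript)) ?_ _ fun k _ t' h' _ => h'
  refine (Stmt.Draws.loop (s := t0) (e := size cK) (E := K) hK ((showBacklog h).partialLaw M.supplier)
    (fun _ k => if hl : k.length < K then
      ((showBacklog h).next k hl).bind fun a =>
        ((M.supplier a.1).law a.2).map fun o => (a.1, a.2, o) :: k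
      else PMF.pure k) (fun _ => rfl) (a0 := []) rfl
    (fun _ k t => t.ints 7 = t0.ints 7 ∧ t.transcript =
      k.map Sum.inr ++ (h.map Sum.inl ++ s.transcript)) (fun _ => ⟨rfl, h0.2.trans (by simp [trace])⟩) ?_).mono
    fun k _ t h' _ => h'.2
  rintro c hc k hk t ⟨h7, htr⟩
  obtain ⟨-, rfl⟩ := (showBacklog h).isHistory_and_length_of_mem_support M.supplier c hc.le k hk
  simp only [dif_pos hc]
  rw [show (showBacklog h).next k hc = PMF.pure (⟨k.length, hc⟩, backlog h ⟨k.length, hc⟩)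
    from rfl, PMF.pure_bind]
  set t1 := (t.setInt 5 0 0 k.length).tick 1 with ht1
  have e5 : t1.ints 5 0 0 = k.length := by simp [ht1, Memory.setInt, Memory.tick]
  have e7 : t1.ints 7 = t0.ints 7 := h7
  have etr : t1.transcript = k.map Sum.inr ++ (h.map Sum.inl ++ s.transcript) := htr
  clear_value t1
  have eB : t1.getSet N 7 k.length = backlog h ⟨k.length, hc⟩ := by
    rw [Memory.getSet_congr e7]
    exact h0.1 ⟨k.length, hc⟩
  refine Stmt.Draws.map (P := fun o t' => t'.transcript =
    ((⟨k.length, hc⟩, backlog h ⟨k.length, hc⟩, o) :: k).map Sum.inr ++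
      (h.map Sum.inl ++ s.transcript)) ?_ _ fun o _ t' h' hf' =>
    ⟨(hf'.ints 7 (by simp [Stmt.KeepsInt])).trans e7, h'⟩
  refine .of_run_eq_map (f := fun o => (((t1.tick (1 + (var 5).size + (var 5).size +
    (IntExpr.lit 0).size + (IntExpr.lit 0).size + N + K)).setInt 9 0 0 (encodeOption o)).record
    (Sum.inr (⟨k.length, hc⟩, backlog h ⟨k.length, hc⟩, o)))) ?_ fun o => ?_
  · simp only [Stmt.run, Side.swap, var, IntExpr.eval, e5, hc, dif_pos, eB]
  · simp only [Memory.record, Memory.setInt, Memory.tick, etr, List.map_cons, List.cons_append]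

end Specification

/-! ### The whole program: law and running time -/

section Correctness

open Code

variable {n m : ℕ} {M : Market n m} {O : M.Oracle}

theorem Stmt.Draws.ifReal {α : Type} {a b : RealExpr} {p q : Stmt} {s : Memory n m} {μ : PMF α}
    {P : α → Memory n m → Prop}
    (hp : a.eval s.ints s.reals ≤ b.eval s.ints s.reals →
      p.Draws M O (s.tick (1 + a.size + b.size)) μ P)
    (hq : ¬ a.eval s.ints s.reals ≤ b.eval s.ints s.reals →
      q.Draws M O (s.tick (1 + a.size + b.size)) μ P) :
    (Stmt.ifReal a b p q).Draws M O s μ P := by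
  unfold Stmt.Draws
  rw [Stmt.run]
  split_ifs with h
  exacts [hp h, hq h]

theorem hasInputs_init (σC : Equiv.Perm (Fin n)) (σS : Equiv.Perm (Fin m)) (T : ℕ) :
    HasInputs (Memory.init σC σS T) 0 1 1 σC :=
  ⟨by simp [Memory.init], by simp [Memory.init], fun t ht => by simp [Memory.init, ht]⟩

theorem hasInputs_swap_init (σC : Equiv.Perm (Fin n)) (σS : Equiv.Perm (Fin m)) (T : ℕ) :
    HasInputs (Memory.init σC σS T).swap 1 0 2 σS :=
  ⟨by simp [Memory.init, Memory.swap], by simp [Memory.init, Memory.swap],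
    fun t ht => by simp [Memory.init, Memory.swap, ht]⟩

theorem estimates_bind {β : Type} (O : M.Oracle) (σC : Equiv.Perm (Fin n))
    (σS : Equiv.Perm (Fin m)) (T : ℕ) (F : ℝ × ℝ → PMF β) :
    (estimates M O σC σS T).bind F =
      (independentRuns (greedyRun M O σC) T).bind fun l =>
        (independentRuns (greedyRun M.swap O.swap σS) T).bind fun l' =>
          F (l.sum / T, l'.sum / T) := by
  simp only [estimates, sampleAverage, PMF.bind_bind, PMF.bind_map, PMF.map_comp,
    Function.comp_apply]
  rfl

theorem transcript_eq_of_swap {s : Memory n m} {r : List (Step m n) × List (Step n m)}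
    (h : s.swap.transcript = r.2.map Sum.inr ++ r.1.map Sum.inl) :
    s.transcript = r.2.map Sum.inl ++ r.1.map Sum.inr := by
  have h2 := congrArg (List.map Sum.swap) h
  have h3 : s.swap.transcript.map Sum.swap = s.transcript :=
    congrArg Memory.transcript s.swap_swap
  rw [h3] at h2
  rw [h2, List.map_append, List.map_map, List.map_map]
  rfl

theorem execute_selected_draws {s : Memory n m} {σC : Equiv.Perm (Fin n)}
    {σS : Equiv.Perm (Fin m)} (hC : HasInputs s 0 1 1 σC) (hS : HasInputs s.swap 1 0 2 σS)
    (htr : s.transcript = []) {e : ℝ × ℝ} (he0 : s.reals 0 0 = e.1) (he1 : s.reals 0 1 = e.2) :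
    (Stmt.ifReal (.cell 0 (.lit 1)) (.cell 0 (.lit 0)) (execute .customer 0 1 1)
      (execute .supplier 1 0 2)).Draws M O s
      (((selectedPolicy M O σC σS e).transcriptLaw M).map fun tr => (e, tr))
      fun x s' => ((s'.reals 0 0, s'.reals 0 1), s'.transcript) = x := by
  refine .ifReal (fun hle => ?_) fun hlt => ?_
  · have hle' : e.2 ≤ e.1 := by simpa [RealExpr.eval, IntExpr.eval, he0, he1] using hle
    rw [selectedPolicy, if_pos hle', OneSidedPolicy.transcriptLaw, PMF.map_comp]
    refine (execute_draws (s := s.tick _) (hC.congr rfl rfl) (by norm_num)).map _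
      fun r _ s' h hf => ?_
    have h0 : s'.reals 0 = s.reals 0 := hf.reals 0 (by
      simp [execute, phase, greedyRound, choice, weight, demand, Stmt.KeepsReal])
    rw [h0, he0, he1, h]
    simp [Memory.tick, htr]
  · have hlt' : ¬ e.2 ≤ e.1 := by simpa [RealExpr.eval, IntExpr.eval, he0, he1] using hlt
    rw [selectedPolicy, if_neg hlt', OneSidedPolicy.transcriptLaw, PMF.map_comp]
    refine (Stmt.Draws.swap (p := execute .customer 1 0 2) (s := s.tick _)
      (execute_draws (s := (s.tick _).swap) (hS.congr rfl rfl) le_rfl)).map _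
      fun r _ s' h hf => ?_
    have h0 : s'.reals 0 = s.reals 0 := hf.reals 0 (by
      simp [execute, phase, greedyRound, choice, weight, demand, Stmt.KeepsReal, Stmt.swap])
    have htr' : s.swap.transcript = [] := by simp [Memory.swap, htr]
    rw [h0, he0, he1, transcript_eq_of_swap (r := r) (by
      rw [h]
      simp [Memory.tick, Memory.swap, htr])]
    rfl

theorem samplingPolicy_draws (σC : Equiv.Perm (Fin n)) (σS : Equiv.Perm (Fin m)) (T : ℕ) :
    samplingPolicy.Draws M O (Memory.init σC σS T)
      ((estimates M O σC σS T).bind fun e =>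
        ((selectedPolicy M O σC σS e).transcriptLaw M).map fun tr => (e, tr))
      fun x s' => ((s'.reals 0 0, s'.reals 0 1), s'.transcript) = x := by
  rw [estimates_bind]
  -- Sampling one side leaves the sizes and both orders intact for the other side and for the actual
  -- run.
  have hkeep : ∀ a ≤ 2, ∀ cN cK ord, (sample .customer cN cK ord).KeepsInt a := by
    intro a ha cN cK ord
    simp [sample, accumulate, phase, greedyRound, choice, weight, demand, Stmt.KeepsInt]
    omega
  have hkeep' : ∀ a ≤ 2, ∀ cN cK ord, (sample .customer cN cK ord).swap.KeepsInt a := by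
    intro a ha cN cK ord
    simp [sample, accumulate, phase, greedyRound, choice, weight, demand, Stmt.KeepsInt, Stmt.swap]
    omega
  set s0 := Memory.init σC σS T with hs0
  have hC0 : HasInputs s0 0 1 1 σC := hasInputs_init σC σS T
  have hS0 : HasInputs s0.swap 1 0 2 σS := hasInputs_swap_init σC σS T
  have hT0 : s0.ints 0 0 2 = T := by simp [hs0, Memory.init]
  have htr0 : s0.transcript = [] := rfl
  clear_value s0
  refine (sample_draws hC0 (by norm_num) hT0).seq fun l _ s1 h1 hf1 => ?_
  refine .ends_seq (R := fun t => t.reals 0 0 = l.sum / T ∧ t.ints = s1.ints ∧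
    t.transcript = s1.transcript) (ends_setReal ⟨?_, rfl, rfl⟩) fun s2 h2 _ => ?_
  · simp [Memory.setReal, Memory.tick, RealExpr.eval, IntExpr.eval, rvar, Code.size, h1,
      hf1.ints 0 (hkeep 0 (by norm_num) _ _ _), hT0]
  have e2 : ∀ a ≤ 2, s2.ints a = s0.ints a := fun a ha => by
    rw [h2.2.1, hf1.ints a (hkeep a ha _ _ _)]
  have hS2 : HasInputs s2.swap 1 0 2 σS := hS0.congr (e2 0 (by norm_num)) (e2 2 le_rfl)
  refine (Stmt.Draws.swap (p := sample .customer 1 0 2) (sample_draws (s := s2.swap) hS2 le_rfl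
    (T := T) (by rw [← hT0, ← e2 0 (by norm_num)]; rfl))).seq fun l' _ s3 h3 hf3 => ?_
  have h3' : s3.reals 2 0 = l'.sum := h3
  refine .ends_seq (R := fun t => (t.reals 0 0 = l.sum / T ∧ t.reals 0 1 = l'.sum / T) ∧
    t.ints = s3.ints ∧ t.transcript = s3.transcript)
    (ends_setReal ⟨⟨?_, ?_⟩, rfl, rfl⟩) fun s4 h4 _ => ?_
  · have : s3.reals 0 = s2.reals 0 := hf3.reals 0 (by
      simp [sample, accumulate, phase, greedyRound, choice, weight, demand, Stmt.KeepsReal,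
        Stmt.swap])
    simpa [Memory.setReal, Memory.tick, IntExpr.eval, this] using h2.1
  · simp [Memory.setReal, Memory.tick, RealExpr.eval, IntExpr.eval, rvar, Code.size, h3',
      hf3.ints 0 (hkeep' 0 (by norm_num) _ _ _), e2, hT0]
  have e4 : ∀ a ≤ 2, s4.ints a = s0.ints a := fun a ha => by
    rw [h4.2.1, hf3.ints a (hkeep' a ha _ _ _), e2 a ha]
  refine execute_selected_draws (hC0.congr (e4 0 (by norm_num)) (e4 1 (by norm_num)))
    (hS0.congr (e4 0 (by norm_num)) (e4 2 le_rfl)) ?_ h4.1.1 h4.1.2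
  rw [h4.2.2, hf3.transcript (by
      simp [sample, accumulate, phase, greedyRound, choice, weight, demand, Stmt.KeepsTranscript,
        Stmt.swap]), h2.2.2, hf1.transcript (by
      simp [sample, accumulate, phase, greedyRound, choice, weight, demand,
        Stmt.KeepsTranscript]), htr0]

/-- This includes `T = 0`, where program and specification divide by zero under the same convention.
-/
theorem samplingPolicy_implements (O : M.Oracle) (σC : Equiv.Perm (Fin n))
    (σS : Equiv.Perm (Fin m)) (T : ℕ) :
    samplingPolicy.ImplementsSamplingPolicy M O σC σS T :=
  ((samplingPolicy_draws σC σS T).map_run _ id fun _ _ h => h).trans (PMF.map_id _)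

theorem samplingPolicy_steps_le (O : M.Oracle) (σC : Equiv.Perm (Fin n))
    (σS : Equiv.Perm (Fin m)) (T : ℕ) :
    ∀ s ∈ (samplingPolicy.run M O (Memory.init σC σS T)).support,
      s.steps ≤ samplingPolicy.costCoeff * (n + m + 1) ^ samplingPolicy.sizeDegree * (T + 1) := by
  intro s hs
  have h := samplingPolicy.steps_le M O T
    (by simp [samplingPolicy, sample, execute, accumulate, phase, greedyRound, choice, weight,
      demand, Stmt.BoundedLoops, Code.size])
    (by simp [samplingPolicy, sample, execute, accumulate, phase, greedyRound, choice, weight,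
      demand, Stmt.KeepsInt])
    (Memory.init σC σS T) (by simp [Memory.init]) (by simp [Memory.init]) (by simp [Memory.init])
    s hs
  -- The two loops over runs stand in sequence and are not nested, hence the bound is linear in `T +
  -- 1`.
  have hr : samplingPolicy.runDegree = 1 := rfl
  rw [Stmt.costBound, hr, pow_one, ← mul_assoc] at h
  exact h.trans_eq (by simp [Memory.init])

end Correctness

end

theorem corollary2 :
    ∃ κ : ℝ, 0 < κ ∧ ∃ (p : Stmt) (c d : ℕ),
      ∀ (n m : ℕ) (M : Market n m) (O : M.Oracle) (σC : Equiv.Perm (Fin n))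
        (σS : Equiv.Perm (Fin m)), M.HasMonotoneSubmodularDemand →
        -- one fixed program carries out the policy; its running time is polynomial in `n`, `m`
        -- and linear in the number `T` of simulated runs
        (∀ T : ℕ, p.ImplementsSamplingPolicy M O σC σS T ∧
          ∀ s ∈ (p.run M O (Memory.init σC σS T)).support,
            s.steps ≤ c * (n + m + 1) ^ d * (T + 1)) ∧
        -- with the stated number of runs, with high probability, the selected policy is a
        -- `(1/2 - ε)`-approximation, and so is the estimate of its value
        (∀ ε δ : ℝ, 0 < ε → 0 < δ → δ < 1 → ∀ T : ℕ,
          κ * (Real.log (1 / δ) / (ε ^ 2 * M.phiMin)) ≤ T →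
          ENNReal.ofReal (1 - 2 * δ) ≤ (estimates M O σC σS T).toOuterMeasure
            {e | ENNReal.ofReal (1 / 2 - ε) * M.opt ≤ (selectedPolicy M O σC σS e).value M ∧
              ENNReal.ofReal (1 / 2 - ε) * M.opt ≤ ENNReal.ofReal (max e.1 e.2)}) ∧
        -- under weak substitutability the benchmark is the optimum over all policies
        (M.WeaklySubstitutable → M.opt = M.optUnrestricted) :=
  ⟨64, by norm_num, Code.samplingPolicy, Code.samplingPolicy.costCoeff,
    Code.samplingPolicy.sizeDegree, fun _ _ _ O σC σS hM =>
      ⟨fun T => ⟨samplingPolicy_implements O σC σS T, samplingPolicy_steps_le O σC σS T⟩,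
        fun _ _ hε hδ hδ1 T hT => estimates_good hM O σC σS hε hδ hδ1 T hT,
        fun hw => Market.opt_eq_optUnrestricted hM hw⟩⟩
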